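/- **Conventions.** A tracial $\mathrm{W}^*$-algebra $(\mathcal M,\tau)$ is a von Neumann algebra with a faithful normal tracial state; $\|a\|_2=\tau(a^*a)^{1/2}$. $M_n(\mathbb C)$ carries the normalized trace $\tau_n$, and $M_n(\mathbb C)_{sa}^I$ carries the product topology and its Borel $\sigma$-algebra. The law of a self-adjoint tuple $\mathbf x=(x_i)_{i\in I}$ is the functional $\lambda_{\mathbf x}(p)=\tau(p(\mathbf x))$ on $\mathbb C\langle t_i:i\in I\rangle$. For $\mathbf R\in(0,\infty)^I$, $\Sigma_{\mathbf R}$ is the space of unital, positive, tracial linear functionals $\lambda$ on $\mathbb C\langle t_i : i\in I\rangle$ with $|\lambda(t_{i(1)}\cdots t_{i(\ell)})|\le R_{i(1)}\cdots R_{i(\ell)}$, with the topology of pointwise convergence. *Functions.* For $f=\sum_j\phi_j\otimes p_j\in\mathcal A_{\mathbf R}=C(\Sigma_{\mathbf R})\otimes\mathbb C\langle t_i:i\in I\rangle$ and a self-adjoint tuple $\mathbf x$ with $\|x_i\|\le R_i$ put $f(\mathbf x)=\sum_j\phi_j(\lambda_{\mathbf x})p_j(\mathbf x)$, and let $\|f\|_{\mathbf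 R,2}=\sup\|f(\mathbf x)\|_2$ over all tracial $\mathrm{W}^*$-algebras and all such $\mathbf x$. $\mathcal F_{\mathbf R,2}$ is the (separated) completion of $\mathcal A_{\mathbf R}$; its elements have values $f(\mathbf x)\in L^2(\mathcal M)$. For index sets $I,I'$, $\mathcal F_{\mathbf R,\mathbf R'}$ is the set of tuples $\mathbf f=(f_j)_{j\in I'}$ in $\mathcal F_{\mathbf R,2}$ such that all values $f_j(\mathbf x)$ are self-adjoint elements of $\mathcal M$ with $\|f_j(\mathbf x)\|\le R'_j$. *Neighborhoods.* For finite $F\subseteq I$ and $\varepsilon>0$, $N_{F,\varepsilon}(\Omega)$ is the set of $\mathbf B\in M_n(\mathbb C)_{sa}^I$ such that some $\mathbf A\in\Omega$ has $\|A_i-B_i\|_2<\varepsilon$ for all $i\in F$; $N_{F,\varepsilon}(\mathbf A)=N_{F,\varepsilon}(\{\mathbf A\})$. $K_{F,\varepsilon}(\Omega)=\inf\{|\Omega_0|:\Omega_0\subseteq\Omega\subseteq N_{F,\varepsilon}(\Omega_0)\}$. Probability measures $\mu^{(k)}$ on $M_{n(k)}(\mathbb C)_{sa}^I$ have *exponential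 concentration* if for all finite $F\subseteq I$ and $\varepsilon>0$, $\limsup_k n(k)^{-2}\log\alpha_{\mu^{(k)}}(F,\varepsilon)<0$, where $\alpha_\mu(F,\varepsilon)=\sup\{\mu(N_{F,\varepsilon}(\Omega)^c):\Omega\text{ Borel},\ \mu(\Omega)\ge 1/2\}$. *Microstates.* Matrices $C^{(k)}\in M_{n(k)}(\mathbb C)_{sa}$ are microstates for $z=z^*\in\mathcal M$, written $C^{(k)}\rightsquigarrow z$, if $\lambda_{C^{(k)}}\to\lambda_z$ pointwise. For a neighborhood $\mathcal U$ of $\lambda_{(\mathbf x,z)}$ in $\Sigma_{(\mathbf R,R_0)}$, $\Gamma_{(\mathbf R,R_0),n(k)}(\mathbf x|C^{(k)}\rightsquigarrow z;\mathcal U)$ is the set of $\mathbf A\in M_{n(k)}(\mathbb C)_{sa}^I$ with $\|A_i\|\le R_i$ and $\lambda_{(\mathbf A,C^{(k)})}\in\mathcal U$. For a neighborhood $\mathcal U$ of $\lambda_{(\mathbf x,\mathbf y,z)}$ in $\Sigma_{(\mathbf R,\mathbf R',R_0)}$, $\Gamma_n(\mathbf y:\mathbf x|C^{(n)}\rightsquigarrow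 z;\mathcal U)$ is the set of self-adjoint $\mathbf B$ with $\|B_j\|\le R'_j$ such that some self-adjoint $\mathbf A$ with $\|A_i\|\le R_i$ satisfies $\lambda_{(\mathbf A,\mathbf B,C^{(n)})}\in\mathcal U$. *$1$-bounded entropy.* For $\mathcal N\le\mathcal M$, $$h(\mathcal N:\mathcal M)=\sup_{F,\varepsilon}\inf_{\mathcal U}\limsup_{n\to\infty}\frac1{n^2}\log K_{F,\varepsilon}\bigl(\Gamma_n(\tilde{\mathbf y}:\tilde{\mathbf x}|\tilde C^{(n)}\rightsquigarrow\tilde z;\mathcal U)\bigr)\in[-\infty,\infty],$$ computed from any choice of self-adjoint generating tuples $\tilde{\mathbf x}$ of $\mathcal M$ and $\tilde{\mathbf y}$ of $\mathcal N$, a self-adjoint $\tilde z\in\mathcal N$ with diffuse spectrum, bounds $\tilde R_i>\|\tilde x_i\|$, $\tilde R'_j>\|\tilde y_j\|$, $\tilde R_0>\|\tilde z\|$, and microstates $\tilde C^{(n)}\in M_n(\mathbb C)_{sa}$, $\tilde C^{(n)}\rightsquigarrow\tilde z$, $\|\tilde C^{(n)}\|\le\tilde R_0$; here $F$ runs over the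 finite subsets of the index set of $\tilde{\mathbf y}$. The value is known to be independent of the choices; the hypothesis $h(\mathcal N:\mathcal M)=0$ below means that it is $0$ for some choice. **Proposition.** Let $(\mathcal M,\tau)$ be a tracial $\mathrm{W}^*$-algebra generated by the self-adjoint tuple $\mathbf x\in\mathcal M_{sa}^I$. Let $\mathbf y\in\mathcal M_{sa}^{I'}$, with $I,I'$ arbitrary index sets, and let $z\in\mathcal M$ be self-adjoint with diffuse spectrum (its spectral distribution with respect to $\tau$ has no atoms). Let $\mathcal N=\mathrm{W}^*(\mathbf y,z)$ and suppose that $h(\mathcal N:\mathcal M)=0$. Let $\|x_i\|<R_i$, $\|y_j\|<R'_j$, $\|z\|<R_0$, and let $\mathbf y=\mathbf f(\mathbf x)$ for some $\mathbf f\in\mathcal F_{\mathbf R,\mathbf R'}$. Let $n(k)\to\infty$, and let $C^{(k)}\in M_{n(k)}(\mathbb C)_{sa}$ be microstates for $z$ with $\|C^{(k)}\|<R_0$. Let $\mu^{(k)}$ be Borel probability measures on $M_{n(k)}(\mathbb C)_{sa}^I$ supported on $\{\mathbf A:\|A_i\|\le R_i\ \forall i\}$ (the complement is null) such that $$\mu^{(k)}\bigl(\Gamma_{(\mathbf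 R,R_0),n(k)}(\mathbf x|C^{(k)}\rightsquigarrow z;\mathcal U)\bigr)\to1$$ for every neighborhood $\mathcal U$ of $\lambda_{(\mathbf x,z)}$ in $\Sigma_{(\mathbf R,R_0)}$, and suppose that $(\mu^{(k)})$ has exponential concentration. Then there exist tuples $\mathbf B^{(k)}\in M_{n(k)}(\mathbb C)_{sa}^{I'}$ with $\|B^{(k)}_j\|\le R'_j$ such that for every finite $F\subseteq I'$ and every $\varepsilon>0$, $$\lim_{k\to\infty}(\mathbf f_*\mu^{(k)})\bigl(N_{F,\varepsilon}(\mathbf B^{(k)})\bigr)=1.$$ -/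

import Mathlib

open scoped ENNReal Topology ComplexConjugate ComplexOrder TensorProduct
open Filter MeasureTheory

noncomputable section

namespace Microstate

universe u v w w'

/-! ### Tracial von Neumann algebras -/

section Algebras

variable {H : Type u} [NormedAddCommGroup H] [InnerProductSpace ℂ H] [CompleteSpace H]

/-- `τ` is a faithful normal tracial state on the von Neumann algebra `M` on `H`, so that
`(M, τ)` is a tracial `W*`-algebra. Normality is continuity for the `σ`-weak topology. -/
structure IsFaithfulNormalTrace (M : VonNeumannAlgebra H)
    (τ : M.toStarSubalgebra →ₗ[ℂ] ℂ) : Prop where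
  map_one : τ 1 = 1
  nonneg : ∀ a : M.toStarSubalgebra, 0 ≤ τ (star a * a)
  faithful : ∀ a : M.toStarSubalgebra, τ (star a * a) = 0 → a = 0
  tracial : ∀ a b : M.toStarSubalgebra, τ (a * b) = τ (b * a)
  normal : ∃ ξ η : ℕ → H, Summable (fun n => ‖ξ n‖ ^ 2) ∧ Summable (fun n => ‖η n‖ ^ 2) ∧
    ∀ a : M.toStarSubalgebra, HasSum (fun n => inner ℂ (η n) ((a : H →L[ℂ] H) (ξ n))) (τ a)

/-- `W*(S)`: the von Neumann algebra generated by `S`, that is, the double commutant of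
`S ∪ S*`. -/
def generatedVN (S : Set (H →L[ℂ] H)) : VonNeumannAlgebra H where
  toStarSubalgebra :=
    StarSubalgebra.centralizer ℂ (StarSubalgebra.centralizer ℂ S : Set (H →L[ℂ] H))
  centralizer_centralizer' := by
    change Set.centralizer (Set.centralizer ((StarSubalgebra.centralizer ℂ
      (StarSubalgebra.centralizer ℂ S : Set (H →L[ℂ] H)) : StarSubalgebra ℂ (H →L[ℂ] H)) :
        Set (H →L[ℂ] H))) = _
    rw [StarSubalgebra.coe_centralizer_centralizer, Set.centralizer_centralizer_centralizer]
    exact (StarSubalgebra.coe_centralizer_centralizer (R := ℂ) S).symm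

/-- `W*(x)` for a tuple `x` of elements of `M`. -/
def tupleVN {M : VonNeumannAlgebra H} {J : Type w} (x : J → M.toStarSubalgebra) :
    VonNeumannAlgebra H :=
  generatedVN (Set.range fun j => (x j : H →L[ℂ] H))

end Algebras

/-! ### Non-commutative laws

The next notions make sense in any complex `*`-algebra with a linear functional; they are used
for tracial von Neumann algebras and for the algebra of `n × n` matrices with its normalized
trace. -/

section Laws

variable {I : Type v} {A : Type u} [Ring A] [Algebra ℂ A]

/-- The `2`-norm `‖a‖₂ = τ(a* a)^{1/2}`. -/
def twoNorm [StarRing A] (τ : A →ₗ[ℂ] ℂ) (a : A) : ℝ := Real.sqrt (τ (star a * a)).re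

/-- The conjugate-linear anti-multiplicative involution of `ℂ⟨t_i : i ∈ I⟩` that fixes every
`t_i`: on words, `(∑ c_w w)* = ∑ conj(c_w) reverse(w)`. (The `star` of `FreeAlgebra` does not
conjugate the coefficients.) -/
def ncStar (p : FreeAlgebra ℂ I) : FreeAlgebra ℂ I :=
  Finsupp.sum (FreeAlgebra.equivMonoidAlgebraFreeMonoid p).coeff fun w c =>
    conj c • FreeAlgebra.equivMonoidAlgebraFreeMonoid.symm (MonoidAlgebra.of ℂ _ (star w))

/-- Evaluation at a self-adjoint tuple is a `*`-homomorphism. -/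
theorem lift_ncStar [StarRing A] [StarModule ℂ A] (x : I → A) (hx : ∀ i, IsSelfAdjoint (x i))
    (p : FreeAlgebra ℂ I) : FreeAlgebra.lift ℂ x (ncStar p) = star (FreeAlgebra.lift ℂ x p) := by
  have hw : ∀ w : FreeMonoid I, FreeAlgebra.lift ℂ x
      (FreeAlgebra.equivMonoidAlgebraFreeMonoid.symm (MonoidAlgebra.of ℂ _ w)) =
      FreeMonoid.lift x w := by
    intro w
    simp [FreeAlgebra.equivMonoidAlgebraFreeMonoid, FreeMonoid.lift_apply, map_list_prod]
  have hs : ∀ w : FreeMonoid I, FreeMonoid.lift x (star w) = star (FreeMonoid.lift x w) := by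
    intro w
    induction w using FreeMonoid.inductionOn' with
    | one => simp
    | of_mul i w ih => simp [ih, (hx i).star_eq]
  obtain ⟨q, rfl⟩ := FreeAlgebra.equivMonoidAlgebraFreeMonoid.symm.surjective p
  have : q = q.coeff.sum fun w c => c • MonoidAlgebra.of ℂ _ w := by
    apply MonoidAlgebra.coeff_injective
    have h := q.coeff.sum_single
    simpa [MonoidAlgebra.of, Finsupp.sum] using h.symm
  conv_rhs => rw [this]
  simp only [ncStar, Finsupp.sum, map_sum, AlgEquiv.apply_symm_apply, star_sum, map_smul, hw, hs,
    star_smul]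
  rfl

/-- The non-commutative law `p ↦ τ(p(x))` of a tuple `x`. -/
def law (τ : A →ₗ[ℂ] ℂ) (x : I → A) : FreeAlgebra ℂ I → ℂ :=
  fun p => τ (FreeAlgebra.lift ℂ x p)

/-- `Σ_R`: the tracial non-commutative laws bounded by `R`. As a subset of
`FreeAlgebra ℂ I → ℂ` it carries the topology of pointwise convergence. -/
def lawSpace (R : I → ℝ) : Set (FreeAlgebra ℂ I → ℂ) :=
  {l | IsLinearMap ℂ l ∧ l 1 = 1 ∧ (∀ p, 0 ≤ l (ncStar p * p)) ∧ (∀ p q, l (p * q) = l (q * p)) ∧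
    ∀ w : List I, ‖l (w.map (FreeAlgebra.ι ℂ)).prod‖ ≤ (w.map R).prod}

/-- `𝒜_R = C(Σ_R) ⊗ ℂ⟨t_i : i ∈ I⟩`. -/
abbrev SimpleFun (R : I → ℝ) : Type v :=
  C(lawSpace R, ℂ) ⊗[ℂ] FreeAlgebra ℂ I

open Classical in
/-- The functional `φ ↦ φ(λ)` on `C(Σ_R)`, for `λ ∈ Σ_R` (and `0` otherwise). -/
def evalAtLaw (R : I → ℝ) (l : FreeAlgebra ℂ I → ℂ) : C(lawSpace R, ℂ) →ₗ[ℂ] ℂ :=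
  if h : l ∈ lawSpace R then
    { toFun := fun φ => φ ⟨l, h⟩
      map_add' := fun _ _ => rfl
      map_smul' := fun _ _ => rfl }
  else 0

/-- The evaluation `ev_x : 𝒜_R → A`, `φ ⊗ p ↦ φ(λ_x) p(x)`. -/
def evalSimple (R : I → ℝ) (τ : A →ₗ[ℂ] ℂ) (x : I → A) : SimpleFun R →ₗ[ℂ] A :=
  TensorProduct.lift
    (LinearMap.toSpanSingleton ℂ _ (FreeAlgebra.lift ℂ x).toLinearMap ∘ₗ evalAtLaw R (law τ x))

theorem evalSimple_tmul (R : I → ℝ) (τ : A →ₗ[ℂ] ℂ) (x : I → A) (h : law τ x ∈ lawSpace R)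
    (φ : C(lawSpace R, ℂ)) (p : FreeAlgebra ℂ I) :
    evalSimple R τ x (φ ⊗ₜ p) = φ ⟨law τ x, h⟩ • FreeAlgebra.lift ℂ x p := by
  simp [evalSimple, evalAtLaw, h]

end Laws

/-! ### The `L²`-continuous functional calculus -/

section FunctionalCalculus

/-- Self-adjoint tuples `x` in `M` with `‖x_i‖ ≤ R_i`. -/
def boundedTuples {H : Type u} [NormedAddCommGroup H] [InnerProductSpace ℂ H] [CompleteSpace H]
    (M : VonNeumannAlgebra H) {I : Type v} (R : I → ℝ) : Set (I → M.toStarSubalgebra) :=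
  {x | ∀ i, IsSelfAdjoint (x i) ∧ ‖x i‖ ≤ R i}

/-- `‖f‖_{R,2}`: the supremum of `‖ev_x(f)‖₂` over all tracial `W*`-algebras and all self-adjoint
tuples `x` with `‖x_i‖ ≤ R_i`. The algebras range over the universe of the index set, which
contains the GNS algebra of every law in `Σ_R`. -/
def twoNormSup {I : Type v} (R : I → ℝ) (f : SimpleFun R) : ℝ≥0∞ :=
  ⨆ (H : Type v) (_ : NormedAddCommGroup H) (_ : InnerProductSpace ℂ H) (_ : CompleteSpace H)
    (M : VonNeumannAlgebra H) (τ : M.toStarSubalgebra →ₗ[ℂ] ℂ) (_ : IsFaithfulNormalTrace M τ)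
    (x : I → M.toStarSubalgebra) (_ : x ∈ boundedTuples M R),
      ENNReal.ofReal (twoNorm τ (evalSimple R τ x f))

/-- The elements of the completion `ℱ_{R,2}` of `(𝒜_R, ‖·‖_{R,2})`, given by the Cauchy sequences
that represent them. -/
def L2Fun {I : Type v} (R : I → ℝ) : Set (ℕ → SimpleFun R) :=
  {f | ∀ ε : ℝ≥0∞, 0 < ε → ∃ N, ∀ m ≥ N, ∀ n ≥ N, twoNormSup R (f m - f n) ≤ ε}

/-- `f(x) = b`: the value in `L²(M)` at `x` of the element represented by `f`, which is the limit
of `ev_x(f_m)` in the `2`-norm, is `b`. -/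
def HasValue {I : Type v} {A : Type u} [Ring A] [Algebra ℂ A] [StarRing A] (R : I → ℝ)
    (τ : A →ₗ[ℂ] ℂ) (x : I → A) (f : ℕ → SimpleFun R) (b : A) : Prop :=
  Tendsto (fun m => twoNorm τ (evalSimple R τ x (f m) - b)) atTop (𝓝 0)

/-- `ℱ_{R,R'}`: the tuples of self-adjoint elements `f_j` of `ℱ_{R,∞}` with
`‖f_j‖_{R,∞} ≤ R'_j`, that is, for every bounded tuple `x` from a tracial `W*`-algebra `(M, τ)`
the value `f_j(x)` is a self-adjoint element of `M` of norm at most `R'_j`. -/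
def FunTuples {I : Type v} {I' : Type w} (R : I → ℝ) (R' : I' → ℝ) :
    Set (I' → ℕ → SimpleFun R) :=
  {f | ∀ j, f j ∈ L2Fun R ∧
    ∀ (H : Type v) (_ : NormedAddCommGroup H) (_ : InnerProductSpace ℂ H) (_ : CompleteSpace H)
      (M : VonNeumannAlgebra H) (τ : M.toStarSubalgebra →ₗ[ℂ] ℂ), IsFaithfulNormalTrace M τ →
      ∀ x ∈ boundedTuples M R, ∃ b : M.toStarSubalgebra,
        IsSelfAdjoint b ∧ ‖b‖ ≤ R' j ∧ HasValue R τ x (f j) b}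

end FunctionalCalculus

/-! ### Tuples of matrices -/

section Matrices

/-- The algebra `M_n(ℂ)`. -/
abbrev Mat (n : ℕ) : Type := Matrix (Fin n) (Fin n) ℂ

/-- The normalized trace on `M_n(ℂ)`. -/
def ntr (n : ℕ) : Mat n →ₗ[ℂ] ℂ := (n : ℂ)⁻¹ • Matrix.traceLinearMap (Fin n) ℂ ℂ

/-- The operator norm on `M_n(ℂ)`. -/
def opNorm {n : ℕ} (A : Mat n) : ℝ := ‖Matrix.toEuclideanCLM (n := Fin n) (𝕜 := ℂ) A‖

/-- `M_n(ℂ)_sa^I`, with the product topology and its Borel `σ`-algebra. -/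
def MatTuple (I : Type v) (n : ℕ) : Type v := I → selfAdjoint (Mat n)

instance (I : Type v) (n : ℕ) : TopologicalSpace (MatTuple I n) :=
  inferInstanceAs (TopologicalSpace (I → selfAdjoint (Mat n)))

instance (I : Type v) (n : ℕ) : MeasurableSpace (MatTuple I n) := borel _

instance (I : Type v) (n : ℕ) : BorelSpace (MatTuple I n) := ⟨rfl⟩

variable {I : Type v} {n : ℕ}

/-- A tuple of self-adjoint matrices as a tuple in the algebra `M_n(ℂ)`. -/
def MatTuple.toMat (A : MatTuple I n) : I → Mat n := fun i => (A i : Mat n)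

/-- The tuples `A` with `‖A_i‖ ≤ R_i`. -/
def matBall (R : I → ℝ) (n : ℕ) : Set (MatTuple I n) := {A | ∀ i, opNorm (A.toMat i) ≤ R i}

/-- The `(F, ε)`-neighborhood of a set of tuples. -/
def nbhd (F : Finset I) (ε : ℝ) (Ω : Set (MatTuple I n)) : Set (MatTuple I n) :=
  {B | ∃ A ∈ Ω, ∀ i ∈ F, twoNorm (ntr n) (A.toMat i - B.toMat i) < ε}

/-- The covering number `K_{F,ε}(Ω)`. -/
def coveringNumber (F : Finset I) (ε : ℝ) (Ω : Set (MatTuple I n)) : ℕ∞ :=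
  ⨅ (Ω₀ : Set (MatTuple I n)) (_ : Ω₀ ⊆ Ω) (_ : Ω ⊆ nbhd F ε Ω₀), Ω₀.encard

/-- The concentration function `α_μ(F, ε)`. -/
def concentration (μ : Measure (MatTuple I n)) (F : Finset I) (ε : ℝ) : ℝ≥0∞ :=
  ⨆ (Ω : Set (MatTuple I n)) (_ : MeasurableSet Ω) (_ : 1 / 2 ≤ μ Ω), μ (nbhd F ε Ω)ᶜ

/-- Exponential concentration of measure at the scale `n(k)²`. -/
def ExponentialConcentration (n : ℕ → ℕ) (μ : ∀ k, Measure (MatTuple I (n k))) : Prop :=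
  ∀ (F : Finset I) (ε : ℝ), 0 < ε →
    limsup (fun k => ((((n k : ℝ) ^ 2)⁻¹ : ℝ) : EReal) *
      ENNReal.log (concentration (μ k) F ε)) atTop < 0

/-- The map `A ↦ f(A)` on `M_n(ℂ)_sa^I`. Here `f_j(A)` is the limit of `ev_A(f_{j,m})` in
`M_n(ℂ)`; for `f` in `ℱ_{R,R'}` and `‖A_i‖ ≤ R_i` this limit exists and is self-adjoint, and then
`selfAdjointPart` only records its self-adjointness in the type. -/
def matEval {I' : Type w} (R : I → ℝ) (f : I' → ℕ → SimpleFun R) (n : ℕ) (A : MatTuple I n) :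
    MatTuple I' n :=
  fun j => selfAdjointPart ℝ (limUnder atTop fun m => evalSimple R (ntr n) A.toMat (f j m))

end Matrices

/-! ### Microstate spaces and `1`-bounded entropy -/

section Entropy

/-- The tuple `(a, c)` with one additional entry `c`. -/
abbrev join₂ {I : Type v} {A : Type u} (a : I → A) (c : A) : I ⊕ Unit → A :=
  Sum.elim a fun _ => c

/-- The tuple `(a, b, c)`. -/
abbrev join₃ {I : Type v} {J : Type w} {A : Type u} (a : I → A) (b : J → A) (c : A) :
    I ⊕ J ⊕ Unit → A :=
  Sum.elim a (join₂ b c)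

/-- The microstate space `Γ_{(R,R₀),n}(x | C ⇝ z; U)`, for `U` a neighborhood of `λ_{(x,z)}`. -/
def microstates {I : Type v} (R : I → ℝ) {n : ℕ} (C : selfAdjoint (Mat n))
    (U : Set (FreeAlgebra ℂ (I ⊕ Unit) → ℂ)) : Set (MatTuple I n) :=
  {A | A ∈ matBall R n ∧ law (ntr n) (join₂ A.toMat (C : Mat n)) ∈ U}

/-- The microstate space `Γ_{(R,R',R₀),n}(y : x | C ⇝ z; U)` of `y` in the presence of `x`, for
`U` a neighborhood of `λ_{(x,y,z)}`. -/
def microstatesPresence {I : Type v} {J : Type w} (R : I → ℝ) (R' : J → ℝ) {n : ℕ}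
    (C : selfAdjoint (Mat n)) (U : Set (FreeAlgebra ℂ (I ⊕ J ⊕ Unit) → ℂ)) :
    Set (MatTuple J n) :=
  {B | ∃ A : MatTuple I n, A ∈ matBall R n ∧ B ∈ matBall R' n ∧
    law (ntr n) (join₃ A.toMat B.toMat (C : Mat n)) ∈ U}

variable {H : Type u} [NormedAddCommGroup H] [InnerProductSpace ℂ H] [CompleteSpace H]
  {M : VonNeumannAlgebra H}

/-- `C^(k) ⇝ z`: the laws of the matrices `C^(k)` converge to the law of `z`. -/
def IsMicrostateSeq (τ : M.toStarSubalgebra →ₗ[ℂ] ℂ) (z : M.toStarSubalgebra) (n : ℕ → ℕ)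
    (C : ∀ k, selfAdjoint (Mat (n k))) : Prop :=
  Tendsto (fun k => law (ntr (n k)) fun _ : Unit => (C k : Mat (n k))) atTop
    (𝓝 (law τ fun _ : Unit => z))

/-- `z` is self-adjoint with diffuse spectrum: its spectral distribution with respect to `τ` (the
compactly supported probability measure on `ℝ` with the moments `τ(z^m)`) has no atoms. -/
def IsDiffuse (τ : M.toStarSubalgebra →ₗ[ℂ] ℂ) (z : M.toStarSubalgebra) : Prop :=
  IsSelfAdjoint z ∧ ∃ ν : Measure ℝ, IsProbabilityMeasure ν ∧ NullSingletonClass ν ∧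
    (∃ K : Set ℝ, IsCompact K ∧ ν Kᶜ = 0) ∧
    ∀ m : ℕ, τ (z ^ m) = ((∫ t, t ^ m ∂ν : ℝ) : ℂ)

/-- The expression `sup_{F,ε} inf_U limsup_n n⁻² log K_{F,ε}(Γ_{R,n}(y : x | C^(n) ⇝ z; U))`
that defines the `1`-bounded entropy in terms of the chosen generators `x` and `y`, the chosen
`z`, the microstates `C` for `z` and the cut-offs. -/
def entropyOf {J : Type w} {L : Type w'} (τ : M.toStarSubalgebra →ₗ[ℂ] ℂ)
    (x : J → M.toStarSubalgebra) (y : L → M.toStarSubalgebra) (z : M.toStarSubalgebra)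
    (R : J → ℝ) (R' : L → ℝ) (R₀ : ℝ) (C : ∀ n, selfAdjoint (Mat n)) : EReal :=
  ⨆ (F : Finset L) (ε : ℝ) (_ : 0 < ε),
    ⨅ U ∈ 𝓝[lawSpace (join₃ R R' R₀)] law τ (join₃ x y z),
      limsup (fun n : ℕ => ((((n : ℝ) ^ 2)⁻¹ : ℝ) : EReal) *
        ENNReal.log (coveringNumber F ε (microstatesPresence R R' (C n) U) : ℝ≥0∞)) atTop

/-- `h(N : M) = h`: the `1`-bounded entropy of `N` in the presence of `M`, computed from some
self-adjoint generating tuples `x` of `M` and `y` of `N`, some self-adjoint `z` in `N` with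
diffuse spectrum, some microstates `C^(n) ⇝ z` and some cut-offs, equals `h`. (It is known not to
depend on these choices; no such independence is built into the definition.) -/
def HasOneBoundedEntropy (τ : M.toStarSubalgebra →ₗ[ℂ] ℂ) (N : VonNeumannAlgebra H)
    (h : EReal) : Prop :=
  ∃ (J : Type w) (L : Type w') (x : J → M.toStarSubalgebra) (y : L → M.toStarSubalgebra)
    (z : M.toStarSubalgebra) (R : J → ℝ) (R' : L → ℝ) (R₀ : ℝ) (C : ∀ n, selfAdjoint (Mat n)),
    (∀ j, IsSelfAdjoint (x j) ∧ ‖x j‖ < R j) ∧ tupleVN x = M ∧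
    (∀ l, IsSelfAdjoint (y l) ∧ ‖y l‖ < R' l) ∧ tupleVN y = N ∧
    IsDiffuse τ z ∧ (z : H →L[ℂ] H) ∈ N ∧ ‖z‖ < R₀ ∧
    (∀ n, opNorm (C n : Mat n) ≤ R₀) ∧ IsMicrostateSeq τ z (fun n => n) C ∧
    entropyOf τ x y z R R' R₀ C = h

end Entropy

end Microstate

end

noncomputable section

namespace Microstate

universe u v w w'

/-! ### Tracial states on C⋆-algebras -/

/-! Vanishing entropy makes the set of possible values of `f_j` small, while exponential
concentration forbids a law from spreading over a small set. Fix `j` and `ε`. The values `f_j(A)`,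
for `A` a microstate of `x` relative to `C ⇝ z`, are covered by `exp(κ n²)` balls for any prescribed
`κ > 0` (`exists_cover_matEval`). By concentration, a set of measure above `exp(r n²)`, with a
certain `r < 0`, has a doubled neighborhood of almost full measure (`measure_compl_nbhd_nbhd_le`).
If `κ = -r/2`, the pigeonhole principle gives one ball whose preimage is above this threshold. Since
`f_j` is uniformly `2`-norm continuous on bounded matrix tuples, uniformly in the size
(`exists_twoNorm_matEval_sub_lt`), almost every `A` has `f_j(A)` within `ε` of the center of that
ball (`eventually_exists_concentrated`). A diagonal argument then removes the dependence on `ε`.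

The work lies in the covering, because the entropy is given to be `0` only for some generators `x'`,
`y'`, some `z'` and some microstates `C'`, unrelated to `x`, `y`, `z`, `C`. Approximate `x'`, `y'`,
`z'` by polynomials in `x` that respect the norm bounds on all bounded tuples
(`exists_bounded_lift_approx`). Evaluated at `A`, they give almost microstates, except that the
matrix in the place of `z'` is not `C'`. It has nearly the same moments as `C'`, so a unitary `u`
conjugates it close to `C'` (`exists_unitary_conj_close`). As `y_j` and `z` are approximately
polynomials in `y'`, the pairs `(u f_j(A) u*, u C u*)` are covered by `exp(κ n²)` balls
(`exists_cover_up_to_conjugation`).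

To remove `u`, compare two tuples that land in the same ball: the quotient of their unitaries almost
commutes with `C`. In an eigenbasis of `C` such a unitary is concentrated on the pairs of close
eigenvalues, and diffuseness of `z` leaves only a small proportion of the `n²` pairs
(`IsDiffuse.eventually_card_closePairs_le`). The almost commuting unitaries thus have a net of small
exponential size (`exists_net_near_commutant`), which multiplies the cover harmlessly. -/

/-- `τ` is a tracial state on the C⋆-algebra `A`. -/
structure IsTracialState {A : Type u} [CStarAlgebra A] (τ : A →ₗ[ℂ] ℂ) : Prop where
  map_one : τ 1 = 1
  nonneg : ∀ a : A, 0 ≤ τ (star a * a)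
  tracial : ∀ a b : A, τ (a * b) = τ (b * a)

namespace IsTracialState

variable {A : Type u} [CStarAlgebra A] {τ : A →ₗ[ℂ] ℂ}

theorem exists_positive [PartialOrder A] [StarOrderedRing A] (hτ : IsTracialState τ) :
    ∃ f : A →ₚ[ℂ] ℂ, ∀ a, f a = τ a :=
  ⟨PositiveLinearMap.mk₀ τ fun a ha => by
    obtain ⟨b, rfl⟩ := CStarAlgebra.nonneg_iff_eq_star_mul_self.1 ha
    exact hτ.nonneg b, fun _ => rfl⟩

/-- The GNS seminorm. It reduces the inequalities for the `2`-norm to those of a semi-inner product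
space on which left multiplication is bounded. -/
theorem exists_norm (hτ : IsTracialState τ) :
    ∃ (E : Type u) (_ : SeminormedAddCommGroup E) (_ : InnerProductSpace ℂ E) (j : A →ₗ[ℂ] E),
      (∀ a b, inner ℂ (j a) (j b) = τ (star a * b)) ∧ (∀ a, ‖j a‖ = twoNorm τ a) ∧
      ∀ a b, ‖j (a * b)‖ ≤ ‖a‖ * ‖j b‖ := by
  let _ := CStarAlgebra.spectralOrder A
  have := CStarAlgebra.spectralOrderedRing A
  obtain ⟨f, hf⟩ := hτ.exists_positive
  refine ⟨f.PreGNS, inferInstance, inferInstance, f.toPreGNS.toLinearMap, ?_, ?_, ?_⟩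
  · intro a b
    exact hf _
  · intro a
    rw [twoNorm, ← hf]
    rfl
  · intro a b
    have h := (f.leftMulMapPreGNS a).le_of_opNorm_le
      (LinearMap.mkContinuous_norm_le _ (norm_nonneg a) _) (f.toPreGNS b)
    exact h

theorem twoNorm_nonneg (τ : A →ₗ[ℂ] ℂ) (a : A) : 0 ≤ twoNorm τ a := Real.sqrt_nonneg _

theorem ofReal_twoNorm_sq (hτ : IsTracialState τ) (a : A) :
    ((twoNorm τ a ^ 2 : ℝ) : ℂ) = τ (star a * a) := by
  have h := Complex.nonneg_iff.1 (hτ.nonneg a)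
  rw [twoNorm, Real.sq_sqrt h.1]
  apply Complex.ext <;> simp [h.2]

theorem twoNorm_sq (hτ : IsTracialState τ) (a : A) :
    twoNorm τ a ^ 2 = (τ (star a * a)).re := by
  rw [← hτ.ofReal_twoNorm_sq, Complex.ofReal_re]

theorem twoNorm_zero (τ : A →ₗ[ℂ] ℂ) : twoNorm τ 0 = 0 := by simp [twoNorm]

theorem twoNorm_add_le (hτ : IsTracialState τ) (a b : A) :
    twoNorm τ (a + b) ≤ twoNorm τ a + twoNorm τ b := by
  obtain ⟨E, _, _, j, -, h, -⟩ := hτ.exists_norm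
  rw [← h, ← h, ← h, map_add]
  exact norm_add_le _ _

theorem twoNorm_smul (hτ : IsTracialState τ) (c : ℂ) (a : A) :
    twoNorm τ (c • a) = ‖c‖ * twoNorm τ a := by
  obtain ⟨E, _, _, j, -, h, -⟩ := hτ.exists_norm
  rw [← h, ← h, map_smul, norm_smul]

theorem twoNorm_neg (hτ : IsTracialState τ) (a : A) : twoNorm τ (-a) = twoNorm τ a := by
  have := hτ.twoNorm_smul (-1) a
  simpa using this

theorem twoNorm_sub_comm (hτ : IsTracialState τ) (a b : A) :
    twoNorm τ (a - b) = twoNorm τ (b - a) := by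
  rw [← hτ.twoNorm_neg, neg_sub]

theorem twoNorm_sub_le (hτ : IsTracialState τ) (a b c : A) :
    twoNorm τ (a - c) ≤ twoNorm τ (a - b) + twoNorm τ (b - c) := by
  simpa using hτ.twoNorm_add_le (a - b) (b - c)

theorem twoNorm_star (hτ : IsTracialState τ) (a : A) : twoNorm τ (star a) = twoNorm τ a := by
  rw [twoNorm, twoNorm, star_star, hτ.tracial]

theorem twoNorm_mul_le (hτ : IsTracialState τ) (a b : A) :
    twoNorm τ (a * b) ≤ ‖a‖ * twoNorm τ b := by
  obtain ⟨E, _, _, j, -, h, h'⟩ := hτ.exists_norm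
  rw [← h, ← h]
  exact h' a b

/-- The trace property enters through `‖a*‖₂ = ‖a‖₂`, which exchanges left and right multiplication.
-/
theorem twoNorm_mul_le' (hτ : IsTracialState τ) (a b : A) :
    twoNorm τ (a * b) ≤ twoNorm τ a * ‖b‖ := by
  rw [← hτ.twoNorm_star, star_mul, mul_comm, ← hτ.twoNorm_star a, ← norm_star b]
  exact hτ.twoNorm_mul_le _ _

theorem twoNorm_one (hτ : IsTracialState τ) : twoNorm τ 1 = 1 := by
  simp [twoNorm, hτ.map_one]

theorem twoNorm_le_norm (hτ : IsTracialState τ) (a : A) : twoNorm τ a ≤ ‖a‖ := by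
  simpa [hτ.twoNorm_one] using hτ.twoNorm_mul_le a 1

theorem norm_apply_mul_le (hτ : IsTracialState τ) (a b : A) :
    ‖τ (star a * b)‖ ≤ twoNorm τ a * twoNorm τ b := by
  obtain ⟨E, _, _, j, hi, h, -⟩ := hτ.exists_norm
  rw [← h, ← h, ← hi]
  exact norm_inner_le_norm _ _

theorem norm_apply_le (hτ : IsTracialState τ) (a : A) : ‖τ a‖ ≤ twoNorm τ a := by
  simpa [hτ.twoNorm_one] using hτ.norm_apply_mul_le 1 a

theorem norm_apply_le_norm (hτ : IsTracialState τ) (a : A) : ‖τ a‖ ≤ ‖a‖ :=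
  (hτ.norm_apply_le a).trans (hτ.twoNorm_le_norm a)

theorem twoNorm_unitary_mul (τ : A →ₗ[ℂ] ℂ) {u : A} (hu : u ∈ unitary A) (a : A) :
    twoNorm τ (u * a) = twoNorm τ a := by
  rw [twoNorm, twoNorm, star_mul, mul_assoc, ← mul_assoc (star u), Unitary.star_mul_self_of_mem hu,
    one_mul]

theorem twoNorm_mul_unitary (hτ : IsTracialState τ) {u : A} (hu : u ∈ unitary A) (a : A) :
    twoNorm τ (a * u) = twoNorm τ a := by
  rw [← hτ.twoNorm_star, star_mul, twoNorm_unitary_mul τ (Unitary.star_mem hu), hτ.twoNorm_star]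

theorem twoNorm_conj (hτ : IsTracialState τ) {u : A} (hu : u ∈ unitary A) (a : A) :
    twoNorm τ (u * a * star u) = twoNorm τ a := by
  rw [hτ.twoNorm_mul_unitary (Unitary.star_mem hu), twoNorm_unitary_mul τ hu]

end IsTracialState


/-! ### Evaluation of non-commutative polynomials on bounded tuples -/

theorem norm_algebraMap_le {A : Type u} [CStarAlgebra A] (c : ℂ) : ‖algebraMap ℂ A c‖ ≤ ‖c‖ := by
  rcases subsingleton_or_nontrivial A with h | h
  · rw [Subsingleton.elim (algebraMap ℂ A c) 0, norm_zero]
    exact norm_nonneg c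
  · rw [norm_algebraMap']

/-- The point is the order of quantifiers: `K` does not depend on the algebra, so it serves all
matrix sizes at once. -/
theorem exists_norm_lift_le {I : Type v} (R : I → ℝ) (p : FreeAlgebra ℂ I) :
    ∃ K : ℝ, 0 ≤ K ∧ ∀ (A : Type u) [CStarAlgebra A] (a : I → A), (∀ i, ‖a i‖ ≤ R i) →
      ‖FreeAlgebra.lift ℂ a p‖ ≤ K := by
  induction p using FreeAlgebra.induction with
  | grade0 c =>
    refine ⟨‖c‖, norm_nonneg c, fun A _ a _ => ?_⟩
    rw [AlgHom.commutes]
    exact norm_algebraMap_le c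
  | grade1 i => exact ⟨|R i|, abs_nonneg _, fun A _ a h => by simpa using (h i).trans (le_abs_self _)⟩
  | mul p q hp hq =>
    obtain ⟨K, hK, hp⟩ := hp
    obtain ⟨L, hL, hq⟩ := hq
    refine ⟨K * L, mul_nonneg hK hL, fun A _ a h => ?_⟩
    rw [map_mul]
    exact (norm_mul_le _ _).trans (mul_le_mul (hp A a h) (hq A a h) (norm_nonneg _) hK)
  | add p q hp hq =>
    obtain ⟨K, hK, hp⟩ := hp
    obtain ⟨L, hL, hq⟩ := hq
    refine ⟨K + L, add_nonneg hK hL, fun A _ a h => ?_⟩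
    rw [map_add]
    exact (norm_add_le _ _).trans (add_le_add (hp A a h) (hq A a h))

/-- Leibniz rule: in `PQ - P'Q' = (P - P')Q + P'(Q - Q')` the difference is measured in the `2`-norm
and the other factor in the operator norm, where `exists_norm_lift_le` bounds it. -/
theorem exists_twoNorm_lift_sub_le {I : Type v} (R : I → ℝ) (p : FreeAlgebra ℂ I) :
    ∃ (F : Finset I) (K : ℝ), 0 ≤ K ∧ ∀ (A : Type u) [CStarAlgebra A] (τ : A →ₗ[ℂ] ℂ),
      IsTracialState τ → ∀ a b : I → A, (∀ i, ‖a i‖ ≤ R i) → (∀ i, ‖b i‖ ≤ R i) →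
      twoNorm τ (FreeAlgebra.lift ℂ a p - FreeAlgebra.lift ℂ b p) ≤
        K * ∑ i ∈ F, twoNorm τ (a i - b i) := by
  classical
  have hmono : ∀ {A : Type u} [CStarAlgebra A] (τ : A →ₗ[ℂ] ℂ) (a b : I → A) {F G : Finset I},
      F ⊆ G → ∑ i ∈ F, twoNorm τ (a i - b i) ≤ ∑ i ∈ G, twoNorm τ (a i - b i) :=
    fun τ a b _ _ h => Finset.sum_le_sum_of_subset_of_nonneg h
      fun i _ _ => IsTracialState.twoNorm_nonneg τ _
  induction p using FreeAlgebra.induction with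
  | grade0 c =>
    exact ⟨∅, 0, le_rfl, fun A _ τ hτ a b _ _ => by simp [IsTracialState.twoNorm_zero]⟩
  | grade1 i => exact ⟨{i}, 1, zero_le_one, fun A _ τ hτ a b _ _ => by simp⟩
  | mul p q hp hq =>
    obtain ⟨F, K, hK, hp⟩ := hp
    obtain ⟨G, L, hL, hq⟩ := hq
    obtain ⟨K', hK', hp'⟩ := exists_norm_lift_le.{u} R p
    obtain ⟨L', hL', hq'⟩ := exists_norm_lift_le.{u} R q
    refine ⟨F ∪ G, K * L' + K' * L, by positivity, fun A _ τ hτ a b ha hb => ?_⟩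
    rw [map_mul, map_mul]
    set P := FreeAlgebra.lift ℂ a p
    set P' := FreeAlgebra.lift ℂ b p
    set Q := FreeAlgebra.lift ℂ a q
    set Q' := FreeAlgebra.lift ℂ b q
    have h : P * Q - P' * Q' = (P - P') * Q + P' * (Q - Q') := by noncomm_ring
    have hF := hmono τ a b (Finset.subset_union_left (s₁ := F) (s₂ := G))
    have hG := hmono τ a b (Finset.subset_union_right (s₁ := F) (s₂ := G))
    set S := ∑ i ∈ F ∪ G, twoNorm τ (a i - b i)
    have hS : 0 ≤ S := Finset.sum_nonneg fun i _ => IsTracialState.twoNorm_nonneg τ _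
    calc twoNorm τ (P * Q - P' * Q')
        ≤ twoNorm τ (P - P') * ‖Q‖ + ‖P'‖ * twoNorm τ (Q - Q') := by
          rw [h]
          exact (hτ.twoNorm_add_le _ _).trans
            (add_le_add (hτ.twoNorm_mul_le' _ _) (hτ.twoNorm_mul_le _ _))
      _ ≤ (K * S) * L' + K' * (L * S) := by
          have h1 := (hp A τ hτ a b ha hb).trans (mul_le_mul_of_nonneg_left hF hK)
          have h2 := (hq A τ hτ a b ha hb).trans (mul_le_mul_of_nonneg_left hG hL)
          exact add_le_add
            (mul_le_mul h1 (hq' A a ha) (norm_nonneg _) (by positivity))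
            (mul_le_mul (hp' A b hb) h2 (IsTracialState.twoNorm_nonneg τ _) hK')
      _ = (K * L' + K' * L) * S := by ring
  | add p q hp hq =>
    obtain ⟨F, K, hK, hp⟩ := hp
    obtain ⟨G, L, hL, hq⟩ := hq
    refine ⟨F ∪ G, K + L, by positivity, fun A _ τ hτ a b ha hb => ?_⟩
    rw [map_add, map_add, add_sub_add_comm, add_mul]
    refine (hτ.twoNorm_add_le _ _).trans (add_le_add ?_ ?_)
    · exact (hp A τ hτ a b ha hb).trans
        (mul_le_mul_of_nonneg_left (hmono τ a b Finset.subset_union_left) hK)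
    · exact (hq A τ hτ a b ha hb).trans
        (mul_le_mul_of_nonneg_left (hmono τ a b Finset.subset_union_right) hL)

/-- Polynomials are uniformly continuous in the `2`-norm on bounded tuples, uniformly in the
algebra. -/
theorem exists_twoNorm_lift_sub_lt {I : Type v} (R : I → ℝ) (p : FreeAlgebra ℂ I) {ε : ℝ}
    (hε : 0 < ε) :
    ∃ (F : Finset I) (δ : ℝ), 0 < δ ∧ ∀ (A : Type u) [CStarAlgebra A] (τ : A →ₗ[ℂ] ℂ),
      IsTracialState τ → ∀ a b : I → A, (∀ i, ‖a i‖ ≤ R i) → (∀ i, ‖b i‖ ≤ R i) →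
      (∀ i ∈ F, twoNorm τ (a i - b i) ≤ δ) →
      twoNorm τ (FreeAlgebra.lift ℂ a p - FreeAlgebra.lift ℂ b p) < ε := by
  obtain ⟨F, K, hK, h⟩ := exists_twoNorm_lift_sub_le.{u} R p
  have hpos : 0 < K * F.card + 1 := by positivity
  refine ⟨F, ε / (K * F.card + 1), by positivity, fun A _ τ hτ a b ha hb hab => ?_⟩
  refine (h A τ hτ a b ha hb).trans_lt ?_
  have h1 : ∑ i ∈ F, twoNorm τ (a i - b i) ≤ F.card * (ε / (K * F.card + 1)) := by
    simpa using Finset.sum_le_card_nsmul F _ _ hab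
  calc _ ≤ K * (F.card * (ε / (K * F.card + 1))) := mul_le_mul_of_nonneg_left h1 hK
    _ = (K * F.card) / (K * F.card + 1) * ε := by ring
    _ < 1 * ε := by
      apply mul_lt_mul_of_pos_right _ hε
      rw [div_lt_one hpos]
      linarith
    _ = ε := one_mul ε

/-- The laws of uniformly bounded tuples that are close in the `2`-norm are close on finitely many
polynomials. -/
theorem exists_norm_law_sub_lt {I : Type v} (R : I → ℝ) (Q : Finset (FreeAlgebra ℂ I)) {ε : ℝ}
    (hε : 0 < ε) :
    ∃ (F : Finset I) (δ : ℝ), 0 < δ ∧ ∀ (A : Type u) [CStarAlgebra A] (τ : A →ₗ[ℂ] ℂ),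
      IsTracialState τ → ∀ a b : I → A, (∀ i, ‖a i‖ ≤ R i) → (∀ i, ‖b i‖ ≤ R i) →
      (∀ i ∈ F, twoNorm τ (a i - b i) ≤ δ) → ∀ q ∈ Q, ‖law τ a q - law τ b q‖ < ε := by
  classical
  induction Q using Finset.induction with
  | empty => exact ⟨∅, 1, one_pos, by simp⟩
  | insert p Q hp ih =>
    obtain ⟨F, δ, hδ, h⟩ := ih
    obtain ⟨G, δ', hδ', h'⟩ := exists_twoNorm_lift_sub_lt.{u} R p hε
    refine ⟨F ∪ G, min δ δ', lt_min hδ hδ', fun A _ τ hτ a b ha hb hab q hq => ?_⟩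
    rcases Finset.mem_insert.1 hq with rfl | hq
    · have := h' A τ hτ a b ha hb fun i hi =>
        (hab i (Finset.mem_union_right _ hi)).trans (min_le_right _ _)
      rw [law, law, ← map_sub]
      exact (hτ.norm_apply_le _).trans_lt this
    · exact h A τ hτ a b ha hb (fun i hi =>
        (hab i (Finset.mem_union_left _ hi)).trans (min_le_left _ _)) q hq

theorem norm_list_prod_map_le {I : Type v} {A : Type u} [CStarAlgebra A] {R : I → ℝ} {a : I → A}
    (ha : ∀ i, ‖a i‖ ≤ R i) (w : List I) : ‖(w.map a).prod‖ ≤ (w.map R).prod := by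
  induction w with
  | nil =>
    have := norm_algebraMap_le (A := A) 1
    simpa using this
  | cons i w ih =>
    simp only [List.map_cons, List.prod_cons]
    exact (norm_mul_le _ _).trans
      (mul_le_mul (ha i) ih (norm_nonneg _) ((norm_nonneg _).trans (ha i)))

/-- The law of a bounded self-adjoint tuple lies in `Σ_R`. -/
theorem law_mem_lawSpace {I : Type v} {A : Type u} [CStarAlgebra A] {τ : A →ₗ[ℂ] ℂ}
    (hτ : IsTracialState τ) {R : I → ℝ} {a : I → A} (hsa : ∀ i, IsSelfAdjoint (a i))
    (ha : ∀ i, ‖a i‖ ≤ R i) : law τ a ∈ lawSpace R := by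
  refine ⟨(τ ∘ₗ (FreeAlgebra.lift ℂ a).toLinearMap).isLinear, ?_, fun p => ?_, fun p q => ?_,
    fun w => ?_⟩
  · simp [law, hτ.map_one]
  · rw [law, map_mul, lift_ncStar a hsa]
    exact hτ.nonneg _
  · rw [law, law, map_mul (FreeAlgebra.lift ℂ a), map_mul (FreeAlgebra.lift ℂ a), hτ.tracial]
  · have : FreeAlgebra.lift ℂ a (w.map (FreeAlgebra.ι ℂ)).prod = (w.map a).prod := by
      rw [map_list_prod, List.map_map]
      congr 2
      funext i
      simp
    rw [law, this]
    exact (hτ.norm_apply_le_norm _).trans (norm_list_prod_map_le ha w)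


/-! ### Density of polynomials in the generated von Neumann algebra -/

section Density

variable {H : Type u} [NormedAddCommGroup H] [InnerProductSpace ℂ H]

/-- The amplification of a bounded operator to `ℓ²(ι; H)`. -/
def amplify (ι : Type v) (T : H →L[ℂ] H) : lp (fun _ : ι => H) 2 →L[ℂ] lp (fun _ : ι => H) 2 :=
  lp.mapCLM 2 (fun _ => T) (norm_nonneg T) fun _ => le_rfl

variable {ι : Type v}

@[simp]
theorem amplify_apply (T : H →L[ℂ] H) (f : lp (fun _ : ι => H) 2) (i : ι) :
    amplify ι T f i = T (f i) := rfl

variable [CompleteSpace H]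

theorem inner_amplify {T : H →L[ℂ] H} (hT : IsSelfAdjoint T) (f g : lp (fun _ : ι => H) 2) :
    inner ℂ f (amplify ι T g) = inner ℂ (amplify ι T f) g := by
  rw [lp.inner_eq_tsum, lp.inner_eq_tsum]
  congr 1
  funext i
  rw [amplify_apply, amplify_apply, ← ContinuousLinearMap.adjoint_inner_left,
    ← ContinuousLinearMap.star_eq_adjoint, hT.star_eq]

/-- An invariant subspace of a self-adjoint operator is reducing, so its projection commutes with
the operator. -/
theorem starProjection_amplify {T : H →L[ℂ] H} (hT : IsSelfAdjoint T)
    (K : Submodule ℂ (lp (fun _ : ι => H) 2)) [K.HasOrthogonalProjection]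
    (hK : ∀ v ∈ K, amplify ι T v ∈ K) (f : lp (fun _ : ι => H) 2) :
    K.starProjection (amplify ι T f) = amplify ι T (K.starProjection f) := by
  refine Submodule.eq_starProjection_of_mem_orthogonal (hK _ (K.starProjection_apply_mem f)) ?_
  rw [← map_sub, Submodule.mem_orthogonal]
  intro w hw
  rw [inner_amplify hT]
  exact Submodule.inner_right_of_mem_orthogonal (hK w hw) (K.sub_starProjection_mem_orthogonal f)

/-- Von Neumann's double commutant argument on the amplified space. The closure `K` of the vectors
`p(x)ζ` is reducing for the amplified `x_j`, hence for the amplified `a`; since `ζ ∈ K`, also `aζ ∈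
K`. -/
theorem amplify_mem_closure {J : Type w} {x : J → H →L[ℂ] H} (hx : ∀ j, IsSelfAdjoint (x j))
    {a : H →L[ℂ] H} (ha : a ∈ generatedVN (Set.range x)) (ζ : lp (fun _ : ι => H) 2) {ε : ℝ}
    (hε : 0 < ε) :
    ∃ p : FreeAlgebra ℂ J, ‖amplify ι (FreeAlgebra.lift ℂ x p - a) ζ‖ < ε := by
  classical
  let φ : FreeAlgebra ℂ J →ₗ[ℂ] lp (fun _ : ι => H) 2 :=
    { toFun := fun p => amplify ι (FreeAlgebra.lift ℂ x p) ζ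
      map_add' := fun p q => by ext i; simp
      map_smul' := fun c p => by ext i; simp }
  set K := (LinearMap.range φ).topologicalClosure with hKdef
  have : CompleteSpace K := (LinearMap.range φ).isClosed_topologicalClosure.completeSpace_coe
  have hK : ∀ j, ∀ v ∈ K, amplify ι (x j) v ∈ K := by
    intro j v hv
    refine map_mem_closure (amplify ι (x j)).continuous hv ?_
    rintro _ ⟨p, rfl⟩
    refine ⟨FreeAlgebra.ι ℂ j * p, ?_⟩
    ext i
    simp [φ]
  -- The matrix entries of the projection onto `K` commute with every `x j`, hence with `a`, which
  -- lies in the double commutant.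
  have hcomm : ∀ m n : ι, a * ((lp.evalCLM ℂ (fun _ : ι => H) 2 m) ∘L K.starProjection ∘L
      (lp.singleContinuousLinearMap ℂ (fun _ : ι => H) 2 n)) =
      ((lp.evalCLM ℂ (fun _ : ι => H) 2 m) ∘L K.starProjection ∘L
      (lp.singleContinuousLinearMap ℂ (fun _ : ι => H) 2 n)) * a := by
    intro m n
    have ha' : a ∈ StarSubalgebra.centralizer ℂ
      (StarSubalgebra.centralizer ℂ (Set.range x) : Set (H →L[ℂ] H)) := ha
    rw [StarSubalgebra.mem_centralizer_iff] at ha'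
    refine (ha' _ ?_).1.symm
    rw [SetLike.mem_coe, StarSubalgebra.mem_centralizer_iff]
    rintro _ ⟨j, rfl⟩
    rw [(hx j).star_eq, and_self]
    ext h
    have h1 : lp.single 2 n (x j h) = amplify ι (x j) (lp.single 2 n h : lp (fun _ : ι => H) 2) := by
      ext i
      rcases eq_or_ne i n with rfl | hi
      · simp
      · simp [hi]
    have h2 := starProjection_amplify (hx j) K (hK j) (lp.single 2 n h)
    change x j ((K.starProjection (lp.single 2 n h)) m) = (K.starProjection (lp.single 2 n (x j h))) m
    rw [h1, h2, amplify_apply]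
  have hP : K.starProjection ∘L amplify ι a = amplify ι a ∘L K.starProjection := by
    refine lp.ext_continuousLinearMap (by norm_num) fun n => ?_
    ext h m
    have h1 : lp.single 2 n (a h) = amplify ι a (lp.single 2 n h : lp (fun _ : ι => H) 2) := by
      ext i
      rcases eq_or_ne i n with rfl | hi
      · simp
      · simp [hi]
    have h2 := congrArg (fun T : H →L[ℂ] H => T h) (hcomm m n)
    change a ((K.starProjection (lp.single 2 n h)) m) =
      (K.starProjection (lp.single 2 n (a h))) m at h2
    change (K.starProjection (amplify ι a (lp.single 2 n h))) m =
      a ((K.starProjection (lp.single 2 n h)) m)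
    rw [h2, h1]
  have hζ : ζ ∈ K := subset_closure ⟨1, by ext i; simp [φ]⟩
  have haζ : amplify ι a ζ ∈ K := by
    have := congrArg (fun T => T ζ) hP
    simp only [ContinuousLinearMap.comp_apply] at this
    rw [Submodule.starProjection_eq_self_iff.2 hζ] at this
    exact Submodule.starProjection_eq_self_iff.1 this
  obtain ⟨_, ⟨p, rfl⟩, hp⟩ := Metric.mem_closure_iff.1 haζ ε hε
  refine ⟨p, ?_⟩
  rw [dist_eq_norm, norm_sub_rev] at hp
  convert! hp using 2

variable {M : VonNeumannAlgebra H} {τ : M.toStarSubalgebra →ₗ[ℂ] ℂ}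

theorem coe_lift {J : Type w} (x : J → M.toStarSubalgebra) (p : FreeAlgebra ℂ J) :
    ((FreeAlgebra.lift ℂ x p : M.toStarSubalgebra) : H →L[ℂ] H) =
      FreeAlgebra.lift ℂ (fun j => (x j : H →L[ℂ] H)) p := by
  have : (M.toStarSubalgebra.subtype : M.toStarSubalgebra →ₐ[ℂ] (H →L[ℂ] H)).comp
      (FreeAlgebra.lift ℂ x) = FreeAlgebra.lift ℂ fun j => (x j : H →L[ℂ] H) := by
    ext j
    simp
  exact congrArg (fun f => f p) this

/-- By normality `τ(b*b) = ∑ ⟨b η_n, b ξ_n⟩ ≤ ‖bη‖ ‖bξ‖`. Stacking `ξ` and `η` into one vector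
indexed by `ℕ ⊕ ℕ` lets a single polynomial make both factors small. -/
theorem exists_twoNorm_lift_sub_lt_of_mem (hτ : IsFaithfulNormalTrace M τ) {J : Type w}
    {x : J → M.toStarSubalgebra} (hx : ∀ j, IsSelfAdjoint (x j)) {a : M.toStarSubalgebra}
    (ha : (a : H →L[ℂ] H) ∈ tupleVN x) {ε : ℝ} (hε : 0 < ε) :
    ∃ p : FreeAlgebra ℂ J, twoNorm τ (FreeAlgebra.lift ℂ x p - a) < ε := by
  obtain ⟨ξ, η, hξ, hη, hsum⟩ := hτ.normal
  let ξ' : lp (fun _ : ℕ => H) 2 := ⟨ξ, memℓp_gen (by simpa using hξ)⟩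
  let η' : lp (fun _ : ℕ => H) 2 := ⟨η, memℓp_gen (by simpa using hη)⟩
  have hζ : Summable fun i : ℕ ⊕ ℕ => ‖(Sum.elim ξ η i : H)‖ ^ 2 := by
    exact Summable.sum (fun i : ℕ ⊕ ℕ => ‖(Sum.elim ξ η i : H)‖ ^ 2) hξ hη
  let ζ : lp (fun _ : ℕ ⊕ ℕ => H) 2 := ⟨Sum.elim ξ η, memℓp_gen (by simpa using hζ)⟩
  have hx' : ∀ j, IsSelfAdjoint (x j : H →L[ℂ] H) := fun j => congrArg Subtype.val (hx j).star_eq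
  obtain ⟨p, hp⟩ := amplify_mem_closure hx' ha ζ hε
  refine ⟨p, ?_⟩
  rw [← coe_lift] at hp
  set b := FreeAlgebra.lift ℂ x p - a with hb
  have hτb : τ (star b * b) = inner ℂ (amplify ℕ (b : H →L[ℂ] H) η') (amplify ℕ (b : H →L[ℂ] H) ξ') := by
    refine (hsum _).unique ?_
    convert! lp.hasSum_inner (amplify ℕ (b : H →L[ℂ] H) η') (amplify ℕ (b : H →L[ℂ] H) ξ') using 1
    funext n
    simp [ContinuousLinearMap.star_eq_adjoint, ContinuousLinearMap.adjoint_inner_right]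
    rfl
  have hsq : ∀ {κ : Type} (f : lp (fun _ : κ => H) 2), HasSum (fun i => ‖f i‖ ^ 2) (‖f‖ ^ 2) := by
    intro κ f
    simpa using lp.hasSum_norm (p := 2) (by norm_num) f
  have hadd : ‖amplify _ (b : H →L[ℂ] H) ζ‖ ^ 2 =
      ‖amplify _ (b : H →L[ℂ] H) ξ'‖ ^ 2 + ‖amplify _ (b : H →L[ℂ] H) η'‖ ^ 2 :=
    (hsq (amplify _ (b : H →L[ℂ] H) ζ)).unique
      (HasSum.sum (hsq (amplify _ (b : H →L[ℂ] H) ξ')) (hsq (amplify _ (b : H →L[ℂ] H) η')))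
  have hle : (τ (star b * b)).re ≤ ‖amplify _ (b : H →L[ℂ] H) ζ‖ ^ 2 := by
    rw [hτb, hadd]
    refine (Complex.re_le_norm _).trans ((norm_inner_le_norm _ _).trans ?_)
    nlinarith [sq_nonneg (‖amplify ℕ (b : H →L[ℂ] H) η'‖ - ‖amplify ℕ (b : H →L[ℂ] H) ξ'‖),
      sq_nonneg (‖amplify ℕ (b : H →L[ℂ] H) η'‖), sq_nonneg (‖amplify ℕ (b : H →L[ℂ] H) ξ'‖)]
  refine lt_of_le_of_lt ?_ hp
  rw [twoNorm]
  exact Real.sqrt_le_iff.2 ⟨norm_nonneg _, hle⟩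

end Density


/-! ### Approximation by polynomials that are bounded on all bounded tuples -/

section Truncation

variable {A : Type u} [CStarAlgebra A] {τ : A →ₗ[ℂ] ℂ}

/-- With `p = v*v`, the trace moves `v*` to the right: `τ(v*vy) = τ(vyv*)`. -/
theorem IsTracialState.apply_mul_nonneg [PartialOrder A] [StarOrderedRing A]
    (hτ : IsTracialState τ) {p y : A} (hp : 0 ≤ p) (hy : 0 ≤ y) : 0 ≤ τ (p * y) := by
  obtain ⟨f, hf⟩ := hτ.exists_positive
  obtain ⟨v, rfl⟩ := CStarAlgebra.nonneg_iff_eq_star_mul_self.1 hp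
  rw [mul_assoc, hτ.tracial, mul_assoc, ← mul_assoc, ← hf]
  exact map_nonneg f (star_right_conjugate_nonneg hy v)

/-- Truncation at level `s` is, in the `2`-norm, a nearest point of the ball of radius `s`. -/
theorem IsTracialState.twoNorm_sub_truncate_le (hτ : IsTracialState τ) {a b : A}
    (ha : IsSelfAdjoint a) (hb : IsSelfAdjoint b) {s : ℝ} (has : ‖a‖ ≤ s) :
    twoNorm τ (b - cfc (fun t : ℝ => max (-s) (min s t)) b) ≤ twoNorm τ (b - a) := by
  let _ := CStarAlgebra.spectralOrder A
  have := CStarAlgebra.spectralOrderedRing A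
  have hs : 0 ≤ s := (norm_nonneg a).trans has
  set c := cfc (fun t : ℝ => max (-s) (min s t)) b with hc
  set p := cfc (fun t : ℝ => max (t - s) 0) b with hp
  set q := cfc (fun t : ℝ => max (-s - t) 0) b with hq
  have hcsa : IsSelfAdjoint c := cfc_predicate _ _
  have hpsa : IsSelfAdjoint p := cfc_predicate _ _
  have hqsa : IsSelfAdjoint q := cfc_predicate _ _
  have hp0 : 0 ≤ p := cfc_nonneg fun t _ => le_max_right _ _
  have hq0 : 0 ≤ q := cfc_nonneg fun t _ => le_max_right _ _
  have hbc : b - c = p - q := by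
    have h1 : b = cfc (fun t : ℝ => t) b := (cfc_id' ℝ b).symm
    conv_lhs => enter [1]; rw [h1]
    rw [hc, hp, hq, ← cfc_sub .., ← cfc_sub ..]
    refine cfc_congr fun t _ => ?_
    rcases max_cases (-s) (min s t) with h | h <;> rcases min_cases s t with h' | h' <;>
      rcases max_cases (t - s) 0 with h'' | h'' <;> rcases max_cases (-s - t) 0 with h3 | h3 <;>
      linarith
  have hpc : p * c = (s : ℂ) • p := by
    rw [Complex.coe_smul, hc, hp, ← cfc_mul .., ← cfc_smul ..]
    refine cfc_congr fun t _ => ?_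
    dsimp only [smul_eq_mul]
    rcases le_total t s with h | h
    · rw [max_eq_right (by linarith : t - s ≤ 0)]; simp
    · rw [min_eq_left h, max_eq_right (by linarith : -s ≤ s)]; exact mul_comm _ _
  have hqc : q * c = (-s : ℂ) • q := by
    rw [← Complex.ofReal_neg, Complex.coe_smul, hc, hq, ← cfc_mul .., ← cfc_smul ..]
    refine cfc_congr fun t _ => ?_
    dsimp only [smul_eq_mul]
    rcases le_total (-s) t with h | h
    · rw [max_eq_right (by linarith : -s - t ≤ 0)]; simp
    · rw [min_eq_right (by linarith : t ≤ s), max_eq_left h]; exact mul_comm _ _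
  have halg : ∀ y : A, IsSelfAdjoint y → ‖y‖ ≤ s → 0 ≤ (s : ℂ) • (1 : A) - y := by
    intro y hy hys
    have h1 : y ≤ algebraMap ℝ A ‖y‖ := hy.le_algebraMap_norm_self
    have h2 : algebraMap ℝ A ‖y‖ ≤ algebraMap ℝ A s := algebraMap_mono A hys
    rw [Complex.coe_smul, ← Algebra.algebraMap_eq_smul_one, sub_nonneg]
    exact h1.trans h2
  -- The obtuse angle condition of a nearest point: since `pc = sp` and `qc = -sq`, the product is
  -- `p(s - a) + q(s + a)`, and both terms have nonnegative trace.
  have hcross : 0 ≤ τ ((b - c) * (c - a)) := by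
    have h1 := hτ.apply_mul_nonneg hp0 (halg a ha has)
    have h2 := hτ.apply_mul_nonneg hq0 (halg (-a) ha.neg (by simpa using has))
    have h3 : (b - c) * (c - a) = p * ((s : ℂ) • (1 : A) - a) + q * ((s : ℂ) • (1 : A) - -a) := by
      rw [hbc, sub_mul, mul_sub, mul_sub, hpc, hqc]
      simp only [mul_sub, mul_smul_comm, mul_one, mul_neg, neg_smul]
      abel
    rw [h3, map_add]
    exact add_nonneg h1 h2
  have hsq : twoNorm τ (b - c) ^ 2 ≤ twoNorm τ (b - a) ^ 2 := by
    rw [hτ.twoNorm_sq (b - a)]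
    have h1 : star (b - a) * (b - a) = star (b - c) * (b - c) + star (c - a) * (c - a) +
        ((b - c) * (c - a) + (c - a) * (b - c)) := by
      simp only [star_sub, hb.star_eq, ha.star_eq, hcsa.star_eq]
      noncomm_ring
    rw [h1]
    simp only [map_add, Complex.add_re]
    rw [← hτ.twoNorm_sq, ← hτ.twoNorm_sq, hτ.tracial (c - a)]
    have h2 := (Complex.nonneg_iff.1 hcross).1
    have h3 := sq_nonneg (twoNorm τ (c - a))
    linarith
  exact (sq_le_sq₀ (IsTracialState.twoNorm_nonneg τ _) (IsTracialState.twoNorm_nonneg τ _)).1 hsq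

theorem abs_le_of_mem_spectrum {b : A} {Λ t : ℝ} (hΛ : ‖b‖ ≤ Λ) (ht : t ∈ spectrum ℝ b) :
    t ∈ Set.Icc (-Λ) Λ := by
  rcases subsingleton_or_nontrivial A with h | h
  · rw [spectrum.of_subsingleton] at ht
    exact ht.elim
  · have := spectrum.norm_le_norm_of_mem ht
    rw [Real.norm_eq_abs] at this
    exact abs_le.1 (this.trans hΛ)

end Truncation

section Kaplansky

variable {H : Type u} [NormedAddCommGroup H] [InnerProductSpace ℂ H] [CompleteSpace H]
  {M : VonNeumannAlgebra H} {τ : M.toStarSubalgebra →ₗ[ℂ] ℂ}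

scoped instance isClosed_toStarSubalgebra (M : VonNeumannAlgebra H) :
    IsClosed (M.toStarSubalgebra : Set (H →L[ℂ] H)) := by
  have h : (M.toStarSubalgebra : Set (H →L[ℂ] H)) =
    Set.centralizer (Set.centralizer (M : Set (H →L[ℂ] H))) := M.centralizer_centralizer.symm
  rw [h]
  exact Set.isClosed_centralizer _

scoped instance (M : VonNeumannAlgebra H) : CStarAlgebra M.toStarSubalgebra :=
  StarSubalgebra.cstarAlgebra M.toStarSubalgebra

theorem IsFaithfulNormalTrace.isTracialState (hτ : IsFaithfulNormalTrace M τ) :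
    IsTracialState τ :=
  ⟨hτ.map_one, hτ.nonneg, hτ.tracial⟩

/-- The substitution of `p` into the real polynomial `P`. -/
def polyComp {J : Type w} (P : Polynomial ℝ) (p : FreeAlgebra ℂ J) : FreeAlgebra ℂ J :=
  Polynomial.aeval p (P.map (algebraMap ℝ ℂ))

theorem lift_polyComp {J : Type w} {A : Type u} [CStarAlgebra A] (b : J → A) (P : Polynomial ℝ)
    (p : FreeAlgebra ℂ J) (h : IsSelfAdjoint (FreeAlgebra.lift ℂ b p)) :
    FreeAlgebra.lift ℂ b (polyComp P p) = cfc (fun t => P.eval t) (FreeAlgebra.lift ℂ b p) := by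
  rw [polyComp, ← Polynomial.aeval_algHom_apply, Polynomial.aeval_map_algebraMap]
  exact (cfc_polynomial P _ h).symm

theorem isSelfAdjoint_lift_symmetrize {J : Type w} {A : Type u} [CStarAlgebra A] {b : J → A}
    (hb : ∀ j, IsSelfAdjoint (b j)) (p : FreeAlgebra ℂ J) :
    IsSelfAdjoint (FreeAlgebra.lift ℂ b ((1 / 2 : ℂ) • (p + ncStar p))) := by
  rw [map_smul, map_add, lift_ncStar b hb]
  refine IsSelfAdjoint.smul ?_ (IsSelfAdjoint.add_star_self _)
  simp [isSelfAdjoint_iff]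

/-- A density theorem of Kaplansky type: the approximating polynomial can be chosen bounded on all
bounded self-adjoint tuples from all C⋆-algebras. -/
theorem exists_bounded_lift_approx (hτ : IsFaithfulNormalTrace M τ) {J : Type w}
    {x : J → M.toStarSubalgebra} (hx : ∀ j, IsSelfAdjoint (x j)) {R : J → ℝ}
    (hxR : ∀ j, ‖x j‖ ≤ R j) {a : M.toStarSubalgebra} (ha : IsSelfAdjoint a)
    (haM : (a : H →L[ℂ] H) ∈ tupleVN x) {r : ℝ} (har : ‖a‖ < r) {ε : ℝ} (hε : 0 < ε) :
    ∃ p : FreeAlgebra ℂ J, twoNorm τ (FreeAlgebra.lift ℂ x p - a) < ε ∧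
      ‖FreeAlgebra.lift ℂ x p‖ ≤ r ∧
      ∀ (A : Type v) [CStarAlgebra A] (b : J → A), (∀ j, IsSelfAdjoint (b j)) →
        (∀ j, ‖b j‖ ≤ R j) → IsSelfAdjoint (FreeAlgebra.lift ℂ b p) ∧
          ‖FreeAlgebra.lift ℂ b p‖ ≤ r := by
  have hτ' := hτ.isTracialState
  obtain ⟨p₀, hp₀⟩ := exists_twoNorm_lift_sub_lt_of_mem hτ hx haM (show 0 < ε / 4 by positivity)
  set p₁ : FreeAlgebra ℂ J := (1 / 2 : ℂ) • (p₀ + ncStar p₀) with hp₁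
  have happrox : twoNorm τ (FreeAlgebra.lift ℂ x p₁ - a) < ε / 4 := by
    have h1 : FreeAlgebra.lift ℂ x p₁ - a = (1 / 2 : ℂ) •
        ((FreeAlgebra.lift ℂ x p₀ - a) + star (FreeAlgebra.lift ℂ x p₀ - a)) := by
      rw [hp₁, map_smul, map_add, lift_ncStar x hx, star_sub, ha.star_eq]
      module
    rw [h1, hτ'.twoNorm_smul, show ‖(1 / 2 : ℂ)‖ = 1 / 2 by norm_num]
    have h2 := hτ'.twoNorm_add_le (FreeAlgebra.lift ℂ x p₀ - a) (star (FreeAlgebra.lift ℂ x p₀ - a))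
    rw [hτ'.twoNorm_star] at h2
    linarith
  obtain ⟨K₁, -, hK₁⟩ := exists_norm_lift_le.{u} R p₁
  obtain ⟨K₂, -, hK₂⟩ := exists_norm_lift_le.{v} R p₁
  -- `K₁` bounds the polynomial in `M`, `K₂` in the test algebras, which live in another universe.
  set Λ := max K₁ K₂
  set s := ‖a‖
  have hs : 0 ≤ s := norm_nonneg a
  have hcont : Continuous fun t : ℝ => max (-s) (min s t) := by fun_prop
  have he : 0 < min (ε / 4) (r - s) := lt_min (by positivity) (sub_pos.2 har)
  -- `P` imitates the truncation at level `s` on an interval containing all the spectra in question.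
  -- The precision `r - s` keeps `|P| ≤ r` there.
  obtain ⟨P, hP⟩ := exists_polynomial_near_of_continuousOn (-Λ) Λ _ hcont.continuousOn _ he
  have hbound : ∀ t ∈ Set.Icc (-Λ) Λ, ‖P.eval t‖ ≤ r := by
    intro t ht
    have h1 := (hP t ht).trans_le (min_le_right _ _)
    have h2 : |max (-s) (min s t)| ≤ s :=
      abs_le.2 ⟨le_max_left _ _, max_le (by linarith) (min_le_left _ _)⟩
    rw [Real.norm_eq_abs]
    have h3 := abs_sub_abs_le_abs_sub (P.eval t) (max (-s) (min s t))
    linarith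
  have hr : 0 ≤ r := hs.trans har.le
  refine ⟨polyComp P p₁, ?_, ?_, fun A _ b hb hbR => ⟨?_, ?_⟩⟩
  · set b := FreeAlgebra.lift ℂ x p₁ with hb
    have hbsa : IsSelfAdjoint b := isSelfAdjoint_lift_symmetrize hx p₀
    have hbΛ : ‖b‖ ≤ Λ := (hK₁ _ x hxR).trans (le_max_left _ _)
    rw [lift_polyComp x P p₁ (isSelfAdjoint_lift_symmetrize hx p₀), ← hb]
    set c := cfc (fun t : ℝ => max (-s) (min s t)) b
    have h1 : twoNorm τ (cfc (fun t => P.eval t) b - c) ≤ ε / 4 := by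
      refine (hτ'.twoNorm_le_norm _).trans ?_
      rw [← cfc_sub ..]
      refine norm_cfc_le (by positivity) fun t ht => ?_
      rw [Real.norm_eq_abs]
      exact (hP t (abs_le_of_mem_spectrum hbΛ ht)).le.trans (min_le_left _ _)
    -- As `‖a‖ = s`, truncation moves `b` by at most its distance to `a`. Three errors of `ε / 4`
    -- result.
    have h2 : twoNorm τ (b - c) ≤ twoNorm τ (b - a) := hτ'.twoNorm_sub_truncate_le ha hbsa le_rfl
    have h3 := hτ'.twoNorm_sub_le (cfc (fun t => P.eval t) b) c a
    have h4 := hτ'.twoNorm_sub_le c b a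
    rw [hτ'.twoNorm_sub_comm c b] at h4
    linarith
  · rw [lift_polyComp x P p₁ (isSelfAdjoint_lift_symmetrize hx p₀)]
    exact norm_cfc_le hr fun t ht =>
      hbound t (abs_le_of_mem_spectrum ((hK₁ _ x hxR).trans (le_max_left _ _)) ht)
  · rw [lift_polyComp b P p₁ (isSelfAdjoint_lift_symmetrize hb p₀)]
    exact cfc_predicate _ _
  · rw [lift_polyComp b P p₁ (isSelfAdjoint_lift_symmetrize hb p₀)]
    exact norm_cfc_le hr fun t ht =>
      hbound t (abs_le_of_mem_spectrum ((hK₂ _ b hbR).trans (le_max_right _ _)) ht)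

end Kaplansky


/-! ### The space of laws and simple functions -/

section LawSpace

variable {I : Type v}

theorem span_words_eq_top :
    Submodule.span ℂ (Set.range fun w : List I => (w.map (FreeAlgebra.ι ℂ)).prod) = ⊤ := by
  rw [eq_top_iff]
  rintro p -
  induction p using FreeAlgebra.induction with
  | grade0 c =>
    rw [Algebra.algebraMap_eq_smul_one]
    exact Submodule.smul_mem _ _ (Submodule.subset_span ⟨[], rfl⟩)
  | grade1 i => exact Submodule.subset_span ⟨[i], by simp⟩
  | mul p q hp hq =>
    have h := Submodule.mul_mem_mul hp hq
    rw [Submodule.span_mul_span] at h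
    refine Submodule.span_mono ?_ h
    rintro _ ⟨_, ⟨w, rfl⟩, _, ⟨w', rfl⟩, rfl⟩
    exact ⟨w ++ w', by simp⟩
  | add p q hp hq => exact Submodule.add_mem _ hp hq

theorem exists_norm_le_of_mem_lawSpace (R : I → ℝ) (p : FreeAlgebra ℂ I) :
    ∃ K : ℝ, ∀ l ∈ lawSpace R, ‖l p‖ ≤ K := by
  have hp : p ∈ Submodule.span ℂ (Set.range fun w : List I => (w.map (FreeAlgebra.ι ℂ)).prod) := by
    rw [span_words_eq_top]
    trivial
  induction hp using Submodule.span_induction with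
  | mem _ h =>
    obtain ⟨w, rfl⟩ := h
    exact ⟨_, fun l hl => hl.2.2.2.2 w⟩
  | zero => exact ⟨0, fun l hl => by rw [hl.1.map_zero, norm_zero]⟩
  | add p q _ _ hp hq =>
    obtain ⟨K, hK⟩ := hp
    obtain ⟨L, hL⟩ := hq
    exact ⟨K + L, fun l hl => by
      rw [hl.1.map_add]
      exact (norm_add_le _ _).trans (add_le_add (hK l hl) (hL l hl))⟩
  | smul c p _ hp =>
    obtain ⟨K, hK⟩ := hp
    exact ⟨‖c‖ * K, fun l hl => by
      rw [hl.1.map_smul, norm_smul]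
      exact mul_le_mul_of_nonneg_left (hK l hl) (norm_nonneg c)⟩

/-- A closed subset of a product of discs. Compactness is what makes the coefficients `φ` bounded
and uniformly continuous. -/
theorem isCompact_lawSpace (R : I → ℝ) : IsCompact (lawSpace R) := by
  choose K hK using exists_norm_le_of_mem_lawSpace R
  refine (isCompact_univ_pi fun p => isCompact_closedBall (0 : ℂ) (K p)).of_isClosed_subset ?_ ?_
  · have h : lawSpace R = {l | (∀ p q, l (p + q) = l p + l q) ∧ (∀ (c : ℂ) p, l (c • p) = c • l p) ∧
        l 1 = 1 ∧ (∀ p, 0 ≤ l (ncStar p * p)) ∧ (∀ p q, l (p * q) = l (q * p)) ∧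
        ∀ w : List I, ‖l (w.map (FreeAlgebra.ι ℂ)).prod‖ ≤ (w.map R).prod} := by
      ext l
      constructor
      · rintro ⟨h1, h2⟩
        exact ⟨h1.map_add, h1.map_smul, h2⟩
      · rintro ⟨h1, h2, h3⟩
        exact ⟨⟨h1, h2⟩, h3⟩
    rw [h]
    simp only [Set.ofPred_and, Set.ofPred_forall]
    refine IsClosed.inter ?_ (IsClosed.inter ?_ (IsClosed.inter ?_ (IsClosed.inter ?_
      (IsClosed.inter ?_ ?_))))
    · exact isClosed_iInter fun p => isClosed_iInter fun q =>
        isClosed_eq (by fun_prop) (by fun_prop)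
    · exact isClosed_iInter fun p => isClosed_iInter fun q =>
        isClosed_eq (by fun_prop) (by fun_prop)
    · exact isClosed_eq (continuous_apply _) continuous_const
    · exact isClosed_iInter fun p => isClosed_le continuous_const (continuous_apply _)
    · exact isClosed_iInter fun p => isClosed_iInter fun q =>
        isClosed_eq (continuous_apply _) (continuous_apply _)
    · exact isClosed_iInter fun w => isClosed_le (continuous_apply _).norm continuous_const
  · intro l hl p _
    rw [mem_closedBall_zero_iff]
    exact hK p l hl

scoped instance (R : I → ℝ) : CompactSpace (lawSpace R) :=
  isCompact_iff_compactSpace.1 (isCompact_lawSpace R)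

/-- Uniform continuity on a compact space; an entourage of the topology of pointwise convergence
tests only finitely many polynomials. -/
theorem exists_norm_apply_sub_lt (R : I → ℝ) (φ : C(lawSpace R, ℂ)) {ε : ℝ} (hε : 0 < ε) :
    ∃ (Q : Finset (FreeAlgebra ℂ I)) (δ : ℝ), 0 < δ ∧ ∀ l l' : lawSpace R,
      (∀ q ∈ Q, ‖l.1 q - l'.1 q‖ < δ) → ‖φ l - φ l'‖ < ε := by
  have hφ : UniformContinuous φ := CompactSpace.uniformContinuous_of_continuous φ.continuous
  have h1 : {x : lawSpace R × lawSpace R | dist (φ x.1) (φ x.2) < ε} ∈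
      uniformity (lawSpace R) := hφ (Metric.dist_mem_uniformity hε)
  rw [uniformity_subtype, mem_comap] at h1
  obtain ⟨s, hs, hs'⟩ := h1
  have h2 : uniformity (FreeAlgebra ℂ I → ℂ) =
      comap (fun a i => (a.1 i, a.2 i)) (Filter.pi fun _ => uniformity ℂ) := by
    rw [Pi.uniformity, Filter.pi, comap_iInf]
    simp only [comap_comap]
    rfl
  rw [h2, mem_comap] at hs
  obtain ⟨t, ht, hts⟩ := hs
  rw [Filter.mem_pi] at ht
  obtain ⟨Q, hQ, r, hr, hrt⟩ := ht
  choose δ hδ hδr using fun q => Metric.mem_uniformity_dist.1 (hr q)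
  obtain ⟨d, hd, hdQ⟩ : ∃ d : ℝ, 0 < d ∧ ∀ q ∈ Q, d ≤ δ q := by
    rcases hQ.toFinset.eq_empty_or_nonempty with h | h
    · exact ⟨1, one_pos, fun q hq => by simp [← Set.Finite.mem_toFinset hQ, h] at hq⟩
    · refine ⟨hQ.toFinset.inf' h δ, (Finset.lt_inf'_iff h).2 fun q _ => hδ q, fun q hq => ?_⟩
      exact Finset.inf'_le _ (hQ.mem_toFinset.2 hq)
  refine ⟨hQ.toFinset, d, hd, fun l l' hl => ?_⟩
  rw [← dist_eq_norm]
  refine @hs' (l, l') (hts (hrt fun q hq => hδr q ?_))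
  rw [dist_eq_norm]
  exact (hl q (hQ.mem_toFinset.2 hq)).trans_le (hdQ q hq)

/-- Simple functions are uniformly continuous in the `2`-norm on bounded tuples, uniformly in the
algebra. -/
theorem exists_twoNorm_evalSimple_sub_lt (R : I → ℝ) (g : SimpleFun R) {ε : ℝ} (hε : 0 < ε) :
    ∃ (F : Finset I) (δ : ℝ), 0 < δ ∧ ∀ (A : Type u) [CStarAlgebra A] (τ : A →ₗ[ℂ] ℂ),
      IsTracialState τ → ∀ a b : I → A, (∀ i, IsSelfAdjoint (a i)) → (∀ i, IsSelfAdjoint (b i)) →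
      (∀ i, ‖a i‖ ≤ R i) → (∀ i, ‖b i‖ ≤ R i) →
      (∀ i ∈ F, twoNorm τ (a i - b i) ≤ δ) →
      twoNorm τ (evalSimple R τ a g - evalSimple R τ b g) < ε := by
  classical
  induction g using TensorProduct.induction_on generalizing ε with
  | zero => exact ⟨∅, 1, one_pos, fun A _ τ _ a b _ _ _ _ _ => by
      simpa [IsTracialState.twoNorm_zero] using hε⟩
  | tmul φ p =>
    obtain ⟨K, hK, hKp⟩ := exists_norm_lift_le.{u} R p
    obtain ⟨Q, η, hη, hφ⟩ := exists_norm_apply_sub_lt R φ (show 0 < ε / 2 / (K + 1) by positivity)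
    obtain ⟨F, δ, hδ, hF⟩ := exists_norm_law_sub_lt.{u} R Q hη
    obtain ⟨G, δ', hδ', hG⟩ := exists_twoNorm_lift_sub_lt.{u} R p
      (show 0 < ε / 2 / (‖φ‖ + 1) by positivity)
    refine ⟨F ∪ G, min δ δ', lt_min hδ hδ', fun A _ τ hτ a b hsa hsb ha hb hab => ?_⟩
    have hla := law_mem_lawSpace hτ hsa ha
    have hlb := law_mem_lawSpace hτ hsb hb
    rw [evalSimple_tmul R τ a hla, evalSimple_tmul R τ b hlb]
    have h1 := hφ ⟨_, hla⟩ ⟨_, hlb⟩ (hF A τ hτ a b ha hb fun i hi =>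
      (hab i (Finset.mem_union_left _ hi)).trans (min_le_left _ _))
    have h2 := hG A τ hτ a b ha hb fun i hi =>
      (hab i (Finset.mem_union_right _ hi)).trans (min_le_right _ _)
    set P := FreeAlgebra.lift ℂ a p with hP
    set P' := FreeAlgebra.lift ℂ b p with hP'
    have h3 : φ ⟨_, hla⟩ • P - φ ⟨_, hlb⟩ • P' =
        (φ ⟨_, hla⟩ - φ ⟨_, hlb⟩) • P + φ ⟨_, hlb⟩ • (P - P') := by module
    have h4 : twoNorm τ P ≤ K := (hτ.twoNorm_le_norm _).trans (hKp A a ha)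
    have h5 : ‖φ ⟨_, hlb⟩‖ ≤ ‖φ‖ := φ.norm_coe_le_norm _
    rw [h3]
    refine (hτ.twoNorm_add_le _ _).trans_lt ?_
    rw [hτ.twoNorm_smul, hτ.twoNorm_smul]
    have h6 : ‖φ ⟨_, hla⟩ - φ ⟨_, hlb⟩‖ * twoNorm τ P ≤ ε / 2 / (K + 1) * K :=
      mul_le_mul h1.le h4 (IsTracialState.twoNorm_nonneg τ _) (by positivity)
    have h7 : ε / 2 / (K + 1) * K ≤ ε / 2 := by
      rw [div_mul_eq_mul_div, div_le_iff₀ (by positivity)]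
      nlinarith
    have h8 : ‖φ ⟨_, hlb⟩‖ * twoNorm τ (P - P') ≤ ‖φ‖ * (ε / 2 / (‖φ‖ + 1)) :=
      mul_le_mul h5 h2.le (IsTracialState.twoNorm_nonneg τ _) (norm_nonneg _)
    have h9 : ‖φ‖ * (ε / 2 / (‖φ‖ + 1)) < ε / 2 := by
      rw [mul_div_assoc', div_lt_iff₀ (by positivity)]
      nlinarith [norm_nonneg φ]
    linarith
  | add g h ihg ihh =>
    obtain ⟨F, δ, hδ, hF⟩ := ihg (half_pos hε)
    obtain ⟨G, δ', hδ', hG⟩ := ihh (half_pos hε)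
    refine ⟨F ∪ G, min δ δ', lt_min hδ hδ', fun A _ τ hτ a b hsa hsb ha hb hab => ?_⟩
    have h1 := hF A τ hτ a b hsa hsb ha hb fun i hi =>
      (hab i (Finset.mem_union_left _ hi)).trans (min_le_left _ _)
    have h2 := hG A τ hτ a b hsa hsb ha hb fun i hi =>
      (hab i (Finset.mem_union_right _ hi)).trans (min_le_right _ _)
    rw [map_add, map_add, add_sub_add_comm]
    exact (hτ.twoNorm_add_le _ _).trans_lt (by linarith)

/-- `Ψ` computes `τ(g(a)* h(a))` from the law of `a`. -/
def RepresentsInner (R : I → ℝ) (g h : SimpleFun R) (Ψ : C(lawSpace R, ℂ)) : Prop :=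
  ∀ (A : Type u) [CStarAlgebra A] (τ : A →ₗ[ℂ] ℂ) (a : I → A) (hl : law τ a ∈ lawSpace R),
    (∀ i, IsSelfAdjoint (a i)) →
    τ (star (evalSimple R τ a g) * evalSimple R τ a h) = Ψ ⟨law τ a, hl⟩

variable {R : I → ℝ}

theorem RepresentsInner.zero_left (h : SimpleFun R) : RepresentsInner.{u} R 0 h 0 :=
  fun A _ τ a _ _ => by simp

theorem RepresentsInner.zero_right (g : SimpleFun R) : RepresentsInner.{u} R g 0 0 :=
  fun A _ τ a _ _ => by simp

theorem RepresentsInner.add_left {g g' h : SimpleFun R} {Ψ Ψ' : C(lawSpace R, ℂ)}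
    (H : RepresentsInner.{u} R g h Ψ) (H' : RepresentsInner.{u} R g' h Ψ') :
    RepresentsInner.{u} R (g + g') h (Ψ + Ψ') := fun A _ τ a hl ha => by
  rw [map_add, star_add, add_mul, map_add, H A τ a hl ha, H' A τ a hl ha]
  rfl

theorem RepresentsInner.add_right {g h h' : SimpleFun R} {Ψ Ψ' : C(lawSpace R, ℂ)}
    (H : RepresentsInner.{u} R g h Ψ) (H' : RepresentsInner.{u} R g h' Ψ') :
    RepresentsInner.{u} R g (h + h') (Ψ + Ψ') := fun A _ τ a hl ha => by
  rw [map_add, mul_add, map_add, H A τ a hl ha, H' A τ a hl ha]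
  rfl

theorem RepresentsInner.tmul (φ ψ : C(lawSpace R, ℂ)) (p q : FreeAlgebra ℂ I) :
    RepresentsInner.{u} R (φ ⊗ₜ p) (ψ ⊗ₜ q)
      (star φ * ψ * ⟨fun l => l.1 (ncStar p * q),
        (continuous_apply _).comp continuous_subtype_val⟩) := fun A _ τ a hl ha => by
  rw [evalSimple_tmul R τ a hl, evalSimple_tmul R τ a hl, star_smul, smul_mul_smul_comm, map_smul,
    ← lift_ncStar a ha, ← map_mul, smul_eq_mul]
  rfl

/-- The same `Ψ` serves two universes because the values at `x` in `M` are later compared with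
values at matrices, which live in `Type`. -/
theorem exists_representsInner (g h : SimpleFun R) :
    ∃ Ψ, RepresentsInner.{u} R g h Ψ ∧ RepresentsInner.{w} R g h Ψ := by
  induction g using TensorProduct.induction_on with
  | zero => exact ⟨0, .zero_left h, .zero_left h⟩
  | add g g' ih ih' =>
    obtain ⟨Ψ, H⟩ := ih
    obtain ⟨Ψ', H'⟩ := ih'
    exact ⟨Ψ + Ψ', H.1.add_left H'.1, H.2.add_left H'.2⟩
  | tmul φ p =>
    induction h using TensorProduct.induction_on with
    | zero => exact ⟨0, .zero_right _, .zero_right _⟩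
    | add h h' ih ih' =>
      obtain ⟨Ψ, H⟩ := ih
      obtain ⟨Ψ', H'⟩ := ih'
      exact ⟨Ψ + Ψ', H.1.add_right H'.1, H.2.add_right H'.2⟩
    | tmul ψ q => exact ⟨_, .tmul φ ψ p q, .tmul φ ψ p q⟩

theorem evalSimple_one_tmul {A : Type u} [CStarAlgebra A] (τ : A →ₗ[ℂ] ℂ) (a : I → A)
    (hl : law τ a ∈ lawSpace R) (p : FreeAlgebra ℂ I) :
    evalSimple R τ a ((1 : C(lawSpace R, ℂ)) ⊗ₜ p) = FreeAlgebra.lift ℂ a p := by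
  rw [evalSimple_tmul R τ a hl]
  simp

/-- The size of a simple function at a tuple depends continuously on the law of the tuple. -/
theorem exists_twoNorm_evalSimple_lt (g : SimpleFun R) {B : Type w} [CStarAlgebra B]
    {σ : B →ₗ[ℂ] ℂ} (hσ : IsTracialState σ) {b : I → B} (hsb : ∀ i, IsSelfAdjoint (b i))
    (hb : ∀ i, ‖b i‖ ≤ R i) {ε : ℝ} (hε : twoNorm σ (evalSimple R σ b g) < ε) :
    ∃ U ∈ 𝓝 (law σ b), ∀ (A : Type u) [CStarAlgebra A] (τ : A →ₗ[ℂ] ℂ),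
      IsTracialState τ → ∀ a : I → A, (∀ i, IsSelfAdjoint (a i)) → (∀ i, ‖a i‖ ≤ R i) →
      law τ a ∈ U → twoNorm τ (evalSimple R τ a g) < ε := by
  obtain ⟨Ψ, h1, h2⟩ := exists_representsInner.{u, v, w} g g
  have hlb := law_mem_lawSpace hσ hsb hb
  -- The squared `2`-norm of `g` at a tuple is the real part of `Ψ` at its law, so smallness is an
  -- open condition on the law.
  have hU : {l : lawSpace R | (Ψ l).re < ε ^ 2} ∈ 𝓝 (⟨law σ b, hlb⟩ : lawSpace R) := by
    refine (isOpen_lt (Complex.continuous_re.comp Ψ.continuous) continuous_const).mem_nhds ?_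
    change (Ψ ⟨law σ b, hlb⟩).re < ε ^ 2
    rw [← h2 B σ b hlb hsb, ← hσ.twoNorm_sq]
    exact pow_lt_pow_left₀ hε (IsTracialState.twoNorm_nonneg σ _) two_ne_zero
  obtain ⟨U, hU1, hU2⟩ := mem_nhds_subtype _ _ _ |>.1 hU
  refine ⟨U, hU1, fun A _ τ hτ a hsa ha hl => ?_⟩
  have hla' := law_mem_lawSpace hτ hsa ha
  have h3 : (Ψ ⟨law τ a, hla'⟩).re < ε ^ 2 := @hU2 ⟨law τ a, hla'⟩ hl
  rw [← h1 A τ a hla' hsa, ← hτ.twoNorm_sq] at h3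
  exact lt_of_pow_lt_pow_left₀ 2 ((IsTracialState.twoNorm_nonneg σ _).trans hε.le) h3

end LawSpace


/-! ### Matrices -/

section MatrixAlgebra

open scoped Matrix.Norms.L2Operator

variable {n : ℕ}

theorem opNorm_eq_norm (a : Mat n) : opNorm a = ‖a‖ := rfl

theorem ntr_apply (a : Mat n) : ntr n a = (n : ℂ)⁻¹ * a.trace := rfl

theorem ntr_star_mul_self (a : Mat n) :
    ntr n (star a * a) = (((n : ℝ)⁻¹ * ∑ i, ∑ j, ‖a i j‖ ^ 2 : ℝ) : ℂ) := by
  rw [ntr_apply, Matrix.trace, Finset.sum_comm]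
  push_cast
  congr 1
  refine Finset.sum_congr rfl fun i _ => ?_
  rw [Matrix.diag_apply, Matrix.mul_apply]
  refine Finset.sum_congr rfl fun j _ => ?_
  rw [Matrix.star_apply, RCLike.star_def, Complex.conj_mul']

theorem twoNorm_ntr_sq (a : Mat n) :
    twoNorm (ntr n) a ^ 2 = (n : ℝ)⁻¹ * ∑ i, ∑ j, ‖a i j‖ ^ 2 := by
  rw [twoNorm, ntr_star_mul_self, Complex.ofReal_re, Real.sq_sqrt (by positivity)]

theorem isTracialState_ntr [NeZero n] : IsTracialState (ntr n) where
  map_one := by simp [ntr_apply, NeZero.ne n]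
  nonneg a := by
    rw [ntr_star_mul_self, Complex.zero_le_real]
    positivity
  tracial a b := by rw [ntr_apply, ntr_apply, Matrix.trace_mul_comm]

theorem norm_apply_sq_le_twoNorm [NeZero n] (a : Mat n) (i j : Fin n) :
    ‖a i j‖ ^ 2 ≤ n * twoNorm (ntr n) a ^ 2 := by
  rw [twoNorm_ntr_sq, mul_inv_cancel_left₀ (by exact_mod_cast NeZero.ne n)]
  calc ‖a i j‖ ^ 2 ≤ ∑ j, ‖a i j‖ ^ 2 :=
        Finset.single_le_sum (f := fun j => ‖a i j‖ ^ 2) (fun _ _ => by positivity)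
          (Finset.mem_univ j)
    _ ≤ ∑ i, ∑ j, ‖a i j‖ ^ 2 :=
        Finset.single_le_sum (f := fun i => ∑ j, ‖a i j‖ ^ 2)
          (fun _ _ => Finset.sum_nonneg fun _ _ => by positivity) (Finset.mem_univ i)

/-- For a fixed size all norms on matrices are equivalent, so that the limit in the definition of
`matEval` is the `L²`-value. -/
theorem tendsto_of_twoNorm [NeZero n] {ι : Type*} {l : Filter ι} {a : ι → Mat n} {b : Mat n}
    (h : Tendsto (fun m => twoNorm (ntr n) (a m - b)) l (𝓝 0)) : Tendsto a l (𝓝 b) := by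
  refine tendsto_pi_nhds.2 fun i => tendsto_pi_nhds.2 fun j => ?_
  rw [tendsto_iff_norm_sub_tendsto_zero]
  have h1 : Tendsto (fun m => Real.sqrt (n * twoNorm (ntr n) (a m - b) ^ 2)) l (𝓝 0) := by
    have := ((h.pow 2).const_mul (n : ℝ)).sqrt
    simpa using this
  refine squeeze_zero (fun _ => norm_nonneg _) (fun m => ?_) h1
  exact Real.le_sqrt_of_sq_le (norm_apply_sq_le_twoNorm (a m - b) i j)

theorem continuous_twoNorm_ntr (n : ℕ) : Continuous (twoNorm (ntr n)) := by
  have h : twoNorm (ntr n) = fun a : Mat n => Real.sqrt ((n : ℝ)⁻¹ * ∑ i, ∑ j, ‖a i j‖ ^ 2) := by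
    funext a
    rw [← twoNorm_ntr_sq, Real.sqrt_sq (IsTracialState.twoNorm_nonneg _ _)]
  rw [h]
  fun_prop

end MatrixAlgebra

/-! ### Transport along trace-preserving homomorphisms -/

section Transfer

variable {I : Type v} {A : Type u} {B : Type w} [Ring A] [Algebra ℂ A] [Ring B] [Algebra ℂ B]

theorem law_algHom {τ : A →ₗ[ℂ] ℂ} {σ : B →ₗ[ℂ] ℂ} (Φ : A →ₐ[ℂ] B) (h : ∀ a, σ (Φ a) = τ a)
    (x : I → A) : law σ (fun i => Φ (x i)) = law τ x := by
  funext p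
  have h1 : FreeAlgebra.lift ℂ (fun i => Φ (x i)) = Φ.comp (FreeAlgebra.lift ℂ x) := by
    ext i
    simp
  rw [law, law, h1, AlgHom.comp_apply, h]

theorem evalSimple_algHom {τ : A →ₗ[ℂ] ℂ} {σ : B →ₗ[ℂ] ℂ} (Φ : A →ₐ[ℂ] B)
    (h : ∀ a, σ (Φ a) = τ a) {R : I → ℝ} (x : I → A) (hx : law τ x ∈ lawSpace R) (g : SimpleFun R) :
    evalSimple R σ (fun i => Φ (x i)) g = Φ (evalSimple R τ x g) := by
  have hl := law_algHom Φ h x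
  have hx' : law σ (fun i => Φ (x i)) ∈ lawSpace R := hl ▸ hx
  have h1 : FreeAlgebra.lift ℂ (fun i => Φ (x i)) = Φ.comp (FreeAlgebra.lift ℂ x) := by
    ext i
    simp
  induction g using TensorProduct.induction_on with
  | zero => simp
  | tmul φ p =>
    rw [evalSimple_tmul R σ _ hx', evalSimple_tmul R τ _ hx, map_smul, h1, AlgHom.comp_apply]
    congr 2
    exact Subtype.ext hl
  | add g g' ih ih' => rw [map_add, map_add, map_add, ih, ih']

theorem twoNorm_starAlgHom [StarRing A] [StarRing B] {τ : A →ₗ[ℂ] ℂ} {σ : B →ₗ[ℂ] ℂ}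
    (Φ : A →⋆ₐ[ℂ] B) (h : ∀ a, σ (Φ a) = τ a) (a : A) : twoNorm σ (Φ a) = twoNorm τ a := by
  rw [twoNorm, twoNorm, ← map_star, ← map_mul, h]

end Transfer

section MatrixVN

open scoped Matrix.Norms.L2Operator

/-- The von Neumann algebra of all bounded operators. -/
def topVN (H : Type u) [NormedAddCommGroup H] [InnerProductSpace ℂ H] [CompleteSpace H] :
    VonNeumannAlgebra H where
  toStarSubalgebra := ⊤
  centralizer_centralizer' := by
    change Set.centralizer (Set.centralizer ((⊤ : StarSubalgebra ℂ (H →L[ℂ] H)) :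
      Set (H →L[ℂ] H))) = _
    simp

/-- The matrix algebra, realized as a von Neumann algebra in any universe. -/
theorem exists_vonNeumann_model (n : ℕ) [NeZero n] :
    ∃ (H : Type v) (_ : NormedAddCommGroup H) (_ : InnerProductSpace ℂ H) (_ : CompleteSpace H)
      (M : VonNeumannAlgebra H) (σ : M.toStarSubalgebra →ₗ[ℂ] ℂ) (Φ : Mat n ≃⋆ₐ[ℂ] M.toStarSubalgebra),
      IsFaithfulNormalTrace M σ ∧ (∀ a, σ (Φ a) = ntr n a) ∧ ∀ a, ‖Φ a‖ = opNorm a := by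
  let e : Mat n ≃⋆ₐ[ℂ] Matrix (ULift.{v} (Fin n)) (ULift.{v} (Fin n)) ℂ :=
    { Matrix.reindexAlgEquiv ℂ ℂ Equiv.ulift.symm with
      map_star' := fun a => rfl
      map_smul' := fun c a => rfl }
  let Ψ := e.trans (Matrix.toEuclideanCLM (n := ULift.{v} (Fin n)) (𝕜 := ℂ))
  have hΨ : ∀ (a : Mat n) (i : Fin n),
      inner ℂ (EuclideanSpace.single (ULift.up.{v} i) (1 : ℂ))
        (Ψ a (EuclideanSpace.single (ULift.up.{v} i) (1 : ℂ))) = a i i := by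
    intro a i
    rw [EuclideanSpace.inner_single_left, map_one, one_mul]
    change (e a).mulVec (Pi.single (ULift.up.{v} i) (1 : ℂ)) (ULift.up i) = a i i
    rw [Matrix.mulVec_single_one]
    rfl
  let M := topVN (EuclideanSpace ℂ (ULift.{v} (Fin n)))
  let T : (EuclideanSpace ℂ (ULift.{v} (Fin n)) →L[ℂ] EuclideanSpace ℂ (ULift.{v} (Fin n))) ≃⋆ₐ[ℂ]
      M.toStarSubalgebra :=
    { toFun := fun a => ⟨a, trivial⟩
      invFun := fun a => a
      left_inv := fun _ => rfl
      right_inv := fun _ => rfl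
      map_mul' := fun _ _ => rfl
      map_add' := fun _ _ => rfl
      map_star' := fun _ => rfl
      map_smul' := fun _ _ => rfl }
  let Φ := Ψ.trans T
  let Φ' : M.toStarSubalgebra →⋆ₐ[ℂ] Mat n := (Φ.symm : M.toStarSubalgebra →⋆ₐ[ℂ] Mat n)
  have hΦ' : ∀ a, Φ (Φ' a) = a := Φ.apply_symm_apply
  have hntr := isTracialState_ntr (n := n)
  refine ⟨_, inferInstance, inferInstance, inferInstance, M, ntr n ∘ₗ Φ'.toAlgHom.toLinearMap, Φ,
    ⟨?_, ?_, ?_, ?_, ?_⟩, ?_, ?_⟩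
  · change ntr n (Φ' 1) = 1
    rw [map_one, hntr.map_one]
  · intro a
    change 0 ≤ ntr n (Φ' (star a * a))
    rw [map_mul, map_star]
    exact hntr.nonneg _
  · intro a ha
    change ntr n (Φ' (star a * a)) = 0 at ha
    rw [map_mul, map_star, ← hntr.ofReal_twoNorm_sq, Complex.ofReal_eq_zero] at ha
    rw [← hΦ' a]
    have h0 : Φ' a = 0 := by
      ext i j
      have := norm_apply_sq_le_twoNorm (Φ' a) i j
      rw [ha, mul_zero] at this
      simpa using le_antisymm this (by positivity)
    rw [h0, map_zero]
  · intro a b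
    change ntr n (Φ' (a * b)) = ntr n (Φ' (b * a))
    rw [map_mul Φ', map_mul Φ', hntr.tracial]
  -- Normality: the normalized trace is the sum of `n⁻¹ ⟨e_k, a e_k⟩`, with the orthonormal basis
  -- extended by zeros to a sequence.
  · let ξ : ℕ → EuclideanSpace ℂ (ULift.{v} (Fin n)) := fun k =>
      if h : k < n then EuclideanSpace.single (ULift.up ⟨k, h⟩) (1 : ℂ) else 0
    have hξ : ∀ k ∉ Finset.range n, ξ k = 0 := fun k hk => dif_neg (by simpa using hk)
    refine ⟨fun k => (n : ℂ)⁻¹ • ξ k, ξ, ?_, ?_, ?_⟩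
    · exact summable_of_ne_finset_zero (s := Finset.range n) fun k hk => by simp [hξ k hk]
    · exact summable_of_ne_finset_zero (s := Finset.range n) fun k hk => by simp [hξ k hk]
    · intro a
      obtain ⟨a, rfl⟩ : ∃ b, Φ b = a := ⟨Φ' a, hΦ' a⟩
      have h1 : (ntr n ∘ₗ Φ'.toAlgHom.toLinearMap) (Φ a) = ∑ k ∈ Finset.range n,
          inner ℂ (ξ k) ((Φ a : EuclideanSpace ℂ (ULift.{v} (Fin n)) →L[ℂ] _)
            ((n : ℂ)⁻¹ • ξ k)) := by
        change ntr n (Φ.symm (Φ a)) = _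
        rw [Φ.symm_apply_apply, ntr_apply, Matrix.trace, Finset.mul_sum, ← Fin.sum_univ_eq_sum_range
          (fun k => inner ℂ (ξ k) ((Φ a : EuclideanSpace ℂ (ULift.{v} (Fin n)) →L[ℂ] _)
            ((n : ℂ)⁻¹ • ξ k)))]
        refine Finset.sum_congr rfl fun i _ => ?_
        rw [map_smul, inner_smul_right, Matrix.diag_apply, ← hΨ a i]
        have h2 : ξ i = EuclideanSpace.single (ULift.up.{v} i) (1 : ℂ) := dif_pos i.2
        rw [h2]
        rfl
      rw [h1]
      exact hasSum_sum_of_ne_finset_zero fun k hk => by simp [hξ k hk]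
  · intro a
    change ntr n (Φ.symm (Φ a)) = ntr n a
    rw [Φ.symm_apply_apply]
  · intro a
    rw [opNorm_eq_norm]
    exact NonUnitalStarAlgHom.norm_map Φ Φ.injective a

end MatrixVN


/-! ### Values of `L²`-functions on matrix tuples -/

section MatEval

open scoped Matrix.Norms.L2Operator

variable {I : Type v} {I' : Type w} {n : ℕ} {R : I → ℝ} {R' : I' → ℝ}

theorem MatTuple.isSelfAdjoint_toMat (A : MatTuple I n) (i : I) : IsSelfAdjoint (A.toMat i) :=
  (A i).2

theorem law_mem_lawSpace_of_mem_matBall [NeZero n] {A : MatTuple I n} (hA : A ∈ matBall R n) :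
    law (ntr n) A.toMat ∈ lawSpace R :=
  law_mem_lawSpace isTracialState_ntr A.isSelfAdjoint_toMat hA

/-- The supremum runs over von Neumann algebras on Hilbert spaces in the universe of `I`; a copy of
the matrix algebra there makes every bounded matrix tuple a competitor. -/
theorem twoNorm_evalSimple_le [NeZero n] {A : MatTuple I n} (hA : A ∈ matBall R n)
    (g : SimpleFun R) :
    ENNReal.ofReal (twoNorm (ntr n) (evalSimple R (ntr n) A.toMat g)) ≤ twoNormSup R g := by
  obtain ⟨H, i1, i2, i3, M, σ, Φ, hσ, hΦσ, hΦ⟩ := exists_vonNeumann_model.{v} n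
  have hl := law_mem_lawSpace_of_mem_matBall hA
  have h1 := evalSimple_algHom ((Φ : Mat n →⋆ₐ[ℂ] M.toStarSubalgebra) : Mat n →ₐ[ℂ] M.toStarSubalgebra)
    (τ := ntr n) (σ := σ) hΦσ A.toMat hl g
  have h2 : twoNorm (ntr n) (evalSimple R (ntr n) A.toMat g) =
      twoNorm σ (evalSimple R σ (fun i => Φ (A.toMat i)) g) := by
    rw [← twoNorm_starAlgHom (Φ : Mat n →⋆ₐ[ℂ] M.toStarSubalgebra) hΦσ]
    exact congrArg (twoNorm σ) h1.symm
  have hx : (fun i => Φ (A.toMat i)) ∈ boundedTuples M R := fun i =>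
    ⟨(A.isSelfAdjoint_toMat i).map Φ, (hΦ _).trans_le (hA i)⟩
  rw [h2, twoNormSup]
  exact le_iSup_of_le H <| le_iSup_of_le i1 <| le_iSup_of_le i2 <| le_iSup_of_le i3 <|
    le_iSup_of_le M <| le_iSup_of_le σ <| le_iSup_of_le hσ <|
    le_iSup_of_le (fun i => Φ (A.toMat i)) <| le_iSup_of_le hx le_rfl

theorem exists_hasValue_matrix [NeZero n] {f : I' → ℕ → SimpleFun R} (hf : f ∈ FunTuples R R')
    (j : I') {A : MatTuple I n} (hA : A ∈ matBall R n) :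
    ∃ b : Mat n, IsSelfAdjoint b ∧ opNorm b ≤ R' j ∧ HasValue R (ntr n) A.toMat (f j) b := by
  obtain ⟨H, i1, i2, i3, M, σ, Φ, hσ, hΦσ, hΦ⟩ := exists_vonNeumann_model.{v} n
  have hl := law_mem_lawSpace_of_mem_matBall hA
  have hx : (fun i => Φ (A.toMat i)) ∈ boundedTuples M R := fun i =>
    ⟨(A.isSelfAdjoint_toMat i).map Φ, (hΦ _).trans_le (hA i)⟩
  obtain ⟨b, hb, hbR, hbv⟩ := (hf j).2 H i1 i2 i3 M σ hσ _ hx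
  have hΦs : Φ (Φ.symm b) = b := Φ.apply_symm_apply b
  refine ⟨Φ.symm b, hb.map Φ.symm, ?_, ?_⟩
  · rw [← hΦ, hΦs]
    exact hbR
  · refine hbv.congr fun m => ?_
    have h1 := evalSimple_algHom
      ((Φ : Mat n →⋆ₐ[ℂ] M.toStarSubalgebra) : Mat n →ₐ[ℂ] M.toStarSubalgebra)
      (τ := ntr n) (σ := σ) hΦσ A.toMat hl (f j m)
    rw [← twoNorm_starAlgHom (Φ : Mat n →⋆ₐ[ℂ] M.toStarSubalgebra) hΦσ, map_sub]
    exact congrArg (twoNorm σ) (congrArg₂ (· - ·) h1 hΦs.symm)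

theorem matEval_spec [NeZero n] {f : I' → ℕ → SimpleFun R} (hf : f ∈ FunTuples R R')
    {A : MatTuple I n} (hA : A ∈ matBall R n) (j : I') :
    opNorm ((matEval R f n A).toMat j) ≤ R' j ∧
      HasValue R (ntr n) A.toMat (f j) ((matEval R f n A).toMat j) := by
  obtain ⟨b, hb, hbR, hbv⟩ := exists_hasValue_matrix hf j hA
  have h : (matEval R f n A).toMat j = b := by
    have h1 : limUnder atTop (fun m => evalSimple R (ntr n) A.toMat (f j m)) = b :=
      (tendsto_of_twoNorm hbv).limUnder_eq
    change ((selfAdjointPart ℝ (limUnder atTop fun m => evalSimple R (ntr n) A.toMat (f j m)) :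
      selfAdjoint (Mat n)) : Mat n) = b
    rw [h1, hb.coe_selfAdjointPart_apply ℝ]
  rw [h]
  exact ⟨hbR, hbv⟩

/-- On bounded matrix tuples, `f_j` is uniformly approximated by simple functions. -/
theorem exists_twoNorm_evalSimple_sub_matEval_le {f : I' → ℕ → SimpleFun R}
    (hf : f ∈ FunTuples R R') (j : I') {ε : ℝ} (hε : 0 < ε) :
    ∃ N, ∀ m ≥ N, ∀ (n : ℕ) [NeZero n] (A : MatTuple I n), A ∈ matBall R n →
      twoNorm (ntr n) (evalSimple R (ntr n) A.toMat (f j m) - (matEval R f n A).toMat j) ≤ ε := by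
  obtain ⟨N, hN⟩ := (hf j).1 (ENNReal.ofReal ε) (ENNReal.ofReal_pos.2 hε)
  refine ⟨N, fun m hm n _ A hA => ?_⟩
  have hτ := isTracialState_ntr (n := n)
  have hv := (matEval_spec hf hA j).2
  set b := (matEval R f n A).toMat j
  have h1 : ∀ m' ≥ N, twoNorm (ntr n) (evalSimple R (ntr n) A.toMat (f j m) - b) ≤
      ε + twoNorm (ntr n) (evalSimple R (ntr n) A.toMat (f j m') - b) := by
    intro m' hm'
    refine (hτ.twoNorm_sub_le _ (evalSimple R (ntr n) A.toMat (f j m')) _).trans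
      (add_le_add ?_ le_rfl)
    rw [← map_sub]
    exact (ENNReal.ofReal_le_ofReal_iff hε.le).1
      ((twoNorm_evalSimple_le hA _).trans (hN m hm m' hm'))
  have h2 := hv.const_add ε
  rw [add_zero] at h2
  exact ge_of_tendsto h2 (eventually_atTop.2 ⟨N, h1⟩)

/-- `f_j` is uniformly continuous in the `2`-norm on bounded matrix tuples, uniformly in the size
of the matrices. -/
theorem exists_twoNorm_matEval_sub_lt {f : I' → ℕ → SimpleFun R} (hf : f ∈ FunTuples R R')
    (j : I') {ε : ℝ} (hε : 0 < ε) :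
    ∃ (F : Finset I) (δ : ℝ), 0 < δ ∧ ∀ (n : ℕ) [NeZero n] (A B : MatTuple I n),
      A ∈ matBall R n → B ∈ matBall R n →
      (∀ i ∈ F, twoNorm (ntr n) (A.toMat i - B.toMat i) ≤ δ) →
      twoNorm (ntr n) ((matEval R f n A).toMat j - (matEval R f n B).toMat j) < ε := by
  obtain ⟨N, hN⟩ := exists_twoNorm_evalSimple_sub_matEval_le hf j (show 0 < ε / 3 by positivity)
  obtain ⟨F, δ, hδ, h⟩ := exists_twoNorm_evalSimple_sub_lt.{0} R (f j N)
    (show 0 < ε / 3 by positivity)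
  refine ⟨F, δ, hδ, fun n _ A B hA hB hAB => ?_⟩
  have hτ := isTracialState_ntr (n := n)
  have h1 := h (Mat n) (ntr n) hτ A.toMat B.toMat A.isSelfAdjoint_toMat B.isSelfAdjoint_toMat hA hB
    hAB
  have h2 := hN N le_rfl n A hA
  have h3 := hN N le_rfl n B hB
  have h4 := hτ.twoNorm_sub_le ((matEval R f n A).toMat j) (evalSimple R (ntr n) A.toMat (f j N))
    ((matEval R f n B).toMat j)
  have h5 := hτ.twoNorm_sub_le (evalSimple R (ntr n) A.toMat (f j N))
    (evalSimple R (ntr n) B.toMat (f j N)) ((matEval R f n B).toMat j)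
  rw [hτ.twoNorm_sub_comm _ (evalSimple R (ntr n) A.toMat (f j N))] at h4
  linarith

theorem continuous_toMat_apply (n : ℕ) (i : I) :
    Continuous fun A : MatTuple I n => A.toMat i :=
  continuous_subtype_val.comp (continuous_apply (A := fun _ => selfAdjoint (Mat n)) i)

theorem continuous_opNorm (n : ℕ) : Continuous (opNorm : Mat n → ℝ) :=
  continuous_norm (E := Mat n)

theorem isClosed_matBall (R : I → ℝ) (n : ℕ) : IsClosed (matBall R n) := by
  simp only [matBall, Set.ofPred_forall]
  exact isClosed_iInter fun i =>
    isClosed_le ((continuous_opNorm n).comp (continuous_toMat_apply n i)) continuous_const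

theorem measurableSet_matBall (R : I → ℝ) (n : ℕ) : MeasurableSet (matBall R n) :=
  (isClosed_matBall R n).measurableSet

theorem isOpen_nbhd (F : Finset I) (ε : ℝ) (Ω : Set (MatTuple I n)) : IsOpen (nbhd F ε Ω) := by
  have h : nbhd F ε Ω = ⋃ A ∈ Ω, ⋂ i ∈ F, {B | twoNorm (ntr n) (A.toMat i - B.toMat i) < ε} := by
    ext B
    simp [nbhd]
  rw [h]
  refine isOpen_biUnion fun A _ => isOpen_biInter_finset fun i _ => ?_
  exact isOpen_lt ((continuous_twoNorm_ntr n).comp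
    (continuous_const.sub (continuous_toMat_apply n i))) continuous_const

theorem continuousOn_matEval_apply [NeZero n] {f : I' → ℕ → SimpleFun R}
    (hf : f ∈ FunTuples R R') (j : I') :
    ContinuousOn (fun A : MatTuple I n => (matEval R f n A).toMat j) (matBall R n) := by
  intro A hA
  have hτ := isTracialState_ntr (n := n)
  refine tendsto_of_twoNorm (b := (matEval R f n A).toMat j) ?_
  rw [Metric.tendsto_nhds]
  intro ε hε
  obtain ⟨F, δ, hδ, h⟩ := exists_twoNorm_matEval_sub_lt hf j hε
  have h1 : nbhd F δ {A} ∈ 𝓝[matBall R n] A := by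
    refine mem_nhdsWithin_of_mem_nhds ((isOpen_nbhd F δ {A}).mem_nhds ⟨A, rfl, fun i _ => ?_⟩)
    rw [sub_self, IsTracialState.twoNorm_zero]
    exact hδ
  filter_upwards [h1, self_mem_nhdsWithin] with B hB hBR
  obtain ⟨A', hA', hAB⟩ := hB
  rw [Set.mem_singleton_iff.1 hA'] at hAB
  rw [dist_zero_right, Real.norm_of_nonneg (IsTracialState.twoNorm_nonneg _ _)]
  refine h n B A hBR hA fun i hi => ?_
  rw [hτ.twoNorm_sub_comm]
  exact (hAB i hi).le

theorem continuousOn_matEval [NeZero n] {f : I' → ℕ → SimpleFun R} (hf : f ∈ FunTuples R R') :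
    ContinuousOn (matEval R f n) (matBall R n) :=
  continuousOn_pi (X := fun _ => selfAdjoint (Mat n)).2 fun j =>
    Topology.IsInducing.subtypeVal.continuousOn_iff.2 (continuousOn_matEval_apply hf j)

/-- Off the norm ball the limits need not exist and nothing is known about the map. The ball is
closed and conull, which suffices for the push-forward. -/
theorem aemeasurable_matEval [NeZero n] {f : I' → ℕ → SimpleFun R} (hf : f ∈ FunTuples R R')
    {μ : Measure (MatTuple I n)} (hμ : μ (matBall R n)ᶜ = 0) :
    AEMeasurable (matEval R f n) μ := by
  have h : μ.restrict (matBall R n) = μ := Measure.restrict_eq_self_of_ae_mem hμ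
  rw [← h]
  exact (continuousOn_matEval hf).aemeasurable (measurableSet_matBall R n)

end MatEval


/-! ### Self-adjoint matrices with close moments are almost unitarily conjugate -/

section UnitaryMatching

/-- One crossing index `i₀` makes every term `h (a i) - h (b i)` nonnegative: by monotonicity `h (a
i) = 1` before `i₀` and `h (b i) = 0` after it. Each crossing index contributes exactly `1`. -/
theorem card_crossing_le {n : ℕ} {a b : Fin n → ℝ} (ha : Antitone a) (hb : Antitone b) {s t : ℝ}
    {h : ℝ → ℝ} (h0 : ∀ r, 0 ≤ h r) (h1 : ∀ r, h r ≤ 1) (hs : ∀ r < s, h r = 0)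
    (ht : ∀ r, t ≤ r → h r = 1) :
    ((Finset.univ.filter fun i => t ≤ a i ∧ b i < s).card : ℝ) ≤ |∑ i, h (a i) - ∑ i, h (b i)| := by
  rcases (Finset.univ.filter fun i => t ≤ a i ∧ b i < s).eq_empty_or_nonempty with he | ⟨i₀, hi₀⟩
  · rw [he]
    simp
  · refine le_trans ?_ (le_abs_self _)
    rw [Finset.mem_filter] at hi₀
    obtain ⟨-, hta, hbs⟩ := hi₀
    rw [← Finset.sum_sub_distrib, Finset.card_filter, Nat.cast_sum]
    refine Finset.sum_le_sum fun i _ => ?_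
    split_ifs with hi
    · rw [ht _ hi.1, hs _ hi.2]
      simp
    · rw [Nat.cast_zero, sub_nonneg]
      rcases le_total i i₀ with hle | hle
      · rw [ht _ (hta.trans (ha hle))]
        exact h1 _
      · rw [hs _ ((hb hle).trans_lt hbs)]
        exact h0 _

/-- The ramp function that climbs from `0` at `s` to `1` at `s + θ`. -/
def ramp (s θ r : ℝ) : ℝ := min 1 (max 0 ((r - s) / θ))

theorem continuous_ramp (s θ : ℝ) : Continuous (ramp s θ) := by
  unfold ramp
  fun_prop

/-- Matching of quantiles: if two decreasing lists differ by more than `2θ` at an index, one of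
finitely many ramps separates the two values, and `card_crossing_le` bounds how often this happens.
-/
theorem exists_sum_sq_sub_le {K ε : ℝ} (hK : 0 < K) (hε : 0 < ε) :
    ∃ (N : ℕ) (h : Fin N → ℝ → ℝ) (η : ℝ), (∀ k, Continuous (h k)) ∧ 0 < η ∧
      ∀ (n : ℕ) (a b : Fin n → ℝ), Antitone a → Antitone b → (∀ i, |a i| ≤ K) → (∀ i, |b i| ≤ K) →
        (∀ k, |∑ i, h k (a i) - ∑ i, h k (b i)| ≤ η * n) → ∑ i, (a i - b i) ^ 2 ≤ ε * n := by
  obtain ⟨θ, hθ, hθε⟩ : ∃ θ : ℝ, 0 < θ ∧ (2 * θ) ^ 2 ≤ ε / 2 := by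
    refine ⟨Real.sqrt (ε / 2) / 2, by positivity, ?_⟩
    rw [mul_div_cancel₀ _ two_ne_zero, Real.sq_sqrt (by positivity)]
  obtain ⟨N, hN⟩ := exists_nat_gt (2 * K / θ)
  rw [div_lt_iff₀ hθ] at hN
  -- There are at most `2(N + 1)ηn` bad indices, each costing at most `(2K)²`; together they cost
  -- `εn / 2`.
  set η := ε / (2 * ((2 * K) ^ 2 * (2 * (N + 1)))) with hη
  have hη0 : 0 < η := by positivity
  refine ⟨N + 1, fun k => ramp (-K + k * θ) θ, η, fun k => continuous_ramp _ _, hη0,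
    fun n a b ha hb haK hbK hab => ?_⟩
  let S : Fin (N + 1) → Finset (Fin n) := fun k => Finset.univ.filter fun i =>
    -K + k * θ + θ ≤ a i ∧ b i < -K + k * θ
  let S' : Fin (N + 1) → Finset (Fin n) := fun k => Finset.univ.filter fun i =>
    -K + k * θ + θ ≤ b i ∧ a i < -K + k * θ
  have h0 : ∀ s r, 0 ≤ ramp s θ r := fun s r => le_min zero_le_one (le_max_left _ _)
  have h1 : ∀ s r, ramp s θ r ≤ 1 := fun s r => min_le_left _ _
  have h2 : ∀ s, ∀ r < s, ramp s θ r = 0 := fun s r hr => by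
    have : (r - s) / θ ≤ 0 := div_nonpos_of_nonpos_of_nonneg (by linarith) hθ.le
    rw [ramp, max_eq_left this, min_eq_right zero_le_one]
  have h3 : ∀ s r, s + θ ≤ r → ramp s θ r = 1 := fun s r hr => by
    have : 1 ≤ (r - s) / θ := by rw [le_div_iff₀ hθ]; linarith
    rw [ramp, max_eq_right (zero_le_one.trans this), min_eq_left this]
  have hS : ∀ k, ((S k).card : ℝ) ≤ η * n := fun k =>
    (card_crossing_le ha hb (h0 _) (h1 _) (h2 _) (h3 _)).trans (hab k)
  have hS' : ∀ k, ((S' k).card : ℝ) ≤ η * n := fun k =>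
    (card_crossing_le hb ha (h0 _) (h1 _) (h2 _) (h3 _)).trans (by rw [abs_sub_comm]; exact hab k)
  have hcross : ∀ c d : ℝ, |c| ≤ K → |d| ≤ K → 2 * θ < c - d →
      ∃ k : Fin (N + 1), -K + k * θ + θ ≤ c ∧ d < -K + k * θ := by
    intro c d hc hd hcd
    rw [abs_le] at hc hd
    -- The grid point with index `m + 1` is the first one above `d`. It exceeds `d` by at most `θ`,
    -- so the next one is still below `c`.
    set m := ⌊(d + K) / θ⌋₊ with hm
    have hm1 : (m : ℝ) * θ ≤ d + K := by
      rw [← le_div_iff₀ hθ]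
      exact Nat.floor_le (div_nonneg (by linarith) hθ.le)
    have hm2 : d + K < (m + 1) * θ := by
      rw [← div_lt_iff₀ hθ]
      exact Nat.lt_floor_add_one _
    have hmN : m + 1 < N + 1 := by
      have : (m : ℝ) * θ < N * θ := by linarith
      have := lt_of_mul_lt_mul_right this hθ.le
      exact Nat.succ_lt_succ (by exact_mod_cast this)
    refine ⟨⟨m + 1, hmN⟩, ?_, ?_⟩ <;> push_cast <;> linarith
  let T : Finset (Fin n) := Finset.univ.biUnion S ∪ Finset.univ.biUnion S'
  have hT : (T.card : ℝ) ≤ 2 * (N + 1) * η * n := by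
    have e1 : ((Finset.univ.biUnion S).card : ℝ) ≤ (N + 1) * (η * n) := by
      refine (Nat.cast_le.2 Finset.card_biUnion_le).trans ?_
      rw [Nat.cast_sum]
      refine (Finset.sum_le_sum fun k _ => hS k).trans ?_
      simp
    have e2 : ((Finset.univ.biUnion S').card : ℝ) ≤ (N + 1) * (η * n) := by
      refine (Nat.cast_le.2 Finset.card_biUnion_le).trans ?_
      rw [Nat.cast_sum]
      refine (Finset.sum_le_sum fun k _ => hS' k).trans ?_
      simp
    have e3 : (T.card : ℝ) ≤ (Finset.univ.biUnion S).card + (Finset.univ.biUnion S').card := by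
      exact_mod_cast Finset.card_union_le _ _
    linarith
  have hgood : ∀ i ∉ T, (a i - b i) ^ 2 ≤ ε / 2 := by
    intro i hi
    have h4 : ∀ k, i ∉ S k := fun k hk => hi (Finset.mem_union_left _
      (Finset.mem_biUnion.2 ⟨k, Finset.mem_univ k, hk⟩))
    have h5 : ∀ k, i ∉ S' k := fun k hk => hi (Finset.mem_union_right _
      (Finset.mem_biUnion.2 ⟨k, Finset.mem_univ k, hk⟩))
    have h6 : a i - b i ≤ 2 * θ := by
      by_contra! h
      obtain ⟨k, hk⟩ := hcross _ _ (haK i) (hbK i) h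
      exact h4 k (Finset.mem_filter.2 ⟨Finset.mem_univ i, hk⟩)
    have h7 : b i - a i ≤ 2 * θ := by
      by_contra! h
      obtain ⟨k, hk⟩ := hcross _ _ (hbK i) (haK i) h
      exact h5 k (Finset.mem_filter.2 ⟨Finset.mem_univ i, hk⟩)
    refine le_trans ?_ hθε
    rw [sq_le_sq]
    refine (abs_le.2 ⟨by linarith, h6⟩).trans (le_abs_self _)
  have hall : ∀ i, (a i - b i) ^ 2 ≤ (2 * K) ^ 2 := by
    intro i
    have h4 := abs_le.1 (haK i)
    have h5 := abs_le.1 (hbK i)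
    exact sq_le_sq' (by linarith) (by linarith)
  calc ∑ i, (a i - b i) ^ 2
      ≤ ∑ i, (ε / 2 + if i ∈ T then (2 * K) ^ 2 else 0) := by
        refine Finset.sum_le_sum fun i _ => ?_
        split_ifs with hi
        · linarith [hall i]
        · linarith [hgood i hi]
    _ = ε / 2 * n + T.card * (2 * K) ^ 2 := by
        rw [Finset.sum_add_distrib, Finset.sum_const, Finset.sum_ite_mem, Finset.univ_inter,
          Finset.sum_const]
        simp [mul_comm]
    _ ≤ ε / 2 * n + (2 * (N + 1) * η * n) * (2 * K) ^ 2 :=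
        add_le_add le_rfl (mul_le_mul_of_nonneg_right hT (sq_nonneg _))
    _ = ε * n := by
        rw [hη]
        field_simp
        ring

open scoped Matrix.Norms.L2Operator

/-- The spectral theorem, with the eigenvalues in decreasing order. -/
theorem exists_antitone_diagonalization {n : ℕ} {X : Mat n} (hX : IsSelfAdjoint X) :
    ∃ (a : Fin n → ℝ) (U : Mat n), Antitone a ∧ U ∈ unitary (Mat n) ∧
      X = U * Matrix.diagonal (fun i => (a i : ℂ)) * star U ∧ ∀ i, |a i| ≤ opNorm X := by
  have hH : X.IsHermitian := hX
  set lam := hH.eigenvalues with hlam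
  set V : Mat n := (hH.eigenvectorUnitary : Mat n) with hV
  have hVu : V ∈ unitary (Mat n) := hH.eigenvectorUnitary.2
  have hspec : X = V * Matrix.diagonal (fun i => (lam i : ℂ)) * star V := by
    have := hH.spectral_theorem
    rw [Unitary.conjStarAlgAut_apply] at this
    exact this
  -- Sorting the negatives in increasing order puts the eigenvalues in decreasing order; the columns
  -- of `V` are permuted accordingly.
  let σ : Equiv.Perm (Fin n) := Tuple.sort fun i => -lam i
  have hσ : Monotone fun i => -lam (σ i) := Tuple.monotone_sort fun i => -lam i
  have hU1 : star (V.submatrix id σ) = (star V).submatrix σ id := rfl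
  have hU2 : Matrix.diagonal (fun i => (lam (σ i) : ℂ)) =
      (Matrix.diagonal fun i => (lam i : ℂ)).submatrix σ σ := by
    rw [Matrix.submatrix_diagonal_equiv]
    rfl
  have hU : V.submatrix id σ ∈ unitary (Mat n) := by
    rw [Unitary.mem_iff, hU1]
    constructor
    · rw [← Matrix.submatrix_mul _ _ _ _ _ Function.bijective_id, Unitary.star_mul_self_of_mem hVu,
        Matrix.submatrix_one_equiv]
    · rw [Matrix.submatrix_mul_equiv, Unitary.mul_star_self_of_mem hVu, Matrix.submatrix_id_id]
  have hXU : X = V.submatrix id σ * Matrix.diagonal (fun i => (lam (σ i) : ℂ)) *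
      star (V.submatrix id σ) := by
    rw [hU1, hU2, Matrix.submatrix_mul_equiv, Matrix.submatrix_mul_equiv, Matrix.submatrix_id_id,
      ← hspec]
  refine ⟨fun i => lam (σ i), V.submatrix id σ, fun i j hij => neg_le_neg_iff.1 (hσ hij), hU, hXU,
    fun i => ?_⟩
  have h1 : ‖X‖ = ‖Matrix.diagonal (fun i => (lam (σ i) : ℂ))‖ := by
    conv_lhs => rw [hXU]
    rw [CStarRing.norm_mul_mem_unitary _ (Unitary.star_mem hU), CStarRing.norm_mem_unitary_mul _ hU]
  rw [opNorm_eq_norm, h1, Matrix.l2_opNorm_diagonal]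
  have := norm_le_pi_norm (fun i => (lam (σ i) : ℂ)) i
  rwa [Complex.norm_real, Real.norm_eq_abs] at this

theorem unitary_conj_pow {A : Type u} [CStarAlgebra A] {u : A} (hu : u ∈ unitary A) (d : A) (k : ℕ) :
    (u * d * star u) ^ k = u * d ^ k * star u := by
  induction k with
  | zero => simp [Unitary.mul_star_self_of_mem hu]
  | succ k ih =>
    rw [pow_succ, ih, pow_succ]
    simp only [mul_assoc]
    rw [← mul_assoc (star u) u, Unitary.star_mul_self_of_mem hu, one_mul]

theorem ntr_pow_of_diagonalization {n : ℕ} {a : Fin n → ℝ} {U X : Mat n} (hU : U ∈ unitary (Mat n))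
    (hX : X = U * Matrix.diagonal (fun i => (a i : ℂ)) * star U) (k : ℕ) :
    ntr n (X ^ k) = (((n : ℝ)⁻¹ * ∑ i, a i ^ k : ℝ) : ℂ) := by
  rw [hX, unitary_conj_pow hU, ntr_apply, mul_assoc, Matrix.trace_mul_comm, mul_assoc,
    Unitary.star_mul_self_of_mem hU, mul_one, Matrix.diagonal_pow, Matrix.trace_diagonal]
  push_cast
  rfl

theorem sum_eval_eq {n : ℕ} (P : Polynomial ℝ) (a : Fin n → ℝ) :
    ∑ i, P.eval (a i) = ∑ k ∈ Finset.range (P.natDegree + 1), P.coeff k * ∑ i, a i ^ k := by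
  simp only [Polynomial.eval_eq_sum_range, Finset.mul_sum]
  exact Finset.sum_comm

/-- Self-adjoint matrices with close moments are close to being unitarily conjugate. -/
theorem exists_unitary_conj_close {K ε : ℝ} (hK : 0 < K) (hε : 0 < ε) :
    ∃ (m : ℕ) (δ : ℝ), 0 < δ ∧ ∀ (n : ℕ) [NeZero n] (X Y : Mat n), IsSelfAdjoint X →
      IsSelfAdjoint Y → opNorm X ≤ K → opNorm Y ≤ K →
      (∀ k ≤ m, ‖ntr n (X ^ k) - ntr n (Y ^ k)‖ ≤ δ) →
      ∃ u ∈ unitary (Mat n), twoNorm (ntr n) (u * X * star u - Y) ≤ ε := by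
  obtain ⟨N, h, η, hcont, hη, H⟩ := exists_sum_sq_sub_le hK (show 0 < ε ^ 2 by positivity)
  have hpoly : ∀ k, ∃ P : Polynomial ℝ, ∀ t ∈ Set.Icc (-K) K, |P.eval t - h k t| < η / 3 :=
    fun k => exists_polynomial_near_of_continuousOn _ _ _ (hcont k).continuousOn _ (by positivity)
  choose P hP using hpoly
  set m := Finset.univ.sup fun k => (P k).natDegree
  -- `L` dominates the sum of the absolute values of the coefficients of each `P k`, so moments
  -- within `η / 3 / (L + 1)` give averages of `P k` within `η / 3`. The remaining two thirds
  -- replace the ramps by polynomials.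
  set L := ∑ k, ∑ l ∈ Finset.range ((P k).natDegree + 1), |(P k).coeff l| with hL
  have hL0 : 0 ≤ L := Finset.sum_nonneg fun k _ => Finset.sum_nonneg fun l _ => abs_nonneg _
  refine ⟨m, η / 3 / (L + 1), by positivity, fun n _ X Y hX hY hXK hYK hXY => ?_⟩
  have hτ := isTracialState_ntr (n := n)
  have hn : (0 : ℝ) < n := by exact_mod_cast NeZero.pos n
  obtain ⟨a, U, ha, hU, hXU, haK⟩ := exists_antitone_diagonalization hX
  obtain ⟨b, V, hb, hV, hYV, hbK⟩ := exists_antitone_diagonalization hY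
  have hmom : ∀ k ≤ m, |∑ i, a i ^ k - ∑ i, b i ^ k| ≤ η / 3 / (L + 1) * n := by
    intro k hk
    have := hXY k hk
    rw [ntr_pow_of_diagonalization hU hXU, ntr_pow_of_diagonalization hV hYV, ← Complex.ofReal_sub,
      Complex.norm_real, ← mul_sub, norm_mul, norm_inv, Real.norm_eq_abs, Real.norm_eq_abs,
      abs_of_pos hn, inv_mul_le_iff₀ hn] at this
    linarith
  have hsum : ∀ k, |∑ i, h k (a i) - ∑ i, h k (b i)| ≤ η * n := by
    intro k
    have hab : ∀ c : Fin n → ℝ, (∀ i, |c i| ≤ K) →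
        |∑ i, h k (c i) - ∑ i, (P k).eval (c i)| ≤ η / 3 * n := by
      intro c hc
      rw [← Finset.sum_sub_distrib]
      refine (Finset.abs_sum_le_sum_abs _ _).trans ?_
      refine (Finset.sum_le_card_nsmul _ _ (η / 3) fun i _ => ?_).trans ?_
      · rw [abs_sub_comm]
        exact (hP k (c i) (abs_le.1 (hc i))).le
      · simp [mul_comm]
    have hPab : |∑ i, (P k).eval (a i) - ∑ i, (P k).eval (b i)| ≤ η / 3 * n := by
      rw [sum_eval_eq, sum_eval_eq, ← Finset.sum_sub_distrib]
      have h1 : ∑ l ∈ Finset.range ((P k).natDegree + 1), |(P k).coeff l| ≤ L :=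
        Finset.single_le_sum (f := fun k => ∑ l ∈ Finset.range ((P k).natDegree + 1), |(P k).coeff l|)
          (fun k _ => Finset.sum_nonneg fun l _ => abs_nonneg _) (Finset.mem_univ k)
      calc _ ≤ ∑ l ∈ Finset.range ((P k).natDegree + 1),
            |(P k).coeff l * ∑ i, a i ^ l - (P k).coeff l * ∑ i, b i ^ l| :=
            Finset.abs_sum_le_sum_abs _ _
        _ ≤ ∑ l ∈ Finset.range ((P k).natDegree + 1), |(P k).coeff l| * (η / 3 / (L + 1) * n) := by
            refine Finset.sum_le_sum fun l hl => ?_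
            rw [← mul_sub, abs_mul]
            refine mul_le_mul_of_nonneg_left (hmom l ?_) (abs_nonneg _)
            exact (Nat.lt_succ_iff.1 (Finset.mem_range.1 hl)).trans
              (Finset.le_sup (f := fun k => (P k).natDegree) (Finset.mem_univ k))
        _ ≤ L * (η / 3 / (L + 1) * n) := by
            rw [← Finset.sum_mul]
            exact mul_le_mul_of_nonneg_right h1 (by positivity)
        _ = L / (L + 1) * (η / 3 * n) := by ring
        _ ≤ 1 * (η / 3 * n) := by
            refine mul_le_mul_of_nonneg_right ?_ (by positivity)
            rw [div_le_one (by positivity)]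
            linarith
        _ = η / 3 * n := one_mul _
    have h1 := hab a fun i => (haK i).trans hXK
    have h2 := hab b fun i => (hbK i).trans hYK
    rw [abs_le] at *
    constructor <;> linarith [h1.1, h1.2, h2.1, h2.2, hPab.1, hPab.2]
  have hfin := H n a b ha hb (fun i => (haK i).trans hXK) (fun i => (hbK i).trans hYK) hsum
  -- This unitary carries the ordered eigenbasis of `X` to that of `Y`, so the distance becomes that
  -- of the sorted eigenvalue lists.
  refine ⟨V * star U, mul_mem hV (Unitary.star_mem hU), ?_⟩
  have h1 : V * star U * X * star (V * star U) - Y = V * (Matrix.diagonal (fun i => (a i : ℂ)) -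
      Matrix.diagonal (fun i => (b i : ℂ))) * star V := by
    have e1 : star U * U = 1 := Unitary.star_mul_self_of_mem hU
    rw [hXU, hYV, star_mul, star_star, mul_sub, sub_mul]
    congr 1
    simp only [mul_assoc]
    rw [← mul_assoc (star U) U (star V), e1, one_mul, ← mul_assoc (star U) U, e1, one_mul]
  rw [h1, hτ.twoNorm_conj hV, Matrix.diagonal_sub]
  refine (sq_le_sq₀ (IsTracialState.twoNorm_nonneg _ _) hε.le).1 ?_
  have h2 : ∀ i : Fin n, ∑ j, ‖Matrix.diagonal (fun i => (a i : ℂ) - (b i : ℂ)) i j‖ ^ 2 =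
      (a i - b i) ^ 2 := by
    intro i
    rw [Finset.sum_eq_single i]
    · rw [Matrix.diagonal_apply_eq, ← Complex.ofReal_sub, Complex.norm_real, Real.norm_eq_abs, sq_abs]
    · intro j _ hj
      rw [Matrix.diagonal_apply_ne' _ hj, norm_zero, zero_pow two_ne_zero]
    · simp
  rw [twoNorm_ntr_sq, inv_mul_le_iff₀ hn]
  simp only [h2]
  linarith

end UnitaryMatching


/-! ### Covering the unitaries that almost commute with a matrix -/

section Separated

/-- Volume comparison: the balls of radius `δ / 2` around the points are disjoint and lie in the
ball of radius `r + δ / 2`. -/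
theorem card_le_of_separated {E : Type*} [NormedAddCommGroup E] [NormedSpace ℝ E]
    [FiniteDimensional ℝ E] {r δ : ℝ} (hr : 0 ≤ r) (hδ : 0 < δ) (s : Finset E)
    (hs : ∀ c ∈ s, ‖c‖ ≤ r) (h : ∀ c ∈ s, ∀ d ∈ s, c ≠ d → δ ≤ ‖c - d‖) :
    (s.card : ℝ) ≤ (1 + 2 * r / δ) ^ Module.finrank ℝ E := by
  borelize E
  let μ : Measure E := Measure.addHaar
  have hδ2 : 0 < δ / 2 := by positivity
  have hρ : 0 < r + δ / 2 := by positivity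
  set A := ⋃ c ∈ s, Metric.ball (c : E) (δ / 2) with hA
  have D : Set.Pairwise (s : Set E) (Function.onFun Disjoint fun c => Metric.ball (c : E) (δ / 2)) := by
    rintro c hc d hd hcd
    apply Metric.ball_disjoint_ball
    rw [dist_eq_norm, add_halves]
    exact h c hc d hd hcd
  have hsub : A ⊆ Metric.ball (0 : E) (r + δ / 2) := by
    refine Set.iUnion₂_subset fun x hx => Metric.ball_subset_ball' ?_
    rw [dist_zero_right, add_comm]
    exact add_le_add (hs x hx) le_rfl
  have I : (s.card : ℝ≥0∞) * ENNReal.ofReal ((δ / 2) ^ Module.finrank ℝ E) * μ (Metric.ball 0 1) ≤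
      ENNReal.ofReal ((r + δ / 2) ^ Module.finrank ℝ E) * μ (Metric.ball 0 1) :=
    calc
      (s.card : ℝ≥0∞) * ENNReal.ofReal ((δ / 2) ^ Module.finrank ℝ E) * μ (Metric.ball 0 1)
          = μ A := by
        rw [hA, measure_biUnion_finset D fun c _ => measurableSet_ball]
        simp only [μ.addHaar_ball_of_pos _ hδ2, Finset.sum_const, nsmul_eq_mul, mul_assoc]
      _ ≤ μ (Metric.ball (0 : E) (r + δ / 2)) := measure_mono hsub
      _ = _ := by simp only [μ.addHaar_ball_of_pos _ hρ]
  have J : (s.card : ℝ≥0∞) * ENNReal.ofReal ((δ / 2) ^ Module.finrank ℝ E) ≤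
      ENNReal.ofReal ((r + δ / 2) ^ Module.finrank ℝ E) :=
    (ENNReal.mul_le_mul_iff_left (Metric.measure_ball_pos _ _ zero_lt_one).ne'
      measure_ball_lt_top.ne).1 I
  have K := ENNReal.toReal_le_of_le_ofReal (by positivity) J
  rw [ENNReal.toReal_mul, ENNReal.toReal_natCast, ENNReal.toReal_ofReal (by positivity),
    ← le_div_iff₀ (by positivity), ← div_pow] at K
  refine K.trans_eq ?_
  congr 1
  field_simp
  ring

/-- A `δ`-separated set of maximal cardinality is a `δ`-net; the bound guarantees that a maximum
exists. -/
theorem exists_net_of_separated_card_le {X : Type*} (T : Set X) (d : X → X → ℝ)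
    (hd : ∀ x, d x x = 0) (hsymm : ∀ x y, d x y = d y x) {δ : ℝ} (hδ : 0 < δ) {N : ℝ}
    (h : ∀ s : Finset X, (∀ x ∈ s, x ∈ T) → (∀ x ∈ s, ∀ y ∈ s, x ≠ y → δ ≤ d x y) →
      (s.card : ℝ) ≤ N) :
    ∃ s : Finset X, (s.card : ℝ) ≤ N ∧ (∀ x ∈ s, x ∈ T) ∧ ∀ x ∈ T, ∃ y ∈ s, d x y < δ := by
  classical
  let P : ℕ → Prop := fun m => ∃ s : Finset X, s.card = m ∧ (∀ x ∈ s, x ∈ T) ∧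
    ∀ x ∈ s, ∀ y ∈ s, x ≠ y → δ ≤ d x y
  have hbound : ∀ m, P m → m ≤ ⌊N⌋₊ := by
    rintro _ ⟨s, rfl, hs1, hs2⟩
    exact Nat.le_floor (h s hs1 hs2)
  have h0 : P 0 := ⟨∅, by simp⟩
  obtain ⟨s, hs, hs1, hs2⟩ : P (Nat.findGreatest P ⌊N⌋₊) := Nat.findGreatest_spec (Nat.zero_le _) h0
  refine ⟨s, h s hs1 hs2, hs1, fun x hx => ?_⟩
  by_contra! hfar
  have hxs : x ∉ s := fun hxs => by
    have := hfar x hxs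
    rw [hd] at this
    linarith
  have hP : P (s.card + 1) := by
    refine ⟨insert x s, Finset.card_insert_of_notMem hxs, ?_, ?_⟩
    · intro y hy
      rcases Finset.mem_insert.1 hy with rfl | hy
      exacts [hx, hs1 y hy]
    · intro y hy y' hy' hne
      rcases Finset.mem_insert.1 hy with h1 | h1 <;> rcases Finset.mem_insert.1 hy' with h2 | h2
      · exact absurd (h1.trans h2.symm) hne
      · exact h1 ▸ hfar y' h2
      · rw [hsymm]
        exact h2 ▸ hfar y h1
      · exact hs2 y h1 y' h2 hne
  have := Nat.le_findGreatest (hbound _ hP) hP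
  omega

end Separated

/-! ### A net for the unitaries near the commutant -/

section NearCommutant

open scoped Matrix.Norms.L2Operator

variable {n : ℕ}

/-- The pairs of indices whose eigenvalues are closer than `θ`. -/
def closePairs (a : Fin n → ℝ) (θ : ℝ) : Finset (Fin n × Fin n) :=
  Finset.univ.filter fun p => |a p.1 - a p.2| < θ

theorem sum_norm_sq_eq [NeZero n] (W : Mat n) :
    ∑ p : Fin n × Fin n, ‖W p.1 p.2‖ ^ 2 = n * twoNorm (ntr n) W ^ 2 := by
  rw [twoNorm_ntr_sq, mul_inv_cancel_left₀ (by exact_mod_cast NeZero.ne n), Fintype.sum_prod_type]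

/-- In an eigenbasis of `C` the commutator multiplies the entry at `p` by `± (a p.1 - a p.2)`, so
the entries at pairs with gap at least `θ` are controlled by the commutator divided by `θ`.
Recording the other entries, by `Φ`, nearly preserves distances, and the volume bound applies in
real dimension twice the number of close pairs. -/
theorem exists_net_near_commutant [NeZero n] {C U : Mat n} {a : Fin n → ℝ}
    (hU : U ∈ unitary (Mat n)) (hC : C = U * Matrix.diagonal (fun i => (a i : ℂ)) * star U)
    {δ η θ : ℝ} (hδ : 0 < δ) (hθ : 0 < θ) (hη : 4 * η ≤ θ * δ) :
    ∃ s : Finset (Mat n), (s.card : ℝ) ≤ (1 + 4 / δ) ^ (2 * (closePairs a θ).card) ∧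
      (∀ V ∈ s, V ∈ unitary (Mat n)) ∧
      ∀ V ∈ unitary (Mat n), twoNorm (ntr n) (V * C - C * V) ≤ η →
        ∃ V₀ ∈ s, twoNorm (ntr n) (V - V₀) < δ := by
  classical
  have hτ := isTracialState_ntr (n := n)
  have hn : (0 : ℝ) < n := by exact_mod_cast NeZero.pos n
  set D : Mat n := Matrix.diagonal (fun i => (a i : ℂ)) with hD
  have eU : star U * U = 1 := Unitary.star_mul_self_of_mem hU
  have eU' : U * star U = 1 := Unitary.mul_star_self_of_mem hU
  let Ψ : Mat n →ₗ[ℂ] Mat n := LinearMap.mulRight ℂ U ∘ₗ LinearMap.mulLeft ℂ (star U)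
  have hΨ : ∀ V, Ψ V = star U * V * U := fun V => rfl
  have hΨnorm : ∀ V, twoNorm (ntr n) (Ψ V) = twoNorm (ntr n) V := fun V => by
    rw [hΨ]
    conv_lhs => rw [← star_star U, star_star (star U)]
    simpa using hτ.twoNorm_conj (Unitary.star_mem hU) V
  let Φ : Mat n →ₗ[ℂ] EuclideanSpace ℂ (closePairs a θ) :=
    { toFun := fun V => WithLp.toLp 2 fun p => Ψ V p.1.1 p.1.2
      map_add' := fun V W => by ext p; simp
      map_smul' := fun c V => by ext p; simp }
  have hΦ : ∀ V, ‖Φ V‖ ^ 2 = ∑ p ∈ closePairs a θ, ‖Ψ V p.1 p.2‖ ^ 2 := fun V => by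
    rw [EuclideanSpace.norm_sq_eq, ← Finset.sum_coe_sort (closePairs a θ)]
    rfl
  have hcomm : ∀ V, Ψ (V * C - C * V) = Ψ V * D - D * Ψ V := fun V => by
    rw [map_sub, hΨ, hΨ, hΨ, hC]
    congr 1
    · simp only [mul_assoc, eU, mul_one]
    · simp only [← mul_assoc, eU, one_mul]
  have hcomm' : ∀ V, n * twoNorm (ntr n) (V * C - C * V) ^ 2 =
      ∑ p : Fin n × Fin n, (a p.1 - a p.2) ^ 2 * ‖Ψ V p.1 p.2‖ ^ 2 := fun V => by
    rw [← hΨnorm, hcomm, ← sum_norm_sq_eq]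
    refine Finset.sum_congr rfl fun p _ => ?_
    rw [Matrix.sub_apply, hD, Matrix.mul_diagonal, Matrix.diagonal_mul, mul_comm, ← sub_mul, norm_mul,
      mul_pow, ← Complex.ofReal_sub, Complex.norm_real, Real.norm_eq_abs, sq_abs]
    ring
  have hlower : ∀ V, n * twoNorm (ntr n) V ^ 2 ≤
      ‖Φ V‖ ^ 2 + n * twoNorm (ntr n) (V * C - C * V) ^ 2 / θ ^ 2 := fun V => by
    rw [← hΨnorm V, ← sum_norm_sq_eq, hΦ, hcomm', ← Finset.sum_filter_add_sum_filter_not Finset.univ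
      (fun p : Fin n × Fin n => |a p.1 - a p.2| < θ)]
    refine add_le_add le_rfl ?_
    rw [le_div_iff₀ (by positivity), Finset.sum_mul]
    refine (Finset.sum_le_sum fun p hp => ?_).trans
      (Finset.sum_le_sum_of_subset_of_nonneg (Finset.filter_subset _ _) fun p _ _ => by positivity)
    rw [mul_comm]
    refine mul_le_mul_of_nonneg_right ?_ (sq_nonneg _)
    rw [sq_le_sq, abs_of_pos hθ]
    exact not_lt.1 (Finset.mem_filter.1 hp).2
  have hupper : ∀ V, ‖Φ V‖ ^ 2 ≤ n * twoNorm (ntr n) V ^ 2 := fun V => by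
    rw [hΦ, ← hΨnorm V, ← sum_norm_sq_eq]
    exact Finset.sum_le_sum_of_subset_of_nonneg (Finset.subset_univ _) fun p _ _ => by positivity
  let T : Set (Mat n) := {V | V ∈ unitary (Mat n) ∧ twoNorm (ntr n) (V * C - C * V) ≤ η}
  have hcard : ∀ s : Finset (Mat n), (∀ V ∈ s, V ∈ T) →
      (∀ V ∈ s, ∀ W ∈ s, V ≠ W → δ ≤ twoNorm (ntr n) (V - W)) →
      (s.card : ℝ) ≤ (1 + 4 / δ) ^ (2 * (closePairs a θ).card) := by
    intro s hsT hsep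
    have hsep' : ∀ V ∈ s, ∀ W ∈ s, V ≠ W → Real.sqrt n * δ / 2 ≤ ‖Φ V - Φ W‖ := by
      intro V hV W hW hVW
      have h1 := hsep V hV W hW hVW
      have h2 : twoNorm (ntr n) ((V - W) * C - C * (V - W)) ≤ 2 * η := by
        have e : (V - W) * C - C * (V - W) = (V * C - C * V) - (W * C - C * W) := by noncomm_ring
        rw [e, sub_eq_add_neg]
        have h3 := hτ.twoNorm_add_le (V * C - C * V) (-(W * C - C * W))
        rw [hτ.twoNorm_neg] at h3
        linarith [(hsT V hV).2, (hsT W hW).2]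
      have h3 := hlower (V - W)
      have h4 : twoNorm (ntr n) ((V - W) * C - C * (V - W)) ^ 2 ≤ (θ * δ / 2) ^ 2 :=
        pow_le_pow_left₀ (IsTracialState.twoNorm_nonneg _ _) (h2.trans (by linarith)) 2
      have h5 : n * twoNorm (ntr n) ((V - W) * C - C * (V - W)) ^ 2 / θ ^ 2 ≤ n * (δ ^ 2 / 4) := by
        rw [div_le_iff₀ (by positivity)]
        calc _ ≤ n * (θ * δ / 2) ^ 2 := mul_le_mul_of_nonneg_left h4 hn.le
          _ = _ := by ring
      have h6 : δ ^ 2 ≤ twoNorm (ntr n) (V - W) ^ 2 := pow_le_pow_left₀ hδ.le h1 2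
      have h7 : n * δ ^ 2 ≤ n * twoNorm (ntr n) (V - W) ^ 2 := mul_le_mul_of_nonneg_left h6 hn.le
      rw [← map_sub]
      refine (sq_le_sq₀ (by positivity) (norm_nonneg _)).1 ?_
      rw [div_pow, mul_pow, Real.sq_sqrt hn.le]
      nlinarith [mul_pos hn (pow_pos hδ 2)]
    have hinj : Set.InjOn Φ s := by
      intro V hV W hW hVW
      by_contra hne
      have := hsep' V hV W hW hne
      rw [hVW, sub_self, norm_zero] at this
      have : 0 < Real.sqrt n * δ / 2 := by positivity
      linarith
    -- A unitary has `2`-norm `1`, so its image has norm at most `√n`. With separation `√n δ / 2`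
    -- this gives the base `1 + 4 / δ`.
    have hcard := card_le_of_separated (r := Real.sqrt n) (δ := Real.sqrt n * δ / 2)
      (Real.sqrt_nonneg _) (by positivity) (s.image Φ) ?_ ?_
    · rw [Finset.card_image_of_injOn hinj, finrank_real_of_complex, finrank_euclideanSpace,
        Fintype.card_coe] at hcard
      refine hcard.trans_eq ?_
      congr 2
      have : 0 < Real.sqrt n := by positivity
      field_simp
      norm_num
    · intro c hc
      obtain ⟨V, hV, rfl⟩ := Finset.mem_image.1 hc
      refine Real.le_sqrt_of_sq_le ((hupper V).trans ?_)
      have h1 : twoNorm (ntr n) V = 1 := by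
        have := IsTracialState.twoNorm_unitary_mul (ntr n) (hsT V hV).1 1
        rwa [mul_one, hτ.twoNorm_one] at this
      rw [h1]
      simp
    · intro c hc d hd hcd
      obtain ⟨V, hV, rfl⟩ := Finset.mem_image.1 hc
      obtain ⟨W, hW, rfl⟩ := Finset.mem_image.1 hd
      exact hsep' V hV W hW fun h => hcd (h ▸ rfl)
  obtain ⟨s, hs, hsT, hnet⟩ := exists_net_of_separated_card_le T
    (fun V W => twoNorm (ntr n) (V - W)) (fun V => by rw [sub_self, IsTracialState.twoNorm_zero])
    (fun V W => hτ.twoNorm_sub_comm V W) hδ hcard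
  exact ⟨s, hs, fun V hV => (hsT V hV).1, fun V hV hVη => hnet V ⟨hV, hVη⟩⟩

end NearCommutant


/-! ### Diffuse spectrum: few pairs of close eigenvalues -/

section Diffuse

/-- The polynomial `(1 - ((s - t) / L)²)^m`, expanded in monomials. -/
theorem exists_monomial_expansion (L : ℝ) (m : ℕ) :
    ∃ (N : ℕ) (d : ℕ → ℕ) (c : ℕ → ℕ → ℝ), ∀ s t : ℝ, (1 - ((s - t) / L) ^ 2) ^ m =
      ∑ q ∈ Finset.range N, ∑ p ∈ Finset.range (d q), c q p * (s ^ p * t ^ q) := by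
  let P : Polynomial (Polynomial ℝ) :=
    (1 - Polynomial.C (Polynomial.C (1 / L ^ 2)) *
      (Polynomial.C Polynomial.X - Polynomial.X) ^ 2) ^ m
  refine ⟨P.natDegree + 1, fun q => (P.coeff q).natDegree + 1, fun q p => (P.coeff q).coeff p,
    fun s t => ?_⟩
  have h1 : P.evalEval s t = (1 - ((s - t) / L) ^ 2) ^ m := by
    simp only [P, Polynomial.evalEval, Polynomial.eval_pow, Polynomial.eval_sub, Polynomial.eval_one,
      Polynomial.eval_mul, Polynomial.eval_C, Polynomial.eval_X]
    congr 2
    rw [div_pow]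
    ring
  rw [← h1, Polynomial.evalEval, Polynomial.eval_eq_sum_range (p := P), Polynomial.eval_finsetSum]
  refine Finset.sum_congr rfl fun q _ => ?_
  rw [Polynomial.eval_mul, Polynomial.eval_pow, Polynomial.eval_C, Polynomial.eval_eq_sum_range,
    Finset.sum_mul]
  refine Finset.sum_congr rfl fun p _ => ?_
  ring

/-- The powers tend to the indicator function of the diagonal, which is a null set for `ν × ν`
because `ν` has no atoms. -/
theorem exists_integral_pow_lt {ν : Measure ℝ} [IsProbabilityMeasure ν] [NullSingletonClass ν]
    {B L : ℝ} (hB : ∀ᵐ t ∂ν, |t| ≤ B) (hBL : 2 * B < L) (hL : 0 < L) {κ : ℝ} (hκ : 0 < κ) :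
    ∃ m : ℕ, ∫ p, (1 - ((p.1 - p.2) / L) ^ 2) ^ m ∂(ν.prod ν) < κ := by
  have hne : ∀ᵐ p ∂(ν.prod ν), p.1 ≠ p.2 := by
    have hm : MeasurableSet {p : ℝ × ℝ | p.1 ≠ p.2} := (isOpen_ne_fun continuous_fst
      continuous_snd).measurableSet
    rw [Measure.ae_prod_iff_ae_ae hm]
    refine Eventually.of_forall fun s => ?_
    have : ∀ᵐ t ∂ν, t ∉ ({s} : Set ℝ) := measure_eq_zero_iff_ae_notMem.1 (measure_singleton s)
    filter_upwards [this] with t ht h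
    exact ht h.symm
  have h1 : ∀ᵐ p ∂(ν.prod ν), |p.1| ≤ B := Measure.quasiMeasurePreserving_fst.ae hB
  have h2 : ∀ᵐ p ∂(ν.prod ν), |p.2| ≤ B := Measure.quasiMeasurePreserving_snd.ae hB
  have hlim : Tendsto (fun m : ℕ => ∫ p, (1 - ((p.1 - p.2) / L) ^ 2) ^ m ∂(ν.prod ν)) atTop
      (𝓝 (∫ _, (0 : ℝ) ∂(ν.prod ν))) := by
    refine tendsto_integral_of_dominated_convergence (fun _ => 1) (fun m => ?_) (integrable_const _)
      (fun m => ?_) ?_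
    · exact (Continuous.aestronglyMeasurable (by fun_prop))
    · filter_upwards [h1, h2] with p hp1 hp2
      rw [norm_pow, Real.norm_eq_abs]
      refine pow_le_one₀ (abs_nonneg _) ?_
      have h3 : ((p.1 - p.2) / L) ^ 2 ≤ 1 := by
        rw [div_pow, div_le_one (by positivity)]
        rw [abs_le] at hp1 hp2
        exact sq_le_sq' (by linarith) (by linarith)
      rw [abs_le]
      constructor <;> nlinarith [sq_nonneg ((p.1 - p.2) / L)]
    · filter_upwards [h1, h2, hne] with p hp1 hp2 hp
      refine tendsto_pow_atTop_nhds_zero_of_abs_lt_one ?_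
      have h3 : ((p.1 - p.2) / L) ^ 2 ≤ 1 := by
        rw [div_pow, div_le_one (by positivity)]
        rw [abs_le] at hp1 hp2
        exact sq_le_sq' (by linarith) (by linarith)
      have h4 : 0 < ((p.1 - p.2) / L) ^ 2 := by
        have : p.1 - p.2 ≠ 0 := sub_ne_zero.2 hp
        positivity
      rw [abs_lt]
      constructor <;> linarith
  rw [integral_zero] at hlim
  exact (hlim.eventually (gt_mem_nhds hκ)).exists

/-- Together with `sum_prod_expansion`, this expresses the double integral for `ν` and the double
sum over eigenvalues by the same polynomial in the moments, so convergence of moments compares them.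
-/
theorem integral_prod_expansion {ν : Measure ℝ} [IsProbabilityMeasure ν] {B : ℝ}
    (hB : ∀ᵐ t ∂ν, |t| ≤ B) (N : ℕ) (d : ℕ → ℕ) (c : ℕ → ℕ → ℝ) :
    ∫ z, (∑ q ∈ Finset.range N, ∑ p ∈ Finset.range (d q), c q p * (z.1 ^ p * z.2 ^ q)) ∂(ν.prod ν) =
      ∑ q ∈ Finset.range N, ∑ p ∈ Finset.range (d q),
        c q p * ((∫ s, s ^ p ∂ν) * ∫ t, t ^ q ∂ν) := by
  have hint : ∀ p : ℕ, Integrable (fun s : ℝ => s ^ p) ν := fun p => by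
    refine Integrable.of_bound (Continuous.aestronglyMeasurable (by fun_prop)) (B ^ p) ?_
    filter_upwards [hB] with t ht
    rw [norm_pow, Real.norm_eq_abs]
    exact pow_le_pow_left₀ (abs_nonneg t) ht p
  have hint2 : ∀ p q : ℕ, Integrable (fun z : ℝ × ℝ => z.1 ^ p * z.2 ^ q) (ν.prod ν) :=
    fun p q => (hint p).mul_prod (hint q)
  rw [integral_finsetSum _ fun q _ => integrable_finsetSum _ fun p _ => (hint2 p q).const_mul _]
  refine Finset.sum_congr rfl fun q _ => ?_
  rw [integral_finsetSum _ fun p _ => (hint2 p q).const_mul _]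
  refine Finset.sum_congr rfl fun p _ => ?_
  rw [integral_const_mul, integral_prod_mul (fun s : ℝ => s ^ p) (fun t : ℝ => t ^ q)]

theorem sum_prod_expansion {n : ℕ} (a : Fin n → ℝ) (N : ℕ) (d : ℕ → ℕ) (c : ℕ → ℕ → ℝ) :
    ∑ z : Fin n × Fin n, (∑ q ∈ Finset.range N, ∑ p ∈ Finset.range (d q),
      c q p * (a z.1 ^ p * a z.2 ^ q)) =
      ∑ q ∈ Finset.range N, ∑ p ∈ Finset.range (d q),
        c q p * ((∑ i, a i ^ p) * ∑ j, a j ^ q) := by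
  rw [Finset.sum_comm]
  refine Finset.sum_congr rfl fun q _ => ?_
  rw [Finset.sum_comm]
  refine Finset.sum_congr rfl fun p _ => ?_
  rw [← Finset.mul_sum, Fintype.sum_prod_type, Finset.sum_mul_sum]

variable {H : Type u} [NormedAddCommGroup H] [InnerProductSpace ℂ H] [CompleteSpace H]
  {M : VonNeumannAlgebra H} {τ : M.toStarSubalgebra →ₗ[ℂ] ℂ}

theorem IsMicrostateSeq.tendsto_moment {z : M.toStarSubalgebra} {n : ℕ → ℕ}
    {C : ∀ k, selfAdjoint (Mat (n k))} (hC : IsMicrostateSeq τ z n C) (m : ℕ) :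
    Tendsto (fun k => ntr (n k) ((C k : Mat (n k)) ^ m)) atTop (𝓝 (τ (z ^ m))) := by
  have := tendsto_pi_nhds.1 hC (FreeAlgebra.ι ℂ () ^ m)
  simpa [law] using this

open scoped Matrix.Norms.L2Operator

/-- Microstates for an element with diffuse spectrum have few pairs of close eigenvalues. -/
theorem IsDiffuse.eventually_card_closePairs_le {z : M.toStarSubalgebra} (hz : IsDiffuse τ z)
    {n : ℕ → ℕ} (hn : Tendsto n atTop atTop) {C : ∀ k, selfAdjoint (Mat (n k))}
    (hC : IsMicrostateSeq τ z n C) {K : ℝ} (hCK : ∀ k, opNorm (C k : Mat (n k)) ≤ K) {κ : ℝ}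
    (hκ : 0 < κ) :
    ∃ θ : ℝ, 0 < θ ∧ ∀ᶠ k in atTop, ∀ (a : Fin (n k) → ℝ) (U : Mat (n k)),
      U ∈ unitary (Mat (n k)) →
      (C k : Mat (n k)) = U * Matrix.diagonal (fun i => (a i : ℂ)) * star U →
      (∀ i, |a i| ≤ opNorm (C k : Mat (n k))) →
      ((closePairs a θ).card : ℝ) ≤ κ * (n k : ℝ) ^ 2 := by
  obtain ⟨-, ν, hν1, hν2, ⟨S, hS, hνS⟩, hmom⟩ := hz
  obtain ⟨B, hB⟩ := hS.isBounded.exists_norm_le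
  have hB' : ∀ᵐ t ∂ν, |t| ≤ B := by
    have : ∀ᵐ t ∂ν, t ∈ S := hνS
    filter_upwards [this] with t ht
    exact hB t ht
  -- `L` exceeds the diameters of the support of `ν` and of all the spectra, so `1 - ((s - t) / L)²`
  -- lies in `[0, 1]` at all relevant points.
  set L := max (2 * K) (2 * B) + 1 with hLdef
  have hK0 : 0 ≤ K := (norm_nonneg _).trans (hCK 0)
  have hLK : 2 * K < L := (le_max_left _ _).trans_lt (lt_add_one _)
  have hLB : 2 * B < L := (le_max_right _ _).trans_lt (lt_add_one _)
  have hL : 0 < L := by linarith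
  obtain ⟨m, hm⟩ := exists_integral_pow_lt hB' hLB hL (show 0 < κ / 2 by positivity)
  obtain ⟨N, d, c, hexp⟩ := exists_monomial_expansion L m
  simp only [hexp] at hm
  rw [integral_prod_expansion hB'] at hm
  have hmomR : ∀ p : ℕ, Tendsto (fun k => (ntr (n k) ((C k : Mat (n k)) ^ p)).re) atTop
      (𝓝 (∫ s, s ^ p ∂ν)) := fun p => by
    have h := (Complex.continuous_re.tendsto _).comp (hC.tendsto_moment p)
    rwa [hmom, Complex.ofReal_re] at h
  have hlim := tendsto_finsetSum (Finset.range N) fun q _ =>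
    tendsto_finsetSum (Finset.range (d q)) fun p _ =>
      ((hmomR p).mul (hmomR q)).const_mul (c q p)
  have hev := hlim.eventually (gt_mem_nhds hm)
  -- By Bernoulli's inequality the `m`-th power is at least `1 / 2` at pairs closer than this `θ`;
  -- Markov's inequality then counts them.
  refine ⟨L / (2 * (m + 1)), by positivity, ?_⟩
  filter_upwards [hev, hn.eventually_ge_atTop 1] with k hk hnk a U hU hCU ha
  have hn0 : (0 : ℝ) < n k := by exact_mod_cast hnk
  simp only [ntr_pow_of_diagonalization hU hCU, Complex.ofReal_re] at hk
  have hsum : ∑ z : Fin (n k) × Fin (n k), (1 - ((a z.1 - a z.2) / L) ^ 2) ^ m ≤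
      κ / 2 * (n k : ℝ) ^ 2 := by
    simp only [hexp]
    rw [sum_prod_expansion]
    have h1 : ∑ q ∈ Finset.range N, ∑ p ∈ Finset.range (d q),
        c q p * ((∑ i, a i ^ p) * ∑ j, a j ^ q) = (∑ q ∈ Finset.range N, ∑ p ∈ Finset.range (d q),
        c q p * (((n k : ℝ)⁻¹ * ∑ i, a i ^ p) * ((n k : ℝ)⁻¹ * ∑ j, a j ^ q))) * (n k : ℝ) ^ 2 := by
      rw [Finset.sum_mul]
      refine Finset.sum_congr rfl fun q _ => ?_
      rw [Finset.sum_mul]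
      refine Finset.sum_congr rfl fun p _ => ?_
      field_simp
    rw [h1]
    exact mul_le_mul_of_nonneg_right hk.le (by positivity)
  have hrange : ∀ i j, ((a i - a j) / L) ^ 2 ≤ 1 := fun i j => by
    have h1 := abs_le.1 ((ha i).trans (hCK k))
    have h2 := abs_le.1 ((ha j).trans (hCK k))
    rw [div_pow, div_le_one (by positivity)]
    exact sq_le_sq' (by linarith) (by linarith)
  have hlow : ∀ z ∈ closePairs a (L / (2 * (m + 1))),
      1 / 2 ≤ (1 - ((a z.1 - a z.2) / L) ^ 2) ^ m := by
    intro z hz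
    have h1 : |a z.1 - a z.2| < L / (2 * (m + 1)) := (Finset.mem_filter.1 hz).2
    have h2 : ((a z.1 - a z.2) / L) ^ 2 ≤ (1 / (2 * (m + 1))) ^ 2 := by
      rw [sq_le_sq, abs_div, abs_of_pos hL, abs_of_pos (by positivity : (0 : ℝ) < 1 / (2 * (m + 1))),
        div_le_iff₀ hL]
      refine h1.le.trans_eq ?_
      ring
    have h3 := one_add_mul_le_pow (a := -((a z.1 - a z.2) / L) ^ 2)
      (by linarith [hrange z.1 z.2]) m
    rw [← sub_eq_add_neg] at h3
    refine le_trans ?_ h3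
    have h4 : (m : ℝ) * ((a z.1 - a z.2) / L) ^ 2 ≤ m * (1 / (2 * (m + 1))) ^ 2 :=
      mul_le_mul_of_nonneg_left h2 (Nat.cast_nonneg m)
    have h5 : (m : ℝ) * (1 / (2 * (m + 1))) ^ 2 ≤ 1 / 2 := by
      rw [div_pow, one_pow, mul_one_div, div_le_iff₀ (by positivity)]
      nlinarith [(Nat.cast_nonneg m : (0 : ℝ) ≤ m)]
    linarith
  have h1 : ((closePairs a (L / (2 * (m + 1)))).card : ℝ) * (1 / 2) ≤ κ / 2 * (n k : ℝ) ^ 2 := by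
    refine le_trans ?_ hsum
    rw [← nsmul_eq_mul]
    refine (Finset.card_nsmul_le_sum _ _ _ hlow).trans ?_
    refine Finset.sum_le_sum_of_subset_of_nonneg (Finset.subset_univ _) fun z _ _ => ?_
    exact pow_nonneg (by linarith [hrange z.1 z.2]) m
  linarith

end Diffuse


/-! ### Covering numbers from vanishing entropy -/

/-- Turns a bound on the exponential rate, with `c = n²`, into a bound on the quantity itself, both
for covering numbers and for the concentration function. -/
theorem lt_ofReal_exp_of_log_lt {K : ℝ≥0∞} {c κ : ℝ} (hc : 0 < c)
    (h : ((c⁻¹ : ℝ) : EReal) * ENNReal.log K < κ) : K < ENNReal.ofReal (Real.exp (κ * c)) := by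
  have h1 : ((κ : ℝ) : EReal) = ENNReal.log (ENNReal.ofReal (Real.exp κ)) := by
    rw [ENNReal.log_ofReal_of_pos (Real.exp_pos κ), Real.log_exp]
  rw [h1, ← ENNReal.log_rpow, ENNReal.log_lt_log_iff] at h
  have h2 := ENNReal.rpow_lt_rpow h hc
  rwa [← ENNReal.rpow_mul, inv_mul_cancel₀ hc.ne', ENNReal.rpow_one,
    ENNReal.ofReal_rpow_of_pos (Real.exp_pos κ), ← Real.exp_mul] at h2

theorem exists_finset_of_coveringNumber_lt {I : Type v} {n : ℕ} {F : Finset I} {ε : ℝ}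
    {Ω : Set (MatTuple I n)} {B : ℝ}
    (h : (coveringNumber F ε Ω : ℝ≥0∞) < ENNReal.ofReal B) :
    ∃ s : Finset (MatTuple I n), (s.card : ℝ) ≤ B ∧ (s : Set (MatTuple I n)) ⊆ Ω ∧
      Ω ⊆ nbhd F ε s := by
  have hne : coveringNumber F ε Ω ≠ ⊤ := fun h' => by
    rw [h'] at h
    simp at h
  obtain ⟨m, hm⟩ := ENat.ne_top_iff_exists.1 hne
  -- The values are natural numbers, so a cover with fewer than `m + 1` elements has at most `m`:
  -- the infimum is attained.
  have hlt : coveringNumber F ε Ω < (m + 1 : ℕ) := by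
    rw [← hm]
    exact_mod_cast Nat.lt_succ_self m
  obtain ⟨Ω₀, h1⟩ := iInf_lt_iff.1 hlt
  obtain ⟨hΩ, h1⟩ := iInf_lt_iff.1 h1
  obtain ⟨hΩ', h1⟩ := iInf_lt_iff.1 h1
  have hfin : Ω₀.Finite := Set.finite_of_encard_le_coe h1.le
  refine ⟨hfin.toFinset, ?_, by simpa using hΩ, by simpa using hΩ'⟩
  rw [hfin.encard_eq_coe_toFinset_card] at h1
  have h2 : hfin.toFinset.card ≤ m := Nat.lt_succ_iff.1 (by exact_mod_cast h1)
  rw [← hm] at h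
  have h3 : ((m : ℕ) : ℝ≥0∞) < ENNReal.ofReal B := by simpa using h
  have h4 : (m : ℝ) < B := by
    have := (ENNReal.lt_ofReal_iff_toReal_lt (ENNReal.natCast_ne_top m)).1 h3
    simpa using this
  exact (Nat.cast_le.2 h2).trans h4.le

theorem exists_finset_subset_of_mem_nhdsWithin {X : Type v} {S U : Set (X → ℂ)} {l : X → ℂ}
    (hU : U ∈ 𝓝[S] l) :
    ∃ (Q : Finset X) (δ : ℝ), 0 < δ ∧ ∀ l' ∈ S, (∀ q ∈ Q, ‖l' q - l q‖ < δ) → l' ∈ U := by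
  obtain ⟨V, hV, hVU⟩ := mem_nhdsWithin_iff_exists_mem_nhds_inter.1 hU
  rw [nhds_pi, Filter.mem_pi'] at hV
  obtain ⟨Q, t, ht, htV⟩ := hV
  choose δ hδ hδt using fun q => Metric.mem_nhds_iff.1 (ht q)
  obtain ⟨d, hd, hdQ⟩ : ∃ d : ℝ, 0 < d ∧ ∀ q ∈ Q, d ≤ δ q := by
    rcases Q.eq_empty_or_nonempty with rfl | h
    · exact ⟨1, one_pos, by simp⟩
    · exact ⟨Q.inf' h δ, (Finset.lt_inf'_iff h).2 fun q _ => hδ q,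
        fun q hq => Finset.inf'_le _ hq⟩
  refine ⟨Q, d, hd, fun l' hl' h => hVU ⟨htV fun q hq => hδt q ?_, hl'⟩⟩
  rw [mem_ball_iff_norm]
  exact (h q hq).trans_le (hdQ q hq)

theorem finset_norm_sub_lt_mem_nhds {X : Type v} (Q : Finset X) {δ : ℝ} (hδ : 0 < δ) (l : X → ℂ) :
    {l' : X → ℂ | ∀ q ∈ Q, ‖l' q - l q‖ < δ} ∈ 𝓝 l := by
  simp only [Set.ofPred_forall]
  rw [biInter_finset_mem]
  intro q _
  have h : Continuous fun l' : X → ℂ => ‖l' q - l q‖ := by fun_prop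
  refine (isOpen_lt h continuous_const).mem_nhds ?_
  simpa using hδ

section Entropy

variable {H : Type u} [NormedAddCommGroup H] [InnerProductSpace ℂ H] [CompleteSpace H]
  {M : VonNeumannAlgebra H} {τ : M.toStarSubalgebra →ₗ[ℂ] ℂ}

/-- The neighborhood `U` is reduced to finitely many moments. The centers of the cover belong to the
microstate space, hence obey the norm bounds; this later allows uniform continuity to be applied at
them. -/
theorem exists_cover_of_entropyOf_le {J : Type w} {L : Type w'} {x : J → M.toStarSubalgebra}
    {y : L → M.toStarSubalgebra} {z : M.toStarSubalgebra} {R : J → ℝ} {R' : L → ℝ} {R₀ : ℝ}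
    {C : ∀ n, selfAdjoint (Mat n)} (h : entropyOf τ x y z R R' R₀ C ≤ 0) (F : Finset L) {ε κ : ℝ}
    (hε : 0 < ε) (hκ : 0 < κ) :
    ∃ (Q : Finset (FreeAlgebra ℂ (J ⊕ L ⊕ Unit))) (δ : ℝ), 0 < δ ∧ ∀ᶠ n : ℕ in atTop,
      ∃ s : Finset (MatTuple L n), (s.card : ℝ) ≤ Real.exp (κ * (n : ℝ) ^ 2) ∧
        (∀ B ∈ s, B ∈ matBall R' n) ∧
        ∀ (A : MatTuple J n) (B : MatTuple L n), A ∈ matBall R n → B ∈ matBall R' n →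
          law (ntr n) (join₃ A.toMat B.toMat (C n : Mat n)) ∈ lawSpace (join₃ R R' R₀) →
          (∀ q ∈ Q, ‖law (ntr n) (join₃ A.toMat B.toMat (C n : Mat n)) q -
            law τ (join₃ x y z) q‖ < δ) →
          ∃ B₀ ∈ s, ∀ i ∈ F, twoNorm (ntr n) (B₀.toMat i - B.toMat i) < ε := by
  have h1 : (⨅ U ∈ 𝓝[lawSpace (join₃ R R' R₀)] law τ (join₃ x y z),
      limsup (fun n : ℕ => ((((n : ℝ) ^ 2)⁻¹ : ℝ) : EReal) *
        ENNReal.log (coveringNumber F ε (microstatesPresence R R' (C n) U) : ℝ≥0∞)) atTop) < κ := by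
    refine lt_of_le_of_lt (le_trans ?_ h) (EReal.coe_pos.2 hκ)
    exact le_iSup_of_le F (le_iSup_of_le ε (le_iSup_of_le hε le_rfl))
  obtain ⟨U, h1⟩ := iInf_lt_iff.1 h1
  obtain ⟨hU, h1⟩ := iInf_lt_iff.1 h1
  obtain ⟨Q, δ, hδ, hQ⟩ := exists_finset_subset_of_mem_nhdsWithin hU
  refine ⟨Q, δ, hδ, ?_⟩
  filter_upwards [eventually_lt_of_limsup_lt h1, eventually_ge_atTop 1] with n hn hn1
  have hn0 : (0 : ℝ) < (n : ℝ) ^ 2 := by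
    have : (0 : ℝ) < n := by exact_mod_cast hn1
    positivity
  obtain ⟨s, hs, hsΩ, hcov⟩ := exists_finset_of_coveringNumber_lt
    (lt_ofReal_exp_of_log_lt hn0 hn)
  refine ⟨s, hs, fun B hB => ?_, fun A B hA hB hl hq => ?_⟩
  · obtain ⟨A, -, hB', -⟩ := hsΩ hB
    exact hB'
  · exact hcov ⟨A, hA, hB, hQ _ hl hq⟩

theorem mem_tupleVN {J : Type w} (x : J → M.toStarSubalgebra) (j : J) :
    (x j : H →L[ℂ] H) ∈ tupleVN x := by
  change (x j : H →L[ℂ] H) ∈ StarSubalgebra.centralizer ℂ (StarSubalgebra.centralizer ℂ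
    (Set.range fun j => (x j : H →L[ℂ] H)) : Set (H →L[ℂ] H))
  rw [StarSubalgebra.mem_centralizer_iff]
  intro g hg
  have hg' := StarSubalgebra.mem_centralizer_iff ℂ |>.1 hg _ ⟨j, rfl⟩
  have hg'' := StarSubalgebra.mem_centralizer_iff ℂ |>.1 (star_mem hg) _ ⟨j, rfl⟩
  exact ⟨hg'.1.symm, hg''.1.symm⟩

end Entropy


/-! ### Substitution of polynomials -/

section Substitution

variable {I : Type v} {J : Type w} {A : Type u} [Ring A] [Algebra ℂ A]

theorem lift_lift (a : I → A) (P : J → FreeAlgebra ℂ I) (q : FreeAlgebra ℂ J) :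
    FreeAlgebra.lift ℂ a (FreeAlgebra.lift ℂ P q) =
      FreeAlgebra.lift ℂ (fun j => FreeAlgebra.lift ℂ a (P j)) q := by
  have : (FreeAlgebra.lift ℂ a).comp (FreeAlgebra.lift ℂ P) =
      FreeAlgebra.lift ℂ fun j => FreeAlgebra.lift ℂ a (P j) := by
    ext j
    simp
  exact congrArg (fun f => f q) this

theorem law_lift (τ : A →ₗ[ℂ] ℂ) (a : I → A) (P : J → FreeAlgebra ℂ I) (q : FreeAlgebra ℂ J) :
    law τ (fun j => FreeAlgebra.lift ℂ a (P j)) q = law τ a (FreeAlgebra.lift ℂ P q) := by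
  rw [law, law, lift_lift]

theorem lift_algHom {B : Type w'} [Ring B] [Algebra ℂ B] (Φ : A →ₐ[ℂ] B) (a : I → A)
    (p : FreeAlgebra ℂ I) :
    FreeAlgebra.lift ℂ (fun i => Φ (a i)) p = Φ (FreeAlgebra.lift ℂ a p) := by
  have : FreeAlgebra.lift ℂ (fun i => Φ (a i)) = Φ.comp (FreeAlgebra.lift ℂ a) := by
    ext i
    simp
  rw [this, AlgHom.comp_apply]

variable (I J) in
/-- The inclusion of polynomials in fewer variables. -/
def inlPoly : FreeAlgebra ℂ I →ₐ[ℂ] FreeAlgebra ℂ (I ⊕ J) :=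
  FreeAlgebra.lift ℂ fun i => FreeAlgebra.ι ℂ (Sum.inl i)

theorem lift_inlPoly (a : I ⊕ J → A) (p : FreeAlgebra ℂ I) :
    FreeAlgebra.lift ℂ a (inlPoly I J p) = FreeAlgebra.lift ℂ (fun i => a (Sum.inl i)) p := by
  rw [inlPoly, lift_lift]
  congr 2
  funext i
  simp

end Substitution

/-! ### Transport of the cover to the given generators -/

section Conjugation

open scoped Matrix.Norms.L2Operator

variable {H : Type u} [NormedAddCommGroup H] [InnerProductSpace ℂ H] [CompleteSpace H]
  {M : VonNeumannAlgebra H} {τ : M.toStarSubalgebra →ₗ[ℂ] ℂ}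

/-- If the `1`-bounded entropy vanishes, then up to unitary conjugation the pairs `(f_j(A), C)`, for
`(A, C)` with law close to that of `(x, z)`, are covered by few balls. -/
theorem exists_cover_up_to_conjugation (hτ : IsFaithfulNormalTrace M τ) {I : Type v} {I' : Type w}
    {x : I → M.toStarSubalgebra} (hx : ∀ i, IsSelfAdjoint (x i)) (hxM : tupleVN x = M)
    {y : I' → M.toStarSubalgebra} {z : M.toStarSubalgebra} (hz : IsSelfAdjoint z)
    (hN : HasOneBoundedEntropy τ (tupleVN (join₂ y z)) 0)
    {R : I → ℝ} {R' : I' → ℝ} {R₀ : ℝ} (hxR : ∀ i, ‖x i‖ < R i) (hzR : ‖z‖ < R₀)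
    {f : I' → ℕ → SimpleFun R} (hf : f ∈ FunTuples R R') (j : I')
    (hfx : HasValue R τ x (f j) (y j)) {ε₁ ε₂ κ : ℝ} (hε₁ : 0 < ε₁) (hε₂ : 0 < ε₂) (hκ : 0 < κ) :
    ∃ U ∈ 𝓝 (law τ (join₂ x z)), ∀ᶠ n : ℕ in atTop, ∃ Z : Finset (Mat n × Mat n),
      (Z.card : ℝ) ≤ Real.exp (κ * (n : ℝ) ^ 2) ∧ ∀ C : selfAdjoint (Mat n),
        opNorm (C : Mat n) ≤ R₀ → ∀ A ∈ matBall R n, law (ntr n) (join₂ A.toMat (C : Mat n)) ∈ U →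
          ∃ u ∈ unitary (Mat n), ∃ p ∈ Z,
            twoNorm (ntr n) (u * (matEval R f n A).toMat j * star u - p.1) < ε₁ ∧
            twoNorm (ntr n) (u * C * star u - p.2) < ε₂ := by
  classical
  obtain ⟨J, L, x', y', z', S, S', S₀, C', hx', -, hy', hy'N, hz', -, hz'S, hC'S, hC', hent⟩ := hN
  have hτ' := hτ.isTracialState
  have e1 : 0 < ε₁ / 5 := by positivity
  have e2 : 0 < ε₂ / 3 := by positivity
  -- Both tuples generate the same algebra, so `y j` and `z` are approximated by polynomials `s` and
  -- `t` in `y'`.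
  have hyN : (y j : H →L[ℂ] H) ∈ tupleVN y' := by
    rw [hy'N]
    exact mem_tupleVN (join₂ y z) (Sum.inl j)
  have hzN : (z : H →L[ℂ] H) ∈ tupleVN y' := by
    rw [hy'N]
    exact mem_tupleVN (join₂ y z) (Sum.inr ())
  obtain ⟨s, hs⟩ := exists_twoNorm_lift_sub_lt_of_mem hτ (fun l => (hy' l).1) hyN e1
  obtain ⟨t, ht⟩ := exists_twoNorm_lift_sub_lt_of_mem hτ (fun l => (hy' l).1) hzN e2
  obtain ⟨Fs, δs, hδs, hsU⟩ := exists_twoNorm_lift_sub_lt.{0} S' s e1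
  obtain ⟨Ft, δt, hδt, htU⟩ := exists_twoNorm_lift_sub_lt.{0} S' t e2
  obtain ⟨Gs, ρs, hρs, hsM⟩ := exists_twoNorm_lift_sub_lt.{u} S' s e1
  obtain ⟨Gt, ρt, hρt, htM⟩ := exists_twoNorm_lift_sub_lt.{u} S' t e2
  obtain ⟨Q, δ, hδ, hcov⟩ := exists_cover_of_entropyOf_le hent.le (Fs ∪ Ft) (lt_min hδs hδt) hκ
  set w : J ⊕ L ⊕ Unit → M.toStarSubalgebra := join₃ x' y' z' with hwdef
  set W : J ⊕ L ⊕ Unit → ℝ := join₃ S S' S₀ with hWdef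
  have hw : ∀ i, IsSelfAdjoint (w i) ∧ ‖w i‖ < W i := by
    rintro (i | i | i)
    · exact hx' i
    · exact hy' i
    · exact ⟨hz'.1, hz'S⟩
  have hS₀ : 0 < S₀ := (norm_nonneg _).trans_lt hz'S
  obtain ⟨F₂, δ₂, hδ₂, hlawC⟩ := exists_norm_law_sub_lt.{0} W Q (show 0 < δ / 3 by positivity)
  obtain ⟨m, δm, hδm, hunit⟩ := exists_unitary_conj_close hS₀ hδ₂
  let zι : FreeAlgebra ℂ (J ⊕ L ⊕ Unit) := FreeAlgebra.ι ℂ (Sum.inr (Sum.inr ()))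
  -- The powers of the variable of `z'` are added to the test polynomials to control the moments
  -- that `hunit` compares. The thirds in `δ'` allow for triangle inequalities with three terms.
  set Q' := Q ∪ (Finset.range (m + 1)).image fun k => zι ^ k with hQ'
  set δ' := min (δ / 3) (δm / 3) with hδ'def
  have hδ' : 0 < δ' := lt_min (by positivity) (by positivity)
  obtain ⟨F₁, δ₁, hδ₁, hlawM⟩ := exists_norm_law_sub_lt.{u} W Q' hδ'
  have hρ : 0 < min δ₁ (min ρs ρt) := lt_min hδ₁ (lt_min hρs hρt)
  -- Since `x` generates `M`, all of `x'`, `y'`, `z'` are approximated by polynomials in `x`. The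
  -- strict cut-offs leave room for the bounds `W i` to hold at every bounded matrix tuple.
  have happ : ∀ i, ∃ p : FreeAlgebra ℂ I,
      twoNorm τ (FreeAlgebra.lift ℂ x p - w i) < min δ₁ (min ρs ρt) ∧
      ‖FreeAlgebra.lift ℂ x p‖ ≤ W i ∧
      ∀ (A : Type) [CStarAlgebra A] (b : I → A), (∀ j, IsSelfAdjoint (b j)) →
        (∀ j, ‖b j‖ ≤ R j) → IsSelfAdjoint (FreeAlgebra.lift ℂ b p) ∧
          ‖FreeAlgebra.lift ℂ b p‖ ≤ W i := fun i =>
    exists_bounded_lift_approx hτ hx (fun i => (hxR i).le) (hw i).1 (by rw [hxM]; exact (w i).2)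
      (hw i).2 hρ
  choose P hPw hPn hPA using happ
  set X : J ⊕ L ⊕ Unit → M.toStarSubalgebra := fun i => FreeAlgebra.lift ℂ x (P i) with hX
  have hlawX : ∀ q ∈ Q', ‖law τ X q - law τ w q‖ < δ' :=
    hlawM _ τ hτ' X w hPn (fun i => (hw i).2.le) fun i _ => (hPw i).le.trans (min_le_left _ _)
  set PL : L → FreeAlgebra ℂ I := fun l => P (Sum.inr (Sum.inl l)) with hPL
  set σ := FreeAlgebra.lift ℂ PL s with hσ
  set ϑ := FreeAlgebra.lift ℂ PL t with hϑ
  have hσx : twoNorm τ (FreeAlgebra.lift ℂ x σ - y j) < 2 * (ε₁ / 5) := by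
    rw [hσ, lift_lift]
    have h1 := hsM _ τ hτ' (fun l => FreeAlgebra.lift ℂ x (PL l)) y' (fun l => hPn _)
      (fun l => (hy' l).2.le) fun l _ => (hPw (Sum.inr (Sum.inl l))).le.trans
        ((min_le_right _ _).trans (min_le_left _ _))
    have h2 := hτ'.twoNorm_sub_le (FreeAlgebra.lift ℂ (fun l => FreeAlgebra.lift ℂ x (PL l)) s)
      (FreeAlgebra.lift ℂ y' s) (y j)
    linarith
  have hϑx : twoNorm τ (FreeAlgebra.lift ℂ x ϑ - z) < 2 * (ε₂ / 3) := by
    rw [hϑ, lift_lift]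
    have h1 := htM _ τ hτ' (fun l => FreeAlgebra.lift ℂ x (PL l)) y' (fun l => hPn _)
      (fun l => (hy' l).2.le) fun l _ => (hPw (Sum.inr (Sum.inl l))).le.trans
        ((min_le_right _ _).trans (min_le_right _ _))
    have h2 := hτ'.twoNorm_sub_le (FreeAlgebra.lift ℂ (fun l => FreeAlgebra.lift ℂ x (PL l)) t)
      (FreeAlgebra.lift ℂ y' t) z
    linarith
  obtain ⟨N, hfN⟩ := exists_twoNorm_evalSimple_sub_matEval_le hf j e1
  obtain ⟨m₀, hm₀, hm₀N⟩ :=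
    ((hfx.eventually (gt_mem_nhds e1)).and (eventually_ge_atTop N)).exists
  have hlx : law τ x ∈ lawSpace R := law_mem_lawSpace hτ' hx fun i => (hxR i).le
  -- The simple function `f j m₀ - 1 ⊗ σ` is small at `x`, hence at all matrix tuples with law near
  -- that of `x`. This passes from `f_j` to a polynomial.
  have hg : twoNorm τ (evalSimple R τ x (f j m₀ - (1 : C(lawSpace R, ℂ)) ⊗ₜ σ)) < 3 * (ε₁ / 5) := by
    rw [map_sub, evalSimple_one_tmul τ x hlx]
    have h1 := hτ'.twoNorm_sub_le (evalSimple R τ x (f j m₀)) (y j) (FreeAlgebra.lift ℂ x σ)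
    rw [hτ'.twoNorm_sub_comm (y j)] at h1
    linarith
  obtain ⟨U₁, hU₁, hU₁'⟩ := exists_twoNorm_evalSimple_lt.{0} _ hτ' hx (fun i => (hxR i).le) hg
  have hjsa : ∀ i, IsSelfAdjoint (join₂ x z i) := by
    rintro (i | i)
    exacts [hx i, hz]
  have hjn : ∀ i, ‖join₂ x z i‖ ≤ join₂ R R₀ i := by
    rintro (i | i)
    exacts [(hxR i).le, hzR.le]
  have hlj : law τ (join₂ x z) ∈ lawSpace (join₂ R R₀) := law_mem_lawSpace hτ' hjsa hjn
  set ψ : FreeAlgebra ℂ (I ⊕ Unit) := FreeAlgebra.ι ℂ (Sum.inr ()) - inlPoly I Unit ϑ with hψ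
  have hψ' : ∀ {A : Type u} [Ring A] [Algebra ℂ A] (a : I → A) (c : A),
      FreeAlgebra.lift ℂ (join₂ a c) ψ = c - FreeAlgebra.lift ℂ a ϑ := by
    intro A _ _ a c
    rw [hψ, map_sub, lift_inlPoly, FreeAlgebra.lift_ι_apply]
    rfl
  have hψ'' : ∀ {A : Type} [Ring A] [Algebra ℂ A] (a : I → A) (c : A),
      FreeAlgebra.lift ℂ (join₂ a c) ψ = c - FreeAlgebra.lift ℂ a ϑ := by
    intro A _ _ a c
    rw [hψ, map_sub, lift_inlPoly, FreeAlgebra.lift_ι_apply]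
    rfl
  have hh : twoNorm τ (evalSimple (join₂ R R₀) τ (join₂ x z)
      ((1 : C(lawSpace (join₂ R R₀), ℂ)) ⊗ₜ ψ)) < 2 * (ε₂ / 3) := by
    rw [evalSimple_one_tmul τ _ hlj, hψ', hτ'.twoNorm_sub_comm]
    exact hϑx
  obtain ⟨U₂, hU₂, hU₂'⟩ := exists_twoNorm_evalSimple_lt.{0} _ hτ' hjsa hjn hh
  have hU₃ := finset_norm_sub_lt_mem_nhds (Q'.image fun q => FreeAlgebra.lift ℂ P q) hδ' (law τ x)
  set U₃ := {l : FreeAlgebra ℂ I → ℂ |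
    ∀ q ∈ Q'.image fun q => FreeAlgebra.lift ℂ P q, ‖l q - law τ x q‖ < δ'}
  let res : (FreeAlgebra ℂ (I ⊕ Unit) → ℂ) → FreeAlgebra ℂ I → ℂ := fun l p => l (inlPoly I Unit p)
  have hres : Continuous res := by fun_prop
  have hresx : res (law τ (join₂ x z)) = law τ x := by
    funext p
    exact congrArg τ (lift_inlPoly _ _)
  have hU₁₃ : U₁ ∩ U₃ ∈ 𝓝 (res (law τ (join₂ x z))) := by
    rw [hresx]
    exact inter_mem hU₁ hU₃
  -- `U₁` forces `f_j(A)` close to `σ(A)`, `U₂` forces `C` close to `ϑ(A)`, and `U₃` brings the law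
  -- of the tuple `P(A)` near that of `P(x)`.
  refine ⟨res ⁻¹' (U₁ ∩ U₃) ∩ U₂, inter_mem (hres.continuousAt.preimage_mem_nhds hU₁₃) hU₂, ?_⟩
  have hmom : ∀ᶠ n : ℕ in atTop, ∀ k ∈ Finset.range (m + 1),
      ‖ntr n ((C' n : Mat n) ^ k) - τ (z' ^ k)‖ < δm / 3 := by
    rw [Filter.eventually_all_finset]
    intro k _
    have h1 := (hC'.tendsto_moment k).sub_const (τ (z' ^ k))
    rw [sub_self] at h1
    have h2 := h1.norm
    rw [norm_zero] at h2
    exact h2.eventually (gt_mem_nhds (by positivity))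
  filter_upwards [hcov, hmom, eventually_ge_atTop 1] with n ⟨s₀, hs₀, hs₀S, hs₀cov⟩ hmomn hn
  have : NeZero n := ⟨by omega⟩
  have hntr := isTracialState_ntr (n := n)
  -- The new centers are the pairs `(s(B), t(B))` for `B` in the old cover. They depend neither on
  -- `C` nor on `A`.
  refine ⟨s₀.image fun B => (FreeAlgebra.lift ℂ B.toMat s, FreeAlgebra.lift ℂ B.toMat t),
    (Nat.cast_le.2 Finset.card_image_le).trans hs₀, fun C hC A hA hl => ?_⟩
  obtain ⟨⟨hl₁, hl₃⟩, hl₂⟩ := hl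
  have hresA : res (law (ntr n) (join₂ A.toMat (C : Mat n))) = law (ntr n) A.toMat := by
    funext p
    exact congrArg (ntr n) (lift_inlPoly _ _)
  rw [hresA] at hl₁ hl₃
  set XA : J ⊕ L ⊕ Unit → Mat n := fun i => FreeAlgebra.lift ℂ A.toMat (P i) with hXA
  have hXAsa : ∀ i, IsSelfAdjoint (XA i) := fun i =>
    (hPA i (Mat n) A.toMat A.isSelfAdjoint_toMat hA).1
  have hXAn : ∀ i, ‖XA i‖ ≤ W i := fun i =>
    (hPA i (Mat n) A.toMat A.isSelfAdjoint_toMat hA).2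
  have hlawXA : ∀ q ∈ Q', ‖law (ntr n) XA q - law τ X q‖ < δ' := by
    intro q hq
    have := hl₃ _ (Finset.mem_image_of_mem _ hq)
    rwa [← law_lift, ← law_lift] at this
  obtain ⟨u, hu, huC⟩ := hunit n (XA (Sum.inr (Sum.inr ()))) (C' n) (hXAsa _) (C' n).2 (hXAn _)
    (hC'S n) (by
      intro k hk
      have hkm : k ∈ Finset.range (m + 1) := Finset.mem_range.2 (Nat.lt_succ_of_le hk)
      have hkQ : zι ^ k ∈ Q' := Finset.mem_union_right _ (Finset.mem_image_of_mem _ hkm)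
      have h1 := (hlawXA _ hkQ).trans_le (min_le_right _ _)
      have h2 := (hlawX _ hkQ).trans_le (min_le_right _ _)
      have h3 := hmomn k hkm
      have h4 : law (ntr n) XA (zι ^ k) = ntr n (XA (Sum.inr (Sum.inr ())) ^ k) := by
        simp [law, zι]
      have h5 : law τ w (zι ^ k) = τ (z' ^ k) := by
        simp [law, zι, w]
      rw [h4] at h1
      rw [h5] at h2
      rw [← dist_eq_norm] at *
      have h6 := dist_triangle4 (ntr n (XA (Sum.inr (Sum.inr ())) ^ k)) (law τ X (zι ^ k))
        (τ (z' ^ k)) (ntr n ((C' n : Mat n) ^ k))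
      rw [dist_comm (τ (z' ^ k))] at h6
      linarith)
  let Φ : Mat n →⋆ₐ[ℂ] Mat n := (Unitary.conjStarAlgAut ℂ (Mat n) ⟨u, hu⟩ : Mat n →⋆ₐ[ℂ] Mat n)
  have hΦ : ∀ a, Φ a = u * a * star u := fun a => rfl
  have hΦτ : ∀ a, ntr n (Φ a) = ntr n a := fun a => by
    rw [hΦ, hntr.tracial, ← mul_assoc, Unitary.star_mul_self_of_mem hu, one_mul]
  have hΦn : ∀ a, ‖Φ a‖ = ‖a‖ := fun a => by
    rw [hΦ, CStarRing.norm_mul_mem_unitary _ (Unitary.star_mem hu),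
      CStarRing.norm_mem_unitary_mul _ hu]
  -- After conjugation by `u` the last matrix is within `δ₂` of `C' n` and may be replaced by it;
  -- the result `Y` is a microstate to which the cover applies.
  let A' : MatTuple J n := fun i => ⟨Φ (XA (Sum.inl i)), (hXAsa _).map Φ⟩
  let B' : MatTuple L n := fun i => ⟨Φ (XA (Sum.inr (Sum.inl i))), (hXAsa _).map Φ⟩
  have hA' : A' ∈ matBall S n := fun i => (hΦn _).trans_le (hXAn (Sum.inl i))
  have hB' : B' ∈ matBall S' n := fun i => (hΦn _).trans_le (hXAn (Sum.inr (Sum.inl i)))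
  set Y : J ⊕ L ⊕ Unit → Mat n := join₃ A'.toMat B'.toMat (C' n : Mat n) with hY
  have hYsa : ∀ i, IsSelfAdjoint (Y i) := by
    rintro (i | i | i)
    exacts [(A' i).2, (B' i).2, (C' n).2]
  have hYn : ∀ i, ‖Y i‖ ≤ W i := by
    rintro (i | i | i)
    exacts [hA' i, hB' i, hC'S n]
  have hYX : ∀ i, twoNorm (ntr n) (Y i - Φ (XA i)) ≤ δ₂ := by
    rintro (i | i | i)
    · exact (le_of_eq (by rw [show Y (Sum.inl i) = Φ (XA (Sum.inl i)) from rfl, sub_self,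
        IsTracialState.twoNorm_zero])).trans hδ₂.le
    · exact (le_of_eq (by rw [show Y (Sum.inr (Sum.inl i)) = Φ (XA (Sum.inr (Sum.inl i))) from rfl,
        sub_self, IsTracialState.twoNorm_zero])).trans hδ₂.le
    · rw [hntr.twoNorm_sub_comm]
      exact huC
  have hYlaw : ∀ q ∈ Q, ‖law (ntr n) Y q - law τ w q‖ < δ := by
    intro q hq
    have hqQ : q ∈ Q' := Finset.mem_union_left _ hq
    have h1 := hlawC (Mat n) (ntr n) hntr Y (fun i => Φ (XA i)) hYn
      (fun i => (hΦn _).trans_le (hXAn i)) (fun i _ => hYX i) q hq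
    have h2 := (hlawXA _ hqQ).trans_le (min_le_left _ _)
    have h3 := (hlawX _ hqQ).trans_le (min_le_left _ _)
    have h4 : law (ntr n) (fun i => Φ (XA i)) = law (ntr n) XA :=
      law_algHom (Φ : Mat n →ₐ[ℂ] Mat n) hΦτ XA
    rw [h4] at h1
    rw [← dist_eq_norm] at *
    have h5 := dist_triangle4 (law (ntr n) Y q) (law (ntr n) XA q) (law τ X q) (law τ w q)
    linarith
  obtain ⟨B₀, hB₀, hB₀'⟩ := hs₀cov A' B' hA' hB' (law_mem_lawSpace hntr hYsa hYn) hYlaw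
  have hBs := hsU (Mat n) (ntr n) hntr B₀.toMat B'.toMat (hs₀S B₀ hB₀) hB' fun i hi =>
    (hB₀' i (Finset.mem_union_left _ hi)).le.trans (min_le_left _ _)
  have hBt := htU (Mat n) (ntr n) hntr B₀.toMat B'.toMat (hs₀S B₀ hB₀) hB' fun i hi =>
    (hB₀' i (Finset.mem_union_right _ hi)).le.trans (min_le_right _ _)
  have hB's : ∀ p : FreeAlgebra ℂ L, FreeAlgebra.lift ℂ B'.toMat p =
      Φ (FreeAlgebra.lift ℂ A.toMat (FreeAlgebra.lift ℂ PL p)) := fun p => by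
    rw [lift_lift]
    exact lift_algHom (Φ : Mat n →ₐ[ℂ] Mat n) (fun l => XA (Sum.inr (Sum.inl l))) p
  rw [hB's] at hBs hBt
  refine ⟨u, hu, _, Finset.mem_image_of_mem _ hB₀, ?_, ?_⟩
  -- Of the five parts of `ε₁`, one separates `f_j` from the simple function, three separate that
  -- from `σ(A)`, and one is spent on the cover.
  · have h1 := hU₁' (Mat n) (ntr n) hntr A.toMat A.isSelfAdjoint_toMat hA hl₁
    rw [map_sub, evalSimple_one_tmul (ntr n) _ (law_mem_lawSpace_of_mem_matBall hA)] at h1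
    have h2 := hfN m₀ hm₀N n A hA
    set G := (matEval R f n A).toMat j
    have h3 : twoNorm (ntr n) (G - FreeAlgebra.lift ℂ A.toMat σ) < 4 * (ε₁ / 5) := by
      have := hntr.twoNorm_sub_le G (evalSimple R (ntr n) A.toMat (f j m₀))
        (FreeAlgebra.lift ℂ A.toMat σ)
      rw [hntr.twoNorm_sub_comm G (evalSimple R (ntr n) A.toMat (f j m₀))] at this
      linarith
    have h4 : twoNorm (ntr n) (Φ G - Φ (FreeAlgebra.lift ℂ A.toMat σ)) < 4 * (ε₁ / 5) := by
      rwa [← map_sub, hΦ, hntr.twoNorm_conj hu]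
    have h5 := hntr.twoNorm_sub_le (Φ G) (Φ (FreeAlgebra.lift ℂ A.toMat σ))
      (FreeAlgebra.lift ℂ B₀.toMat s)
    rw [hntr.twoNorm_sub_comm (Φ (FreeAlgebra.lift ℂ A.toMat σ))
      (FreeAlgebra.lift ℂ B₀.toMat s)] at h5
    change twoNorm (ntr n) (Φ G - FreeAlgebra.lift ℂ B₀.toMat s) < ε₁
    linarith
  · have hjA : ∀ i, IsSelfAdjoint (join₂ A.toMat (C : Mat n) i) := by
      rintro (i | i)
      exacts [A.isSelfAdjoint_toMat i, C.2]
    have hjAn : ∀ i, ‖join₂ A.toMat (C : Mat n) i‖ ≤ join₂ R R₀ i := by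
      rintro (i | i)
      exacts [hA i, hC]
    have h1 := hU₂' (Mat n) (ntr n) hntr (join₂ A.toMat (C : Mat n)) hjA hjAn hl₂
    rw [evalSimple_one_tmul (ntr n) _ (law_mem_lawSpace hntr hjA hjAn), hψ''] at h1
    have h4 : twoNorm (ntr n) (Φ C - Φ (FreeAlgebra.lift ℂ A.toMat ϑ)) < 2 * (ε₂ / 3) := by
      rwa [← map_sub, hΦ, hntr.twoNorm_conj hu]
    have h5 := hntr.twoNorm_sub_le (Φ C) (Φ (FreeAlgebra.lift ℂ A.toMat ϑ))
      (FreeAlgebra.lift ℂ B₀.toMat t)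
    rw [hntr.twoNorm_sub_comm (Φ (FreeAlgebra.lift ℂ A.toMat ϑ))
      (FreeAlgebra.lift ℂ B₀.toMat t)] at h5
    change twoNorm (ntr n) (Φ C - FreeAlgebra.lift ℂ B₀.toMat t) < ε₂
    linarith

end Conjugation


/-! ### Covering the values of a function on the microstates relative to `C` -/

theorem IsTracialState.twoNorm_conj_sub_conj_le {A : Type u} [CStarAlgebra A] {τ : A →ₗ[ℂ] ℂ}
    (hτ : IsTracialState τ) {V W : A} (hV : V ∈ unitary A) (hW : W ∈ unitary A) (g : A) :
    twoNorm τ (star V * g * V - star W * g * W) ≤ 2 * ‖g‖ * twoNorm τ (V - W) := by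
  have e : star V * g * V - star W * g * W = star (V - W) * g * V + star W * (g * (V - W)) := by
    rw [star_sub]
    noncomm_ring
  have h1 := hτ.twoNorm_mul_le' (star (V - W)) g
  rw [hτ.twoNorm_star] at h1
  have h2 := hτ.twoNorm_mul_le g (V - W)
  have h3 := hτ.twoNorm_add_le (star (V - W) * g * V) (star W * (g * (V - W)))
  rw [hτ.twoNorm_mul_unitary hV, twoNorm_unitary_mul τ (Unitary.star_mem hW)] at h3
  rw [e]
  linarith

section Covering

open scoped Matrix.Norms.L2Operator

/-- A cover up to unitary conjugation of the pairs `(g, C)`, for fixed `C` with few pairs of close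
eigenvalues, gives a cover of the matrices `g`. -/
theorem exists_cover_of_cover_up_to_conjugation {n : ℕ} [NeZero n] {C U : Mat n} {a : Fin n → ℝ}
    (hU : U ∈ unitary (Mat n)) (hC : C = U * Matrix.diagonal (fun i => (a i : ℂ)) * star U)
    {S : Set (Mat n)} {r : ℝ} (hS : ∀ g ∈ S, IsSelfAdjoint g ∧ ‖g‖ ≤ r) {Z : Finset (Mat n × Mat n)}
    {ε₁ ε₂ δ θ : ℝ} (hδ : 0 < δ) (hθ : 0 < θ) (hε₂ : 8 * ε₂ ≤ θ * δ)
    (hZ : ∀ g ∈ S, ∃ u ∈ unitary (Mat n), ∃ p ∈ Z,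
      twoNorm (ntr n) (u * g * star u - p.1) < ε₁ ∧ twoNorm (ntr n) (u * C * star u - p.2) < ε₂) :
    ∃ T : Finset (Mat n), (T.card : ℝ) ≤ Z.card * (1 + 4 / δ) ^ (2 * (closePairs a θ).card) ∧
      (∀ D ∈ T, IsSelfAdjoint D ∧ ‖D‖ ≤ r) ∧
      ∀ g ∈ S, ∃ D ∈ T, twoNorm (ntr n) (g - D) < 2 * ε₁ + 2 * r * δ := by
  classical
  have hτ := isTracialState_ntr (n := n)
  obtain ⟨s, hs, hsU, hsnet⟩ := exists_net_near_commutant hU hC hδ hθ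
    (η := 2 * ε₂) (by linarith)
  let near (p : Mat n × Mat n) (g u : Mat n) : Prop := g ∈ S ∧ u ∈ unitary (Mat n) ∧
    twoNorm (ntr n) (u * g * star u - p.1) < ε₁ ∧ twoNorm (ntr n) (u * C * star u - p.2) < ε₂
  have hrep : ∀ p : Mat n × Mat n, (∃ g u, near p g u) → ∃ g u, near p g u := fun p h => h
  -- One representative is fixed for each center that is hit; every other `g` at this center is
  -- compared with it.
  choose! g₀ u₀ h₀ using hrep
  let Z' := Z.filter fun p => ∃ g u, near p g u
  refine ⟨(Z' ×ˢ s).image fun q => star q.2 * g₀ q.1 * q.2, ?_, ?_, ?_⟩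
  · calc (((Z' ×ˢ s).image fun q => star q.2 * g₀ q.1 * q.2).card : ℝ)
        ≤ ((Z' ×ˢ s).card : ℝ) := Nat.cast_le.2 Finset.card_image_le
      _ = Z'.card * s.card := by rw [Finset.card_product, Nat.cast_mul]
      _ ≤ _ := mul_le_mul (Nat.cast_le.2 (Finset.card_filter_le _ _)) hs (Nat.cast_nonneg _)
          (Nat.cast_nonneg _)
  · intro D hD
    obtain ⟨⟨p, V⟩, hpV, rfl⟩ := Finset.mem_image.1 hD
    obtain ⟨hp, hV⟩ := Finset.mem_product.1 hpV
    have h := hS _ (h₀ p (Finset.mem_filter.1 hp).2).1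
    have hV' := hsU V hV
    refine ⟨h.1.conjugate' V, ?_⟩
    change ‖star V * g₀ p * V‖ ≤ r
    rw [CStarRing.norm_mul_mem_unitary _ hV',
      CStarRing.norm_mem_unitary_mul _ (Unitary.star_mem hV')]
    exact h.2
  · intro g hg
    obtain ⟨u, hu, p, hp, h1, h2⟩ := hZ g hg
    have hex : ∃ g u, near p g u := ⟨g, u, hg, hu, h1, h2⟩
    obtain ⟨hg₀, hu₀, h3, h4⟩ := h₀ p hex
    have hu₀' := Unitary.star_mem hu₀
    -- Both `u` and `u₀ p` carry `C` close to `p.2`, so `V` commutes with `C` up to `2ε₂`, while `g`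
    -- is within `2ε₁` of `V* g₀ V`. It remains to replace `V` by a member of the net.
    set V := star (u₀ p) * u with hVdef
    have hV : V ∈ unitary (Mat n) := mul_mem hu₀' hu
    have eu₀ : star (u₀ p) * u₀ p = 1 := Unitary.star_mul_self_of_mem hu₀
    have key : ∀ b c : Mat n, twoNorm (ntr n) (V * b * star V - c) =
        twoNorm (ntr n) (u * b * star u - u₀ p * c * star (u₀ p)) := fun b c => by
      rw [← hτ.twoNorm_conj hu₀' (u * b * star u - u₀ p * c * star (u₀ p))]
      congr 1
      calc V * b * star V - c = V * b * star V - (star (u₀ p) * u₀ p) * c * (star (u₀ p) * u₀ p) := by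
            rw [eu₀, one_mul, mul_one]
        _ = _ := by
            rw [hVdef, star_mul, star_star]
            noncomm_ring
    have hVC : twoNorm (ntr n) (V * C - C * V) ≤ 2 * ε₂ := by
      have e : V * C - C * V = (V * C * star V - C) * V := by
        rw [sub_mul, mul_assoc (V * C), Unitary.star_mul_self_of_mem hV, mul_one]
      rw [e, hτ.twoNorm_mul_unitary hV, key]
      have := hτ.twoNorm_sub_le (u * C * star u) p.2 (u₀ p * C * star (u₀ p))
      rw [hτ.twoNorm_sub_comm p.2] at this
      linarith
    obtain ⟨V₀, hV₀, hVV₀⟩ := hsnet V hV hVC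
    refine ⟨star V₀ * g₀ p * V₀, Finset.mem_image.2 ⟨(p, V₀), Finset.mem_product.2
      ⟨Finset.mem_filter.2 ⟨hp, hex⟩, hV₀⟩, rfl⟩, ?_⟩
    have h5 : twoNorm (ntr n) (g - star V * g₀ p * V) < 2 * ε₁ := by
      rw [← hτ.twoNorm_conj hV]
      have e : V * (g - star V * g₀ p * V) * star V = V * g * star V - g₀ p := by
        have e1 : V * star V = 1 := Unitary.mul_star_self_of_mem hV
        calc _ = V * g * star V - (V * star V) * g₀ p * (V * star V) := by noncomm_ring
          _ = _ := by rw [e1, one_mul, mul_one]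
      rw [e, key]
      have := hτ.twoNorm_sub_le (u * g * star u) p.1 (u₀ p * g₀ p * star (u₀ p))
      rw [hτ.twoNorm_sub_comm p.1] at this
      linarith
    have h6 := hτ.twoNorm_conj_sub_conj_le hV (hsU V₀ hV₀) (g₀ p)
    have h7 : 2 * ‖g₀ p‖ * twoNorm (ntr n) (V - V₀) ≤ 2 * r * δ := by
      have hr := (hS _ hg₀).2
      have := IsTracialState.twoNorm_nonneg (ntr n) (V - V₀)
      have hr0 : 0 ≤ r := (norm_nonneg _).trans hr
      gcongr
    have h8 := hτ.twoNorm_sub_le g (star V * g₀ p * V) (star V₀ * g₀ p * V₀)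
    linarith

variable {H : Type u} [NormedAddCommGroup H] [InnerProductSpace ℂ H] [CompleteSpace H]
  {M : VonNeumannAlgebra H} {τ : M.toStarSubalgebra →ₗ[ℂ] ℂ}

/-- If the `1`-bounded entropy vanishes, the values `f_j(A)`, for `A` a microstate for `x` relative
to `C ⇝ z`, are covered by subexponentially many balls. -/
theorem exists_cover_matEval (hτ : IsFaithfulNormalTrace M τ) {I : Type v} {I' : Type w}
    {x : I → M.toStarSubalgebra} (hx : ∀ i, IsSelfAdjoint (x i)) (hxM : tupleVN x = M)
    {y : I' → M.toStarSubalgebra} {z : M.toStarSubalgebra} (hz : IsDiffuse τ z)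
    (hN : HasOneBoundedEntropy τ (tupleVN (join₂ y z)) 0)
    {R : I → ℝ} {R' : I' → ℝ} {R₀ : ℝ} (hxR : ∀ i, ‖x i‖ < R i) (hzR : ‖z‖ < R₀)
    {f : I' → ℕ → SimpleFun R} (hf : f ∈ FunTuples R R') {j : I'} (hR' : 0 < R' j)
    (hfx : HasValue R τ x (f j) (y j)) {n : ℕ → ℕ} (hn : Tendsto n atTop atTop)
    {C : ∀ k, selfAdjoint (Mat (n k))} (hCR : ∀ k, opNorm (C k : Mat (n k)) ≤ R₀)
    (hC : IsMicrostateSeq τ z n C) {ε κ : ℝ} (hε : 0 < ε) (hκ : 0 < κ) :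
    ∃ U ∈ 𝓝 (law τ (join₂ x z)), ∀ᶠ k in atTop, ∃ T : Finset (Mat (n k)),
      (T.card : ℝ) ≤ Real.exp (κ * (n k : ℝ) ^ 2) ∧
      (∀ D ∈ T, IsSelfAdjoint D ∧ opNorm D ≤ R' j) ∧
      ∀ A ∈ microstates R (C k) U, ∃ D ∈ T,
        twoNorm (ntr (n k)) ((matEval R f (n k) A).toMat j - D) < ε := by
  -- With radius `ε / 4` for the first components, this makes `2 (ε / 4) + 2 (R' j) δ = ε`.
  set δ := ε / (4 * R' j) with hδdef
  have hδ : 0 < δ := by positivity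
  have hlog : 0 < Real.log (1 + 4 / δ) := Real.log_pos (by
    have : 0 < 4 / δ := by positivity
    linarith)
  -- This proportion of close pairs makes the net of unitaries cost at most `exp(κ n² / 2)`. The gap
  -- `θ` is fixed before the precision `θδ / 8` demanded of the cover up to conjugation.
  obtain ⟨θ, hθ, hclose⟩ := hz.eventually_card_closePairs_le hn hC hCR
    (show 0 < κ / (4 * Real.log (1 + 4 / δ)) by positivity)
  obtain ⟨U, hU, hcov⟩ := exists_cover_up_to_conjugation hτ hx hxM hz.1 hN hxR hzR hf j hfx
    (show 0 < ε / 4 by positivity) (show 0 < θ * δ / 8 by positivity) (show 0 < κ / 2 by positivity)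
  refine ⟨U, hU, ?_⟩
  filter_upwards [hclose, hn.eventually hcov, hn.eventually_ge_atTop 1] with k h1 h2 h3
  have : NeZero (n k) := ⟨by omega⟩
  obtain ⟨a, V, -, hV, hCV, ha⟩ := exists_antitone_diagonalization (C k).2
  obtain ⟨Z, hZcard, hZ⟩ := h2
  obtain ⟨T, hTcard, hT, hTcov⟩ := exists_cover_of_cover_up_to_conjugation hV hCV
    (S := (fun A => (matEval R f (n k) A).toMat j) '' microstates R (C k) U) (r := R' j) (Z := Z)
    (ε₁ := ε / 4) (ε₂ := θ * δ / 8)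
    (by
      rintro _ ⟨A, hA, rfl⟩
      exact ⟨MatTuple.isSelfAdjoint_toMat _ j, (matEval_spec hf hA.1 j).1⟩)
    hδ hθ (by linarith)
    (by
      rintro _ ⟨A, hA, rfl⟩
      exact hZ (C k) (hCR k) A hA.1 hA.2)
  refine ⟨T, ?_, hT, fun A hA => ?_⟩
  · have hpow : (1 + 4 / δ) ^ (2 * (closePairs a θ).card) ≤ Real.exp (κ / 2 * (n k : ℝ) ^ 2) := by
      rw [← Real.exp_log (show 0 < (1 + 4 / δ) ^ (2 * (closePairs a θ).card) by positivity),
        Real.log_pow, Real.exp_le_exp]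
      have h4 := h1 a V hV hCV ha
      push_cast
      calc 2 * ((closePairs a θ).card : ℝ) * Real.log (1 + 4 / δ)
          ≤ 2 * (κ / (4 * Real.log (1 + 4 / δ)) * (n k : ℝ) ^ 2) * Real.log (1 + 4 / δ) := by gcongr
        _ = _ := by
          generalize Real.log (1 + 4 / δ) = l at hlog
          field_simp
          norm_num
    calc (T.card : ℝ) ≤ _ := hTcard
      _ ≤ Real.exp (κ / 2 * (n k : ℝ) ^ 2) * Real.exp (κ / 2 * (n k : ℝ) ^ 2) :=
        mul_le_mul hZcard hpow (by positivity) (Real.exp_pos _).le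
      _ = _ := by
        rw [← Real.exp_add]
        ring_nf
  · obtain ⟨D, hD, h⟩ := hTcov _ (Set.mem_image_of_mem _ hA)
    refine ⟨D, hD, h.trans_eq ?_⟩
    rw [hδdef]
    field_simp
    ring

end Covering


/-! ### Concentration of the values of a function -/

section Concentration

open scoped Matrix.Norms.L2Operator

/-- A set of measure larger than the concentration function has a doubled neighborhood of almost
full measure. -/
theorem measure_compl_nbhd_nbhd_le {I : Type v} {n : ℕ} [NeZero n] {μ : Measure (MatTuple I n)}
    [IsProbabilityMeasure μ] {F : Finset I} {δ : ℝ} {E : Set (MatTuple I n)}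
    (hE : concentration μ F δ < μ E) :
    μ (nbhd F δ (nbhd F δ E))ᶜ ≤ concentration μ F δ := by
  have hle : ∀ Ω : Set (MatTuple I n), MeasurableSet Ω → 1 / 2 ≤ μ Ω →
      μ (nbhd F δ Ω)ᶜ ≤ concentration μ F δ := fun Ω h1 h2 =>
    le_iSup_of_le Ω (le_iSup_of_le h1 (le_iSup_of_le h2 le_rfl))
  have hm : MeasurableSet (nbhd F δ E) := (isOpen_nbhd F δ E).measurableSet
  by_cases h : 1 / 2 ≤ μ (nbhd F δ E)
  · exact hle _ hm h
  -- Otherwise the complement of the neighborhood has measure at least `1 / 2`, and its own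
  -- neighborhood misses `E`, so `μ E` is at most the concentration function.
  · refine absurd (lt_of_lt_of_le hE ((measure_mono ?_).trans (hle _ hm.compl ?_))) (lt_irrefl _)
    · rintro A hA ⟨B, hB, hBA⟩
      refine hB ⟨A, hA, fun i hi => ?_⟩
      rw [isTracialState_ntr.twoNorm_sub_comm]
      exact hBA i hi
    · rw [prob_compl_eq_one_sub hm]
      refine ENNReal.le_sub_of_add_le_left (measure_ne_top _ _) ?_
      calc μ (nbhd F δ E) + 1 / 2 ≤ 1 / 2 + 1 / 2 := by
            gcongr
            exact (not_le.1 h).le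
        _ = 1 := ENNReal.add_halves 1

/-- Pigeonhole by the union bound. -/
theorem exists_lt_measure_of_cover {Ω α : Type*} [MeasurableSpace Ω] {μ : Measure Ω} {G : Set Ω}
    {T : Finset α} {E : α → Set Ω} {a b : ℝ} {c : ℝ≥0∞} (hT : (T.card : ℝ) ≤ a)
    (hc : c ≤ ENNReal.ofReal b) (hG : G ⊆ ⋃ D ∈ T, E D) (h : ENNReal.ofReal (a * b) < μ G) :
    ∃ D ∈ T, c < μ (E D) := by
  by_contra! hcon
  refine absurd h (not_lt.2 ?_)
  calc μ G ≤ μ (⋃ D ∈ T, E D) := measure_mono hG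
    _ ≤ ∑ D ∈ T, μ (E D) := measure_biUnion_finset_le _ _
    _ ≤ ∑ D ∈ T, c := Finset.sum_le_sum hcon
    _ = (T.card : ℝ≥0∞) * c := by rw [Finset.sum_const, nsmul_eq_mul]
    _ ≤ ENNReal.ofReal a * ENNReal.ofReal b := by
      gcongr
      rw [← ENNReal.ofReal_natCast]
      exact ENNReal.ofReal_le_ofReal hT
    _ = ENNReal.ofReal (a * b) :=
      (ENNReal.ofReal_mul ((Nat.cast_nonneg _).trans hT)).symm

theorem tendsto_exp_mul_sq {n : ℕ → ℕ} (hn : Tendsto n atTop atTop) {r : ℝ} (hr : r < 0) :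
    Tendsto (fun k => Real.exp (r * (n k : ℝ) ^ 2)) atTop (𝓝 0) := by
  have h : Tendsto (fun k => (n k : ℝ)) atTop atTop := tendsto_natCast_atTop_atTop.comp hn
  exact Real.tendsto_exp_atBot.comp
    (((tendsto_pow_atTop two_ne_zero).comp h).const_mul_atTop_of_neg hr)

/-- Diagonal choice: at stage `k` the finest tolerance `1 / (m + 1)` with `m ≤ k` that can be met is
used. -/
theorem exists_seq_of_eventually_exists {α : ℕ → Type*} [∀ k, Nonempty (α k)]
    {P : ∀ k, ℝ → α k → Prop} (hP : ∀ k a ε ε', ε ≤ ε' → P k ε a → P k ε' a)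
    (h : ∀ ε : ℝ, 0 < ε → ∀ᶠ k in atTop, ∃ a, P k ε a) :
    ∃ a : ∀ k, α k, ∀ ε : ℝ, 0 < ε → ∀ᶠ k in atTop, P k ε (a k) := by
  classical
  let Q (k m : ℕ) : Prop := ∃ a, P k (1 / ((m : ℝ) + 1)) a
  have hQ : ∀ k, ∃ a, (∃ m ≤ k, Q k m) →
      P k (1 / (((Nat.findGreatest (Q k) k : ℕ) : ℝ) + 1)) a := by
    intro k
    by_cases hk : ∃ m ≤ k, Q k m
    · obtain ⟨m, hm, hQm⟩ := hk
      obtain ⟨a, ha⟩ := Nat.findGreatest_spec hm hQm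
      exact ⟨a, fun _ => ha⟩
    · exact ⟨Classical.arbitrary _, fun h => absurd h hk⟩
  choose a ha using hQ
  refine ⟨a, fun ε hε => ?_⟩
  obtain ⟨m, hm⟩ := exists_nat_one_div_lt hε
  filter_upwards [h _ (Nat.one_div_pos_of_nat (α := ℝ) (n := m)), eventually_ge_atTop m] with k hk hmk
  refine hP k _ _ _ ?_ (ha k ⟨m, hmk, hk⟩)
  refine le_trans ?_ hm.le
  have : (m : ℝ) ≤ (Nat.findGreatest (Q k) k : ℕ) := Nat.cast_le.2 (Nat.le_findGreatest hmk hk)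
  gcongr

variable {H : Type u} [NormedAddCommGroup H] [InnerProductSpace ℂ H] [CompleteSpace H]
  {M : VonNeumannAlgebra H} {τ : M.toStarSubalgebra →ₗ[ℂ] ℂ}

/-- Under exponential concentration and vanishing `1`-bounded entropy, `f_j(A)` is with high
probability close to a fixed matrix. -/
theorem eventually_exists_concentrated (hτ : IsFaithfulNormalTrace M τ) {I : Type v} {I' : Type w}
    {x : I → M.toStarSubalgebra} (hx : ∀ i, IsSelfAdjoint (x i)) (hxM : tupleVN x = M)
    {y : I' → M.toStarSubalgebra} {z : M.toStarSubalgebra} (hz : IsDiffuse τ z)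
    (hN : HasOneBoundedEntropy τ (tupleVN (join₂ y z)) 0)
    {R : I → ℝ} {R' : I' → ℝ} {R₀ : ℝ} (hxR : ∀ i, ‖x i‖ < R i) (hzR : ‖z‖ < R₀)
    {f : I' → ℕ → SimpleFun R} (hf : f ∈ FunTuples R R') {j : I'} (hR' : 0 < R' j)
    (hfx : HasValue R τ x (f j) (y j)) {n : ℕ → ℕ} (hn : Tendsto n atTop atTop)
    {C : ∀ k, selfAdjoint (Mat (n k))} (hCR : ∀ k, opNorm (C k : Mat (n k)) ≤ R₀)
    (hC : IsMicrostateSeq τ z n C) {μ : ∀ k, Measure (MatTuple I (n k))}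
    [∀ k, IsProbabilityMeasure (μ k)] (hμR : ∀ k, μ k (matBall R (n k))ᶜ = 0)
    (hμx : ∀ U ∈ 𝓝 (law τ (join₂ x z)),
      Tendsto (fun k => μ k (microstates R (C k) U)) atTop (𝓝 1))
    (hconc : ExponentialConcentration n μ) {ε : ℝ} (hε : 0 < ε) :
    ∀ᶠ k in atTop, ∃ D : selfAdjoint (Mat (n k)), opNorm (D : Mat (n k)) ≤ R' j ∧
      μ k {A | A ∈ matBall R (n k) ∧
        twoNorm (ntr (n k)) ((D : Mat (n k)) - (matEval R f (n k) A).toMat j) < ε}ᶜ ≤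
          ENNReal.ofReal ε := by
  obtain ⟨F, δ, hδ, hFδ⟩ := exists_twoNorm_matEval_sub_lt hf j (half_pos hε)
  -- The radius is `δ / 2` because neighborhoods are taken twice. The covering rate is chosen below
  -- as `-r / 2`, so the number of balls times the concentration function is at most `exp(r n² /
  -- 2)`, which tends to `0`.
  obtain ⟨r, hr, hr0⟩ := EReal.lt_iff_exists_real_btwn.1 (hconc F (δ / 2) (half_pos hδ))
  have hr0 : r < 0 := by exact_mod_cast hr0
  obtain ⟨U, hU, hcov⟩ := exists_cover_matEval hτ hx hxM hz hN hxR hzR hf hR' hfx hn hCR hC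
    (half_pos hε) (show 0 < -(r / 2) by linarith)
  have h2 : ((1 / 2 : ℝ)) < 1 := by norm_num
  filter_upwards [eventually_lt_of_limsup_lt hr, hcov, hn.eventually_ge_atTop 1,
    (tendsto_exp_mul_sq hn hr0).eventually (ge_mem_nhds hε),
    (tendsto_exp_mul_sq hn (show r / 2 < 0 by linarith)).eventually
      (ge_mem_nhds (show (0 : ℝ) < 1 / 2 by norm_num)),
    (hμx U hU).eventually (lt_mem_nhds (show ENNReal.ofReal (1 / 2) < 1 by
      rw [← ENNReal.ofReal_one]
      exact (ENNReal.ofReal_lt_ofReal_iff one_pos).2 h2))] with k hk hTk hnk he1 he2 hμk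
  have : NeZero (n k) := ⟨by omega⟩
  have hntr := isTracialState_ntr (n := n k)
  have hnpos : (0 : ℝ) < (n k : ℝ) ^ 2 := by
    have : (0 : ℝ) < n k := by exact_mod_cast hnk
    positivity
  have hα := lt_ofReal_exp_of_log_lt hnpos hk
  obtain ⟨T, hTcard, hT, hTcov⟩ := hTk
  obtain ⟨D, hD, hDμ⟩ := exists_lt_measure_of_cover (μ := μ k) (G := microstates R (C k) U) (T := T)
    (E := fun D => {A | A ∈ matBall R (n k) ∧
      twoNorm (ntr (n k)) ((matEval R f (n k) A).toMat j - D) < ε / 2}) hTcard hα.le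
    (fun A hA => by
      obtain ⟨D, hD, h⟩ := hTcov A hA
      exact Set.mem_biUnion hD ⟨hA.1, h⟩)
    (lt_of_le_of_lt (ENNReal.ofReal_le_ofReal (by
      rw [← Real.exp_add, show -(r / 2) * (n k : ℝ) ^ 2 + r * (n k : ℝ) ^ 2 =
        r / 2 * (n k : ℝ) ^ 2 by ring]
      exact he2)) hμk)
  refine ⟨⟨D, (hT D hD).1⟩, (hT D hD).2, ?_⟩
  have h1 := measure_compl_nbhd_nbhd_le hDμ
  refine (measure_mono (t := (nbhd F (δ / 2) (nbhd F (δ / 2) {A | A ∈ matBall R (n k) ∧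
      twoNorm (ntr (n k)) ((matEval R f (n k) A).toMat j - D) < ε / 2}))ᶜ ∪ (matBall R (n k))ᶜ)
      ?_).trans ((measure_union_le _ _).trans ?_)
  · rw [← Set.compl_inter, Set.compl_subset_compl]
    -- `A` is within `δ` of some `A₂` whose value is within `ε / 2` of `D`; uniform continuity adds
    -- at most another `ε / 2`.
    rintro A ⟨⟨A₁, ⟨A₂, ⟨hA₂, hA₂D⟩, h21⟩, h1A⟩, hA⟩
    refine ⟨hA, ?_⟩
    have h3 := hFδ (n k) A₂ A hA₂ hA fun i hi => by
      have := hntr.twoNorm_sub_le (A₂.toMat i) (A₁.toMat i) (A.toMat i)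
      linarith [h21 i hi, h1A i hi]
    have h4 := hntr.twoNorm_sub_le D ((matEval R f (n k) A₂).toMat j) ((matEval R f (n k) A).toMat j)
    rw [hntr.twoNorm_sub_comm D ((matEval R f (n k) A₂).toMat j)] at h4
    change twoNorm (ntr (n k)) (D - (matEval R f (n k) A).toMat j) < ε
    linarith
  · rw [hμR, add_zero]
    exact h1.trans (hα.le.trans (ENNReal.ofReal_le_ofReal he1))

/-- If each coordinate of `g` is concentrated, its distribution is concentrated on neighborhoods. -/
theorem tendsto_map_nbhd {I : Type v} {I' : Type w} {n : ℕ → ℕ}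
    {μ : ∀ k, Measure (MatTuple I (n k))} [∀ k, IsProbabilityMeasure (μ k)]
    {g : ∀ k, MatTuple I (n k) → MatTuple I' (n k)} (hg : ∀ᶠ k in atTop, AEMeasurable (g k) (μ k))
    {B : ∀ k, MatTuple I' (n k)} (S : ∀ k, Set (MatTuple I (n k)))
    (hB : ∀ j, ∀ ε : ℝ, 0 < ε → ∀ᶠ k in atTop, μ k {A | A ∈ S k ∧
      twoNorm (ntr (n k)) ((B k).toMat j - (g k A).toMat j) < ε}ᶜ ≤ ENNReal.ofReal ε)
    (F : Finset I') {ε : ℝ} (hε : 0 < ε) :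
    Tendsto (fun k => (μ k).map (g k) (nbhd F ε {B k})) atTop (𝓝 1) := by
  let G (j : I') (k : ℕ) : Set (MatTuple I (n k)) :=
    {A | A ∈ S k ∧ twoNorm (ntr (n k)) ((B k).toMat j - (g k A).toMat j) < ε}
  have hG : ∀ j, Tendsto (fun k => μ k (G j k)ᶜ) atTop (𝓝 0) := by
    intro j
    rw [ENNReal.tendsto_nhds_zero]
    intro c hc
    obtain ⟨c', hc', hc'c⟩ : ∃ c' : ℝ, 0 < c' ∧ ENNReal.ofReal c' ≤ c := by
      obtain ⟨d, hd, hdc⟩ := ENNReal.lt_iff_exists_nnreal_btwn.1 hc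
      exact ⟨d, by exact_mod_cast hd, by simpa using hdc.le⟩
    -- In `hB` one parameter is both the radius and the bound on the measure; the minimum serves
    -- both purposes.
    filter_upwards [hB j (min ε c') (lt_min hε hc')] with k hk
    refine (measure_mono (Set.compl_subset_compl.2 ?_)).trans
      (hk.trans ((ENNReal.ofReal_le_ofReal (min_le_right _ _)).trans hc'c))
    exact fun A hA => ⟨hA.1, hA.2.trans_le (min_le_left _ _)⟩
  have hsum : Tendsto (fun k => ∑ j ∈ F, μ k (G j k)ᶜ) atTop (𝓝 0) := by
    simpa using tendsto_finsetSum F fun j _ => hG j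
  have hlow : Tendsto (fun k => 1 - ∑ j ∈ F, μ k (G j k)ᶜ) atTop (𝓝 1) := by
    simpa using ENNReal.Tendsto.sub tendsto_const_nhds hsum (Or.inl ENNReal.one_ne_top)
  refine tendsto_of_tendsto_of_tendsto_of_le_of_le' hlow tendsto_const_nhds ?_ ?_
  · filter_upwards [hg] with k hk
    rw [Measure.map_apply_of_aemeasurable hk (isOpen_nbhd F ε _).measurableSet, tsub_le_iff_right]
    -- Only monotonicity and subadditivity are used, so the sets `G j k` need not be measurable.
    have hcov : (Set.univ : Set (MatTuple I (n k))) ⊆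
        g k ⁻¹' nbhd F ε {B k} ∪ ⋃ j ∈ F, (G j k)ᶜ := by
      intro A _
      by_cases hA : A ∈ ⋃ j ∈ F, (G j k)ᶜ
      · exact Or.inr hA
      · refine Or.inl ⟨B k, rfl, fun j hj => ?_⟩
        by_contra hcon
        exact hA (Set.mem_biUnion hj fun h => hcon h.2)
    calc (1 : ℝ≥0∞) = μ k Set.univ := measure_univ.symm
      _ ≤ _ := measure_mono hcov
      _ ≤ _ := measure_union_le _ _
      _ ≤ _ := by
        gcongr
        exact measure_biUnion_finset_le _ _
  · filter_upwards [hg] with k hk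
    have := Measure.isProbabilityMeasure_map hk
    exact prob_le_one

end Concentration

end Microstate

end

theorem mainTheorem7
    {H : Type*} [NormedAddCommGroup H] [InnerProductSpace ℂ H] [CompleteSpace H]
    (M : VonNeumannAlgebra H) (τ : M.toStarSubalgebra →ₗ[ℂ] ℂ)
    (hτ : Microstate.IsFaithfulNormalTrace M τ)
    {I I' : Type*}
    (x : I → M.toStarSubalgebra) (y : I' → M.toStarSubalgebra) (z : M.toStarSubalgebra)
    (hx : ∀ i, IsSelfAdjoint (x i)) (hxM : Microstate.tupleVN x = M)
    (hy : ∀ j, IsSelfAdjoint (y j))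
    (hz : Microstate.IsDiffuse τ z)
    (hN : Microstate.HasOneBoundedEntropy τ
      (Microstate.tupleVN (Microstate.join₂ y z)) 0)
    (R : I → ℝ) (R' : I' → ℝ) (R₀ : ℝ)
    (hxR : ∀ i, ‖x i‖ < R i) (hyR : ∀ j, ‖y j‖ < R' j) (hzR : ‖z‖ < R₀)
    (f : I' → ℕ → Microstate.SimpleFun R) (hf : f ∈ Microstate.FunTuples R R')
    (hfx : ∀ j, Microstate.HasValue R τ x (f j) (y j))
    (n : ℕ → ℕ) (hn : Filter.Tendsto n Filter.atTop Filter.atTop)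
    (C : ∀ k, selfAdjoint (Microstate.Mat (n k)))
    (hCR : ∀ k, Microstate.opNorm (C k : Microstate.Mat (n k)) < R₀)
    (hC : Microstate.IsMicrostateSeq τ z n C)
    (μ : ∀ k, MeasureTheory.Measure (Microstate.MatTuple I (n k)))
    (hμ : ∀ k, MeasureTheory.IsProbabilityMeasure (μ k))
    (hμR : ∀ k, μ k (Microstate.matBall R (n k))ᶜ = 0)
    (hμx : ∀ U ∈ nhdsWithin (Microstate.law τ (Microstate.join₂ x z))
        (Microstate.lawSpace (Microstate.join₂ R R₀)),
      Filter.Tendsto (fun k => μ k (Microstate.microstates R (C k) U)) Filter.atTop (nhds 1))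
    (hconc : Microstate.ExponentialConcentration n μ) :
    ∃ B : ∀ k, Microstate.MatTuple I' (n k),
      (∀ k, B k ∈ Microstate.matBall R' (n k)) ∧
      ∀ (F : Finset I') (ε : ℝ), 0 < ε →
        Filter.Tendsto
          (fun k => (μ k).map (Microstate.matEval R f (n k)) (Microstate.nbhd F ε {B k}))
          Filter.atTop (nhds 1) := by
  have hne : ∀ j k, Nonempty {D : selfAdjoint (Microstate.Mat (n k)) //
      Microstate.opNorm (D : Microstate.Mat (n k)) ≤ R' j} := fun j k => by
    refine ⟨⟨0, ?_⟩⟩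
    simpa [Microstate.opNorm] using ((norm_nonneg _).trans_lt (hyR j)).le
  have hB := fun j => Microstate.exists_seq_of_eventually_exists
    -- The norm bound is built into the type, so that it holds at every `k`, also where no
    -- concentrated center exists; the zero matrix is available as a default.
    (α := fun k => {D : selfAdjoint (Microstate.Mat (n k)) //
      Microstate.opNorm (D : Microstate.Mat (n k)) ≤ R' j})
    (P := fun k ε D => μ k {A | A ∈ Microstate.matBall R (n k) ∧
      Microstate.twoNorm (Microstate.ntr (n k)) ((D.1 : Microstate.Mat (n k)) -
        (Microstate.matEval R f (n k) A).toMat j) < ε}ᶜ ≤ ENNReal.ofReal ε)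
    (fun k D ε ε' hεε' h => by
      refine (MeasureTheory.measure_mono (Set.compl_subset_compl.2 ?_)).trans
        (h.trans (ENNReal.ofReal_le_ofReal hεε'))
      exact fun A hA => ⟨hA.1, hA.2.trans_le hεε'⟩)
    (fun ε hε => by
      filter_upwards [Microstate.eventually_exists_concentrated hτ hx hxM hz hN hxR hzR hf
        ((norm_nonneg _).trans_lt (hyR j)) (hfx j) hn (fun k => (hCR k).le) hC hμR
        (fun U hU => hμx U (mem_nhdsWithin_of_mem_nhds hU)) hconc hε] with k hk
      obtain ⟨D, hD, h⟩ := hk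
      exact ⟨⟨D, hD⟩, h⟩)
  choose B hB using hB
  refine ⟨fun k j => (B j k).1, fun k j => (B j k).2, fun F ε hε => ?_⟩
  refine Microstate.tendsto_map_nbhd ?_ (fun k => Microstate.matBall R (n k)) hB F hε
  -- Size `0` can occur for only finitely many `k`.
  filter_upwards [hn.eventually_ge_atTop 1] with k hk
  have : NeZero (n k) := ⟨by omega⟩
  exact Microstate.aemeasurable_matEval hf (hμR k)
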